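/- Let $I,J\ge 1$ and $M_i\ge 0$ $(1\le i\le I)$, $N_1\ge N_2\ge\dots\ge N_J\ge 0$ be integers, and let $\varepsilon,\delta\ge 0$ be rational numbers such that $(\varepsilon,\delta)$ is nondegenerate: $\nu\varepsilon+2-\frac{l}{[\delta]+1}\delta\ne 0$ for all integers $0\le\nu\le\max_i M_i$ and $0\le l\le([\delta]+1)\max_j N_j$, where $[\delta]$ is the integer part of $\delta$. Let $\mathcal B$ be the set of all complex vectors $b=(b'_{i,\mu},b''_{j,\nu})$, $1\le i\le I$, $0\le\mu\le M_i$, $1\le j\le J$, $0\le\nu\le N_j$, such that some $b'_{i,\mu}\ne 0$. For $b\in\mathcal B$ put $P_i(b;z)=\sum_{\mu}b'_{i,\mu}z^\mu$, $Q_j(b;z)=\sum_\nu b''_{j,\nu}z^\nu$ and $$R_b(z)=\frac{\left(\sum_{i}|P_i(b;z)|^2\right)^{\varepsilon/2}}{\left(\sum_{j}|Q_j(b;z)|^2\right)^{\delta/2}} .$$ An absolute rational power (ARP) with integer coefficients in variables $B$ is an expression $T=K/L$ with $K=(\sum_i|p_i(B)|^2)^{e/2}$, $L=(\sum_j|q_j(B)|^2)^{d/2}$,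 where the sums are finite, $p_i,q_j\in\mathbb Z[B]$, some $p_i\neq 0$, and $e,d\ge 0$ are rational (an exponent $0$ gives the constant $1$). Its domain is the set where $K\ne 0$; there it takes values in $(0,\infty]$, with value $\infty$ where $L=0$. For a polynomial $Q$ let $|||Q|||$ be the sum of the absolute values of its coefficients. A subset of $\mathcal B$ is called algebraic if it is the set of common zeros in $\mathcal B$ of finitely many polynomials with complex coefficients. **Theorem.** There exist a real number $s\in(0,1)$, a finite strictly decreasing chain of algebraic subsets of $\mathcal B$ $$\mathcal B=U_0\supset U_1\supset\dots\supset U_{\mathcal N}=\emptyset ,$$ and ARPs $T_\lambda=K_\lambda/L_\lambda$ $(0\le\lambda\le\mathcal N-1)$ with integer coefficients in the variables $b'_{i,\mu},b''_{j,\nu}$ such that: 1. If $b\in U_\lambda\setminus U_{\lambda+1}$, then $K_\lambda(b)\ne 0$; in particular $T_\lambda$ is defined and nowhere vanishing on $U_\lambda\setminus U_{\lambda+1}$. 2. For every $C>0$ there is a constant $A$, depending only on $I,J,M_i,N_j,\varepsilon,\delta,C$, such that for every $\lambda$ and every $b\in U_\lambda\setminus U_{\lambda+1}$ with $|||Q_1(b;z)-z^{N_1}|||<s$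 and $|||Q_j(b;z)|||<C$ for all $j>1$, the point $b$ is in the domain of $T_\lambda$ and, in $[0,\infty]$, $$A^{-1}\,T_\lambda(b)\le\int_{|z|<1}R_b(z)\,dV\le A\,T_\lambda(b);$$ in particular the two sides are finite or infinite together. 3. For every $0\le\lambda\le\mathcal N-1$, $$U_{\lambda+1}=\{b\in U_\lambda: K_\lambda(b)=0\}=\{b\in U_\lambda: K_\lambda(b)=0\text{ and }L_\lambda(b)=0\}.$$ -/

import Mathlib

open MeasureTheory
open scoped ENNReal NNReal

noncomputable section

/-- The quantity `(|v₁|² + ⋯ + |vₙ|²)^(e/2)`; the exponent `0` gives the constant `1`. -/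
def absPower {n : ℕ} (v : Fin n → ℂ) (e : ℚ) : ℝ :=
  (∑ i, ‖v i‖ ^ 2) ^ ((e : ℝ) / 2)

/-- An absolute rational power in the variables `σ` with coefficients in `A`: a formal expression
`(∑ᵢ |Pᵢ|²)^(ε/2) / (∑ⱼ |Qⱼ|²)^(δ/2)` with polynomials `Pᵢ`, `Qⱼ` over `A`, nonnegative rational
exponents `ε`, `δ`, and at least one nonzero `Pᵢ`. -/
structure ARP (A : Type*) [CommRing A] (σ : Type*) where
  /-- number of terms in the numerator -/
  numCard : ℕ
  /-- number of terms in the denominator -/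
  denCard : ℕ
  /-- the polynomials in the numerator -/
  num : Fin numCard → MvPolynomial σ A
  /-- the polynomials in the denominator -/
  den : Fin denCard → MvPolynomial σ A
  /-- the exponent of the numerator -/
  numExp : ℚ
  /-- the exponent of the denominator -/
  denExp : ℚ
  numExp_nonneg : 0 ≤ numExp
  denExp_nonneg : 0 ≤ denExp
  exists_num_ne_zero : ∃ i, num i ≠ 0

namespace ARP

variable {A : Type*} [CommRing A] [Algebra A ℂ] {σ : Type*}

/-- The value of the numerator at `b`. -/
def K (T : ARP A σ) (b : σ → ℂ) : ℝ :=
  absPower (fun i => MvPolynomial.aeval b (T.num i)) T.numExp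

/-- The value of the denominator at `b`. -/
def L (T : ARP A σ) (b : σ → ℂ) : ℝ :=
  absPower (fun j => MvPolynomial.aeval b (T.den j)) T.denExp

/-- The domain of an ARP: the complement of the zero set of the numerator. -/
def domain (T : ARP A σ) : Set (σ → ℂ) := {b | T.K b ≠ 0}

/-- The value `K(b)/L(b)` in `[0, ∞]`; on the domain it lies in `(0, ∞]`, and it is `∞` where
`L(b) = 0`. -/
def value (T : ARP A σ) (b : σ → ℂ) : ℝ≥0∞ :=
  ENNReal.ofReal (T.K b) / ENNReal.ofReal (T.L b)

end ARP

/-- The indices of the coefficients `b'_{i,μ}`, `0 ≤ μ ≤ Mᵢ`, and `b''_{j,ν}`, `0 ≤ ν ≤ Nⱼ`. -/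
abbrev CoeffIndex {I J : ℕ} (M : Fin I → ℕ) (N : Fin J → ℕ) : Type :=
  (Σ i : Fin I, Fin (M i + 1)) ⊕ (Σ j : Fin J, Fin (N j + 1))

section CoefficientSpace

variable {I J : ℕ} (M : Fin I → ℕ) (N : Fin J → ℕ)

/-- The coefficient space: all `b = (b', b'')` with some `b'_{i,μ} ≠ 0`. -/
def coeffSpace : Set (CoeffIndex M N → ℂ) :=
  {b | ∃ x : Σ i : Fin I, Fin (M i + 1), b (Sum.inl x) ≠ 0}

variable {M N}

/-- The polynomial `Pᵢ(b; Z) = ∑ b'_{i,μ} Z^μ`. -/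
def polyP (b : CoeffIndex M N → ℂ) (i : Fin I) : Polynomial ℂ :=
  ∑ μ : Fin (M i + 1), Polynomial.C (b (Sum.inl ⟨i, μ⟩)) * Polynomial.X ^ (μ : ℕ)

/-- The polynomial `Qⱼ(b; Z) = ∑ b''_{j,ν} Z^ν`. -/
def polyQ (b : CoeffIndex M N → ℂ) (j : Fin J) : Polynomial ℂ :=
  ∑ ν : Fin (N j + 1), Polynomial.C (b (Sum.inr ⟨j, ν⟩)) * Polynomial.X ^ (ν : ℕ)

/-- The function `R_b(z) = (∑ᵢ |Pᵢ(b; z)|²)^(ε/2) / (∑ⱼ |Qⱼ(b; z)|²)^(δ/2)`, with values in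
`[0, ∞]`. -/
def ratPower (ε δ : ℚ) (b : CoeffIndex M N → ℂ) (z : ℂ) : ℝ≥0∞ :=
  ENNReal.ofReal (absPower (fun i => (polyP b i).eval z) ε) /
    ENNReal.ofReal (absPower (fun j => (polyQ b j).eval z) δ)

variable (M N)

/-- Nondegeneracy of `(ε, δ)`: `νε + 2 - lδ/([δ] + 1) ≠ 0` for all integers
`0 ≤ ν ≤ max Mᵢ` and `0 ≤ l ≤ ([δ] + 1) max Nⱼ`. -/
def Nondegenerate (ε δ : ℚ) : Prop :=
  ∀ i j, ∀ ν ≤ M i, ∀ l ≤ (⌊δ⌋₊ + 1) * N j,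
    (ν : ℚ) * ε + 2 - (l : ℚ) / ((⌊δ⌋₊ : ℚ) + 1) * δ ≠ 0

end CoefficientSpace

/-- The norm `|||Q|||`: the sum of the absolute values of the coefficients. -/
def polyNorm (Q : Polynomial ℂ) : ℝ := ∑ k ∈ Q.support, ‖Q.coeff k‖

/-- `U` is an algebraic subvariety of `X ⊆ ℂ^σ`: the set of the points of `X` at which finitely
many polynomials with complex coefficients vanish. -/
def IsAlgebraicIn {σ : Type*} (X U : Set (σ → ℂ)) : Prop :=
  ∃ S : Finset (MvPolynomial σ ℂ), U = {b ∈ X | ∀ f ∈ S, MvPolynomial.eval b f = 0}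

end

/-! Indices j start at 0 here, so the polynomial close to a power of z is `Q 0`. Call the roots of z
Q_0 and of all z Q_0 + Q_j (j ≠ 0) the centers. The degree of Q_j may drop, but where the leading
coefficient of Q_0 does not vanish these polynomials all have degree N_0 + 1 and that same leading
coefficient. Hence the number of centers is constant, and they stay bounded under the hypotheses on
b.

Cut the unit disc into cells, a cell consisting of the points nearest to one center α. On its cell
every root is at least as far away as α, so each of these polynomials dominates all terms of its
Taylor expansion at α (`mul_taylorNorm_le_norm_eval`). Consequently the denominator of R_b dominates
every (q_l |w|^l)^δ, where w = z - α and the q_l are the absolute Taylor coefficients of the Q_j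
(`localCoeff_mul_pow_le`). What remains are radial integrals of |w|^(κ-2) min (q_l |w|^l)^(-δ) with
κ = νε + 2, weighted by X = |P_i^(ν)(α)/ν!|^ε. Nondegeneracy says κ ≠ lδ, which excludes logarithms,
and the radial integral is bounded by a multiple of 1/Y with Y a sum of products of powers of two of
the q_l (`lintegral_le_balance`). Conversely, at a well chosen radius (`exists_radius`) a ball
contributes at least a multiple of X/Y to the integral. So the integral is comparable to ∑ X_k/Y_k
over all pairs k of a center and a Taylor index (`exists_integral_equiv`).

Some Y_k may vanish, so no single common denominator works. Put S_n = ∑ X_{k_0} Y_{k_1} ⋯ Y_{k_n}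
and T_n = ∑ Y_{k_0} ⋯ Y_{k_n}, over tuples of distinct indices. For the largest n with S_n ≠ 0 the
quotient S_n/T_n is comparable to ∑ X_k/Y_k, infinite values included (`exists_sum_div_equiv`).

Finally S_n and T_n are sums of a fixed power of absolute values of polynomials in the centers, and
permutations of the centers permute these polynomials. Such a sum is comparable to an absolute power
of their elementary symmetric functions, and these are, up to powers of the leading coefficient,
integer polynomials in b (`exists_absPower_descent`). This gives K_n and L_n. The chain imposes the
equations K_n = 0 one after the other, from the largest n down. Once all hold the leading
coefficient is zero, which Q_0 near z^{N_0} rules out. -/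

noncomputable section

/-! ### Sums of quotients with possibly vanishing denominators -/

section Strata

open scoped Classical in
/-- The sum over the injective `(n+1)`-tuples `e` of `X (e 0) * ∏_{i ≥ 1} Y (e i)`. -/
def stratNum {κ : Type*} [Fintype κ] (X Y : κ → ℝ≥0) (n : ℕ) : ℝ≥0 :=
  ∑ e : Fin (n + 1) ↪ κ, X (e 0) * ∏ i : Fin n, Y (e i.succ)

open scoped Classical in
/-- The sum over the injective `(n+1)`-tuples `e` of `∏ᵢ Y (e i)`. -/
def stratDen {κ : Type*} [Fintype κ] (Y : κ → ℝ≥0) (n : ℕ) : ℝ≥0 :=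
  ∑ e : Fin (n + 1) ↪ κ, ∏ i, Y (e i)

variable {κ : Type*} [Fintype κ] {X Y : κ → ℝ≥0} {n : ℕ}

lemma stratNum_ne_zero_iff :
    stratNum X Y n ≠ 0 ↔ ∃ e : Fin (n + 1) ↪ κ, X (e 0) ≠ 0 ∧ ∀ i : Fin n, Y (e i.succ) ≠ 0 := by
  classical
  simp [stratNum, Finset.sum_eq_zero_iff, Finset.prod_eq_zero_iff]

lemma stratDen_ne_zero_iff :
    stratDen Y n ≠ 0 ↔ ∃ e : Fin (n + 1) ↪ κ, ∀ i, Y (e i) ≠ 0 := by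
  classical
  simp [stratDen, Finset.sum_eq_zero_iff, Finset.prod_eq_zero_iff]

/-- A point together with `n` further points of a large enough finite set. -/
lemma exists_embedding_cons {κ : Type*} (k : κ) (s : Finset κ) (hk : k ∉ s) (h : n ≤ s.card) :
    ∃ e : Fin (n + 1) ↪ κ, e 0 = k ∧ ∀ i : Fin n, e i.succ ∈ s := by
  obtain ⟨t, hts, ht⟩ := Finset.exists_subset_card_eq h
  let f := t.equivFinOfCardEq ht
  refine ⟨⟨Fin.cons k fun i => ((f.symm i : t) : κ), ?_⟩, rfl, fun i => ?_⟩
  · rw [Fin.cons_injective_iff]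
    refine ⟨?_, fun i j hij => f.symm.injective (Subtype.ext hij)⟩
    rintro ⟨i, hi⟩
    exact hk (hi ▸ hts (f.symm i).2)
  · exact hts (f.symm i).2

open scoped Classical in
lemma card_le_of_forall_mem {κ : Type*} {m : ℕ} (e : Fin m ↪ κ) (s : Finset κ)
    (h : ∀ i, e i ∈ s) : m ≤ s.card := by
  have : (Finset.univ.map e) ⊆ s := by
    intro x hx
    obtain ⟨i, -, rfl⟩ := Finset.mem_map.1 hx
    exact h i
  simpa using Finset.card_le_card this

open scoped Classical in
/-- If `X` is nonzero at a zero of `Y`, the last nonzero numerator has as many factors `Y` as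
there are nonzero values of `Y`. -/
lemma stratNum_card_ne_zero {k : κ} (hX : X k ≠ 0) (hY : Y k = 0) :
    stratNum X Y (Finset.univ.filter fun k => Y k ≠ 0).card ≠ 0 ∧
      (Finset.univ.filter fun k => Y k ≠ 0).card < Fintype.card κ := by
  constructor
  · rw [stratNum_ne_zero_iff]
    obtain ⟨e, he, hs⟩ := exists_embedding_cons k (Finset.univ.filter fun k => Y k ≠ 0)
      (by simp [hY]) le_rfl
    exact ⟨e, he ▸ hX, fun i => by simpa using hs i⟩
  · rw [← Finset.card_univ]
    apply Finset.card_lt_card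
    rw [Finset.ssubset_univ_iff]
    intro h
    have := Finset.mem_univ k
    rw [← h] at this
    simp [hY] at this

open scoped Classical in
lemma le_card_of_stratNum_ne_zero (h : stratNum X Y n ≠ 0) :
    n ≤ (Finset.univ.filter fun k => Y k ≠ 0).card := by
  obtain ⟨e, -, he⟩ := stratNum_ne_zero_iff.1 h
  exact card_le_of_forall_mem ((Fin.succEmb n).trans e) _ fun i => by simpa using he i

open scoped Classical in
lemma lt_card_of_stratDen_ne_zero (h : stratDen Y n ≠ 0) :
    n < (Finset.univ.filter fun k => Y k ≠ 0).card := by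
  obtain ⟨e, he⟩ := stratDen_ne_zero_iff.1 h
  exact card_le_of_forall_mem e _ fun i => by simpa using he i

lemma stratDen_ne_zero_of_stratNum (h0 : ∀ k, Y k = 0 → X k = 0) (h : stratNum X Y n ≠ 0) :
    stratDen Y n ≠ 0 := by
  obtain ⟨e, h1, h2⟩ := stratNum_ne_zero_iff.1 h
  refine stratDen_ne_zero_iff.2 ⟨e, fun i => ?_⟩
  induction i using Fin.cases with
  | zero => exact fun h => h1 (h0 _ h)
  | succ i => exact h2 i

-- A place where X is nonzero has Y nonzero too. It heads the tuple, and n of the remaining nonzero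
-- values of Y fill the other places.
open scoped Classical in
lemma stratNum_ne_zero_of_lt_card (h0 : ∀ k, Y k = 0 → X k = 0) (hX : ∃ k, X k ≠ 0)
    (h : n < (Finset.univ.filter fun k => Y k ≠ 0).card) : stratNum X Y n ≠ 0 := by
  obtain ⟨k, hk⟩ := hX
  have hk' : Y k ≠ 0 := fun h => hk (h0 k h)
  obtain ⟨e, he, hs⟩ := exists_embedding_cons (n := n) k
    ((Finset.univ.filter fun k => Y k ≠ 0).erase k) (by simp) (by
      rw [Finset.card_erase_of_mem (by simpa using hk')]; omega)
  refine stratNum_ne_zero_iff.2 ⟨e, he ▸ hk, fun i => ?_⟩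
  have := hs i
  simp at this
  exact this.2

/-- If the numerators vanish from level `n` on, so does the denominator at level `n`. -/
lemma stratDen_eq_zero (hX : ∃ k, X k ≠ 0)
    (hz : ∀ m, n ≤ m → m < Fintype.card κ → stratNum X Y m = 0) : stratDen Y n = 0 := by
  classical
  by_contra hL
  have hc := lt_card_of_stratDen_ne_zero hL
  -- More than n values of Y are nonzero. If X vanishes wherever Y does, the numerator at level n is
  -- nonzero; otherwise the numerator at the level counting the nonzero values of Y is.
  by_cases h0 : ∀ k, Y k = 0 → X k = 0
  · exact stratNum_ne_zero_of_lt_card h0 hX hc (hz n le_rfl (hc.trans_le (Finset.card_le_univ _)))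
  · push Not at h0
    obtain ⟨k, hk, hk'⟩ := h0
    obtain ⟨h1, h2⟩ := stratNum_card_ne_zero hk' hk
    exact h1 (hz _ hc.le h2)

/-- Termwise: `X (e 0)` is its quotient by `Y (e 0)` times `Y (e 0)`, and the latter factor
completes the product to a term of the denominator. -/
lemma stratNum_le (h0 : ∀ k, Y k = 0 → X k = 0) :
    stratNum X Y n ≤ (∑ k, X k / Y k) * stratDen Y n := by
  classical
  rw [stratNum, stratDen, Finset.mul_sum]
  refine Finset.sum_le_sum fun e _ => ?_
  rw [Fin.prod_univ_succ, ← mul_assoc]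
  gcongr
  by_cases h : Y (e 0) = 0
  · simp [h0 _ h]
  · calc X (e 0) = X (e 0) / Y (e 0) * Y (e 0) := by field_simp
      _ ≤ _ := by
        gcongr
        exact Finset.single_le_sum (f := fun k => X k / Y k) (fun _ _ => zero_le) (Finset.mem_univ _)

-- When exactly n + 1 values of Y are nonzero, every tuple with nonzero product runs through all of
-- them, hence through k. Replacing the factor `Y k` by `X k` leaves a term of the numerator.
open scoped Classical in
lemma div_mul_stratDen_le
    (hc : (Finset.univ.filter fun k => Y k ≠ 0).card = n + 1) (k : κ) :
    X k / Y k * stratDen Y n ≤ Fintype.card (Fin (n + 1) ↪ κ) * stratNum X Y n := by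
  by_cases hk : Y k = 0
  · simp [hk]
  rw [stratDen, Finset.mul_sum]
  calc _ ≤ ∑ e : Fin (n + 1) ↪ κ, stratNum X Y n := by
        refine Finset.sum_le_sum fun e _ => ?_
        by_cases he : ∃ i, Y (e i) = 0
        · obtain ⟨i, hi⟩ := he
          rw [Finset.prod_eq_zero (Finset.mem_univ i) hi]
          simp
        push Not at he
        have hr : Finset.univ.map e = Finset.univ.filter fun k => Y k ≠ 0 := by
          apply Finset.eq_of_subset_of_card_le
          · intro x hx
            obtain ⟨i, -, rfl⟩ := Finset.mem_map.1 hx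
            simpa using he i
          · simp [hc]
        obtain ⟨i, -, hi⟩ := Finset.mem_map.1 (show k ∈ Finset.univ.map e by
          rw [hr]; simpa using hk)
        -- The swap moves k to the distinguished first place without changing the product.
        let f : Fin (n + 1) ↪ κ := (Equiv.swap 0 i).toEmbedding.trans e
        have hf0 : f 0 = k := by simpa [f] using hi
        have hprod : ∏ j, Y (e j) = Y k * ∏ j : Fin n, Y (f j.succ) := by
          rw [← hf0, ← Fin.prod_univ_succ (fun j => Y (f j))]
          exact (Equiv.prod_comp (Equiv.swap 0 i) fun j => Y (e j)).symm
        rw [hprod, ← mul_assoc, div_mul_cancel₀ _ hk, ← hf0]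
        exact Finset.single_le_sum
          (f := fun f : Fin (n + 1) ↪ κ => X (f 0) * ∏ i : Fin n, Y (f i.succ))
          (fun _ _ => zero_le) (Finset.mem_univ f)
    _ = _ := by simp

/-- At the first level where the numerator does not vanish, the quotient is comparable to
`∑ X / Y`. -/
lemma exists_sum_div_equiv (κ : Type*) [Fintype κ] (n : ℕ) : ∃ A : ℝ≥0, ∀ X Y : κ → ℝ≥0,
    (∀ m, n < m → m < Fintype.card κ → stratNum X Y m = 0) → stratNum X Y n ≠ 0 →
    ∑ k, (X k : ℝ≥0∞) / Y k ≤ A * (stratNum X Y n / stratDen Y n) ∧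
    (stratNum X Y n / stratDen Y n : ℝ≥0∞) ≤ A * ∑ k, (X k : ℝ≥0∞) / Y k := by
  classical
  refine ⟨Fintype.card κ * Fintype.card (Fin (n + 1) ↪ κ) + 1, fun X Y hz hn => ?_⟩
  have hnc := le_card_of_stratNum_ne_zero hn
  by_cases h0 : ∀ k, Y k = 0 → X k = 0
  · have hL := stratDen_ne_zero_of_stratNum h0 hn
    have hlt := lt_card_of_stratDen_ne_zero hL
    -- With more than n + 1 nonzero values of Y the numerator at level n + 1 would not vanish.
    have hc : (Finset.univ.filter fun k => Y k ≠ 0).card = n + 1 := by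
      by_contra hne
      have hX : ∃ k, X k ≠ 0 := by
        obtain ⟨e, h, -⟩ := stratNum_ne_zero_iff.1 hn
        exact ⟨_, h⟩
      refine stratNum_ne_zero_of_lt_card (n := n + 1) h0 hX (by omega) (hz _ (by omega) ?_)
      have := Finset.card_le_univ (Finset.univ.filter fun k => Y k ≠ 0)
      omega
    have hsum : ∑ k, (X k : ℝ≥0∞) / Y k = ((∑ k, X k / Y k : ℝ≥0) : ℝ≥0∞) := by
      push_cast
      refine Finset.sum_congr rfl fun k _ => ?_
      by_cases hk : Y k = 0
      · simp [hk, h0 k hk]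
      · rw [ENNReal.coe_div hk]
    rw [hsum, ← ENNReal.coe_div hL, ← ENNReal.coe_mul, ← ENNReal.coe_mul, ENNReal.coe_le_coe,
      ENNReal.coe_le_coe]
    constructor
    · rw [← mul_div_assoc, le_div_iff₀ (pos_iff_ne_zero.2 hL), Finset.sum_mul]
      calc _ ≤ ∑ k : κ, (Fintype.card (Fin (n + 1) ↪ κ) : ℝ≥0) * stratNum X Y n :=
            Finset.sum_le_sum fun k _ => div_mul_stratDen_le hc k
        _ = Fintype.card κ * Fintype.card (Fin (n + 1) ↪ κ) * stratNum X Y n := by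
            simp [mul_assoc]
        _ ≤ _ := by gcongr; simp
    · rw [div_le_iff₀ (pos_iff_ne_zero.2 hL)]
      refine (stratNum_le h0).trans ?_
      gcongr
      exact le_mul_of_one_le_left zero_le (by simp)
  · push Not at h0
    obtain ⟨k, hk, hk'⟩ := h0
    obtain ⟨h1, h2⟩ := stratNum_card_ne_zero hk' hk
    -- The numerator at the level counting the nonzero values of Y is nonzero, so that level is at
    -- most n. No n + 1 values of Y are then nonzero together, the denominator is zero, and both
    -- sides are infinite.
    have hle : (Finset.univ.filter fun k => Y k ≠ 0).card ≤ n := by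
      by_contra hlt
      exact h1 (hz _ (by omega) h2)
    have hL : stratDen Y n = 0 := by
      by_contra hL
      have := lt_card_of_stratDen_ne_zero hL
      omega
    have hS : ∑ k, (X k : ℝ≥0∞) / Y k = ⊤ := by
      rw [ENNReal.sum_eq_top]
      exact ⟨k, Finset.mem_univ _, by simp [hk, ENNReal.div_zero, hk']⟩
    have hQ : (stratNum X Y n / stratDen Y n : ℝ≥0∞) = ⊤ := by
      rw [hL, ENNReal.coe_zero, ENNReal.div_zero (by simpa using hn)]
    have hA : ((Fintype.card κ * Fintype.card (Fin (n + 1) ↪ κ) + 1 : ℝ≥0) : ℝ≥0∞) ≠ 0 := by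
      rw [ENNReal.coe_ne_zero]; positivity
    rw [hS, hQ, ENNReal.mul_top hA]
    simp

end Strata

/-! ### Symmetric functions of the roots and their descent to the coefficients -/

section Symmetric

variable {R : Type*} [CommRing R] {D : ℕ}

/-- `α` is the family of the roots of the polynomial `H`, with leading coefficient `lc`,
specialized by `ψ`. -/
def IsRootFamily (H : Polynomial R) (lc : R) (ψ : R →+* ℂ) (α : Fin D → ℂ) : Prop :=
  H.map ψ = Polynomial.C (ψ lc) * ∏ i, (Polynomial.X - Polynomial.C (α i))

/-- A symmetric polynomial in the roots of `H` is, up to a power of the leading coefficient of `H`,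
a polynomial in the coefficients of `H`. -/
lemma exists_descent (H : Polynomial R) (lc : R) (f : MvPolynomial (Fin D) R)
    (hf : f.IsSymmetric) : ∃ (g : R) (n : ℕ), ∀ (ψ : R →+* ℂ) (α : Fin D → ℂ),
      IsRootFamily H lc ψ α → ψ g = ψ lc ^ n * MvPolynomial.eval₂Hom ψ α f := by
  obtain ⟨p, hp⟩ := MvPolynomial.esymmAlgHom_surjective (σ := Fin D) (R := R) (n := D)
    (by simp) ⟨f, hf⟩
  have hp' : f = MvPolynomial.aeval (fun i : Fin D => MvPolynomial.esymm (Fin D) R (i + 1)) p := by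
    have := congrArg Subtype.val hp
    rw [MvPolynomial.esymmAlgHom_apply] at this
    exact this.symm
  rw [hp']
  clear hp hp' hf f
  induction p using MvPolynomial.induction_on with
  | C r => exact ⟨r, 0, fun ψ α _ => by simp [MvPolynomial.algebraMap_eq]⟩
  | add p q hp hq =>
    obtain ⟨g, n, hg⟩ := hp
    obtain ⟨g', n', hg'⟩ := hq
    -- Crosswise powers of the leading coefficient bring both summands to the same exponent.
    refine ⟨lc ^ n' * g + lc ^ n * g', n + n', fun ψ α h => ?_⟩
    simp only [map_add, map_mul, map_pow, hg ψ α h, hg' ψ α h]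
    ring
  | mul_X p i hp =>
    obtain ⟨g, n, hg⟩ := hp
    -- By Vieta the coefficient of index D - (i + 1) is, up to sign, the leading coefficient times
    -- the elementary symmetric function of degree i + 1. Each such factor costs one power of `lc`.
    refine ⟨(-1) ^ ((i : ℕ) + 1) * H.coeff (D - (i + 1)) * g, n + 1, fun ψ α h => ?_⟩
    have h1 : ψ (H.coeff (D - (i + 1))) = ψ lc * ((-1) ^ ((i : ℕ) + 1) *
        MvPolynomial.eval₂Hom ψ α (MvPolynomial.esymm (Fin D) R (i + 1))) := by
      rw [← Polynomial.coeff_map, h, Polynomial.coeff_C_mul]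
      congr 1
      have h2 := Multiset.prod_X_sub_C_coeff (Finset.univ.val.map α) (k := D - (i + 1)) (by simp)
      rw [Multiset.map_map] at h2
      have h3 : Multiset.card (Finset.univ.val.map α) - (D - (i + 1)) = (i : ℕ) + 1 := by
        have := i.2
        simp only [Multiset.card_map, Finset.card_val, Finset.card_univ, Fintype.card_fin]
        omega
      rw [h3, Finset.esymm_map_val] at h2
      have h4 : (Multiset.map ((fun t => Polynomial.X - Polynomial.C t) ∘ α) Finset.univ.val).prod =
        ∏ i, (Polynomial.X - Polynomial.C (α i)) := rfl
      rw [← h4, MvPolynomial.esymm]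
      exact h2.trans (by simp)
    simp only [map_mul, hg ψ α h, h1, map_pow, map_neg, map_one, MvPolynomial.aeval_X]
    have h4 : ((-1 : ℂ) ^ ((i : ℕ) + 1)) * (-1) ^ ((i : ℕ) + 1) = 1 := by
      rw [← mul_pow]; simp
    linear_combination (ψ lc ^ (n + 1) * (MvPolynomial.eval₂Hom ψ α)
      (MvPolynomial.aeval (fun i : Fin D => MvPolynomial.esymm (Fin D) R (i + 1)) p) *
      (MvPolynomial.eval₂Hom ψ α) (MvPolynomial.esymm (Fin D) R (i + 1))) * h4

/-- The elementary symmetric functions of a finite family. -/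
lemma aeval_esymm_isSymmetric {ι : Type*} [Fintype ι] (κ : ι → MvPolynomial (Fin D) R)
    (hκ : ∀ s : Equiv.Perm (Fin D), ∃ τ : Equiv.Perm ι, ∀ i, MvPolynomial.rename s (κ i) = κ (τ i))
    (k : ℕ) : (MvPolynomial.aeval κ (MvPolynomial.esymm ι R k)).IsSymmetric := by
  intro s
  obtain ⟨τ, hτ⟩ := hκ s
  have h1 : MvPolynomial.rename s (MvPolynomial.aeval κ (MvPolynomial.esymm ι R k)) =
      MvPolynomial.aeval (fun i => MvPolynomial.rename s (κ i)) (MvPolynomial.esymm ι R k) := by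
    rw [← AlgHom.comp_apply, MvPolynomial.comp_aeval]
  rw [h1]
  simp_rw [hτ]
  conv_rhs => rw [← MvPolynomial.esymm_isSymmetric ι R k τ, MvPolynomial.aeval_rename]
  rfl

lemma eval_aeval_esymm {ι : Type*} [Fintype ι] (κ : ι → MvPolynomial (Fin D) R) (ψ : R →+* ℂ)
    (α : Fin D → ℂ) (k : ℕ) :
    MvPolynomial.eval₂Hom ψ α (MvPolynomial.aeval κ (MvPolynomial.esymm ι R k)) =
      ∑ t ∈ Finset.powersetCard k Finset.univ, ∏ i ∈ t, MvPolynomial.eval₂Hom ψ α (κ i) := by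
  simp only [MvPolynomial.esymm, map_sum, map_prod, MvPolynomial.aeval_X]

/-- A bound for the elementary symmetric functions. -/
lemma norm_esymm_le {ι : Type*} [Fintype ι] (z : ι → ℂ) (m : ℝ) (hm : 0 ≤ m)
    (hz : ∀ i, ‖z i‖ ≤ m) (k : ℕ) :
    ‖∑ t ∈ Finset.powersetCard k Finset.univ, ∏ i ∈ t, z i‖ ≤ 2 ^ Fintype.card ι * m ^ k := by
  calc _ ≤ ∑ t ∈ Finset.powersetCard k (Finset.univ : Finset ι), m ^ k := by
        refine (norm_sum_le _ _).trans (Finset.sum_le_sum fun t ht => ?_)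
        rw [norm_prod, ← (Finset.mem_powersetCard.1 ht).2]
        calc ∏ i ∈ t, ‖z i‖ ≤ ∏ i ∈ t, m := Finset.prod_le_prod (fun _ _ => norm_nonneg _)
              fun i _ => hz i
          _ = _ := by simp
    _ = (Fintype.card ι).choose k * m ^ k := by simp
    _ ≤ _ := by
      gcongr
      exact_mod_cast Nat.choose_le_two_pow _ _

/-- Each of finitely many numbers is controlled by their elementary symmetric functions. -/
lemma exists_pow_le_norm_esymm {ι : Type*} [Fintype ι] (z : ι → ℂ) (i : ι) : ∃ k < Fintype.card ι,
      ‖z i‖ ^ (k + 1) ≤ Fintype.card ι *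
        ‖∑ t ∈ Finset.powersetCard (k + 1) Finset.univ, ∏ i ∈ t, z i‖ := by
  set N := Fintype.card ι with hN
  have hN0 : 0 < N := Fintype.card_pos_iff.2 ⟨i⟩
  set E : ℕ → ℂ := fun k => ∑ t ∈ Finset.powersetCard k Finset.univ, ∏ i ∈ t, z i with hE
  by_contra! hcon
  have hm : 0 < ‖z i‖ := by
    have h := hcon 0 hN0
    have : (0 : ℝ) ≤ N * ‖E (0 + 1)‖ := by positivity
    simpa using this.trans_lt h
  have h1 := Multiset.prod_X_sub_X_eq_sum_esymm (Finset.univ.val.map z)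
  rw [Multiset.map_map] at h1
  -- `z i` is a root of the monic polynomial whose coefficients are, up to sign, the elementary
  -- symmetric functions. If all of these were small against the matching powers of `‖z i‖`, nothing
  -- could cancel the leading term.
  have h2 := congrArg (Polynomial.eval (z i)) h1
  have h3 : Polynomial.eval (z i) (Multiset.map ((fun t => Polynomial.X - Polynomial.C t) ∘ z)
      Finset.univ.val).prod = 0 := by
    have : (Multiset.map ((fun t => Polynomial.X - Polynomial.C t) ∘ z) Finset.univ.val).prod =
      ∏ j, (Polynomial.X - Polynomial.C (z j)) := rfl
    rw [this, Polynomial.eval_prod]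
    exact Finset.prod_eq_zero (Finset.mem_univ i) (by simp)
  rw [h3, Polynomial.eval_finsetSum] at h2
  simp only [Multiset.card_map, Finset.card_val, Finset.card_univ, ← hN, Finset.esymm_map_val,
    Polynomial.eval_mul, Polynomial.eval_pow, Polynomial.eval_neg, Polynomial.eval_one,
    Polynomial.eval_C, Polynomial.eval_X] at h2
  rw [Finset.sum_range_succ'] at h2
  have h4 : ‖z i‖ ^ N ≤ ∑ k ∈ Finset.range N, ‖E (k + 1)‖ * ‖z i‖ ^ (N - (k + 1)) := by
    have : z i ^ N = -∑ k ∈ Finset.range N,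
        (-1) ^ (k + 1) * (E (k + 1) * z i ^ (N - (k + 1))) := by
      rw [eq_neg_iff_add_eq_zero, add_comm, h2]
      simp [hE]
    rw [← norm_pow, this, norm_neg]
    refine (norm_sum_le _ _).trans (le_of_eq (Finset.sum_congr rfl fun k _ => ?_))
    simp
  have h5 : ∑ k ∈ Finset.range N, ‖E (k + 1)‖ * ‖z i‖ ^ (N - (k + 1)) <
      ∑ k ∈ Finset.range N, ‖z i‖ ^ N / N := by
    refine Finset.sum_lt_sum_of_nonempty (by simpa using hN0.ne') fun k hk => ?_
    have hk := Finset.mem_range.1 hk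
    have h6 := hcon k hk
    have : ‖z i‖ ^ N = ‖z i‖ ^ (k + 1) * ‖z i‖ ^ (N - (k + 1)) := by
      rw [← pow_add]; congr 1; omega
    rw [this, lt_div_iff₀ (by exact_mod_cast hN0)]
    calc _ = (N * ‖E (k + 1)‖) * ‖z i‖ ^ (N - (k + 1)) := by ring
      _ < _ := by gcongr
  rw [Finset.sum_const, Finset.card_range, nsmul_eq_mul, mul_div_cancel₀ _ (by positivity)] at h5
  exact absurd h5 (not_lt.2 h4)

/-- Here m plays the maximum of the |z_i|, and the v_k play functions homogeneous of degree F in the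
z_i, at least one of which has size m^F. The exponent e/F undoes the degree. -/
lemma absPower_equiv (n F : ℕ) (hF : 0 < F) (e : ℚ) (he : 0 < e) (B : ℝ) :
    ∃ A : ℝ, 0 < A ∧ ∀ (v : Fin n → ℂ) (m : ℝ), 0 ≤ m → (∀ k, ‖v k‖ ≤ B * m ^ F) →
      (m = 0 ∨ ∃ k, m ^ F ≤ B * ‖v k‖) →
      absPower v (e / F) ≤ A * m ^ (e : ℝ) ∧ m ^ (e : ℝ) ≤ A * absPower v (e / F) := by
  set q : ℝ := ((e / F : ℚ) : ℝ) / 2 with hq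
  have hF' : (0 : ℝ) < F := by exact_mod_cast hF
  have he' : (0 : ℝ) < e := by exact_mod_cast he
  have hq0 : 0 < q := by rw [hq]; push_cast; positivity
  have hpow : ∀ m : ℝ, 0 ≤ m → ((m ^ F) ^ 2) ^ q = m ^ (e : ℝ) := by
    intro m hm
    rw [← pow_mul, ← Real.rpow_natCast, ← Real.rpow_mul hm]
    congr 1
    rw [hq]; push_cast; field_simp
  refine ⟨(n * B ^ 2) ^ q + (B ^ 2) ^ q + 1, by positivity, fun v m hm h1 h2 => ?_⟩
  have hs0 : 0 ≤ ∑ i, ‖v i‖ ^ 2 := Finset.sum_nonneg fun _ _ => by positivity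
  have hm0 : 0 ≤ m ^ (e : ℝ) := by positivity
  have ha0 : 0 ≤ absPower v (e / F) := Real.rpow_nonneg hs0 _
  constructor
  · have h3 : ∑ i, ‖v i‖ ^ 2 ≤ (n * B ^ 2) * (m ^ F) ^ 2 := by
      calc ∑ i, ‖v i‖ ^ 2 ≤ ∑ i : Fin n, (B * m ^ F) ^ 2 := by
            gcongr with i; exact h1 i
        _ = _ := by simp; ring
    have h4 : absPower v (e / F) ≤ (n * B ^ 2) ^ q * m ^ (e : ℝ) := by
      rw [← hpow m hm, ← Real.mul_rpow (by positivity) (by positivity)]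
      exact Real.rpow_le_rpow hs0 h3 hq0.le
    refine h4.trans ?_
    gcongr
    have : 0 ≤ (B ^ 2) ^ q := by positivity
    linarith
  · rcases h2 with rfl | ⟨k, hk⟩
    · rw [Real.zero_rpow he'.ne']; positivity
    · have h3 : (m ^ F) ^ 2 ≤ B ^ 2 * ∑ i, ‖v i‖ ^ 2 := by
        calc (m ^ F) ^ 2 ≤ (B * ‖v k‖) ^ 2 := by gcongr
          _ = B ^ 2 * ‖v k‖ ^ 2 := by ring
          _ ≤ _ := by
            gcongr
            exact Finset.single_le_sum (f := fun i => ‖v i‖ ^ 2) (fun _ _ => by positivity)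
              (Finset.mem_univ k)
      have h4 : m ^ (e : ℝ) ≤ (B ^ 2) ^ q * absPower v (e / F) := by
        rw [← hpow m hm, absPower, ← Real.mul_rpow (by positivity) hs0]
        exact Real.rpow_le_rpow (by positivity) h3 hq0.le
      refine h4.trans ?_
      gcongr
      have : 0 ≤ (n * B ^ 2) ^ q := by positivity
      linarith

/-- The sum of the powers of the absolute values of a family of polynomials in the roots of `H`
that is permuted by the permutations of the roots is comparable to an absolute power of polynomials
in the coefficients of `H`. -/
theorem exists_absPower_descent (H : Polynomial R) (lc : R) {ι : Type*} [Fintype ι]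
    (κ : ι → MvPolynomial (Fin D) R)
    (hκ : ∀ s : Equiv.Perm (Fin D), ∃ τ : Equiv.Perm ι, ∀ i, MvPolynomial.rename s (κ i) = κ (τ i))
    (e : ℚ) (he : 0 < e) :
    ∃ (n : ℕ) (g : Fin n → R) (e' : ℚ), 0 < e' ∧
      (∀ ψ : R →+* ℂ, ψ lc = 0 → ∀ i, ψ (g i) = 0) ∧
      ∀ c : ℝ, 0 < c → ∃ A : ℝ, 0 < A ∧ ∀ (ψ : R →+* ℂ) (α : Fin D → ℂ),
        IsRootFamily H lc ψ α → c ≤ ‖ψ lc‖ → ‖ψ lc‖ ≤ c⁻¹ →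
        absPower (fun i => ψ (g i)) e' ≤
          A * ∑ i, ‖MvPolynomial.eval₂Hom ψ α (κ i)‖ ^ (e : ℝ) ∧
        ∑ i, ‖MvPolynomial.eval₂Hom ψ α (κ i)‖ ^ (e : ℝ) ≤
          A * absPower (fun i => ψ (g i)) e' := by
  set N := Fintype.card ι with hN
  -- Every k + 1 ≤ N divides N!, so suitable powers of the elementary symmetric functions all get
  -- the same degree N!.
  set F := N.factorial with hF
  have hF0 : 0 < F := Nat.factorial_pos _
  choose g p hg using fun k : Fin N => exists_descent H lc _ (aeval_esymm_isSymmetric κ hκ (k + 1))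
  have he' : (0 : ℝ) < e := by exact_mod_cast he
  -- The extra factor `lc` makes everything vanish where the leading coefficient does. Where `‖ψ
  -- lc‖` is bounded above and below it only changes the constants.
  refine ⟨N, fun k => lc * g k ^ (F / (k + 1)), e / F, by positivity, fun ψ h i => by simp [h],
    fun c hc => ?_⟩
  set P : Fin N → ℕ := fun k => 1 + p k * (F / (k + 1)) with hP
  set B0 : ℝ := ∑ k, c⁻¹ ^ P k with hB0
  have hB0' : 0 ≤ B0 := Finset.sum_nonneg fun _ _ => by positivity
  obtain ⟨A, hA, hA'⟩ := absPower_equiv N F hF0 e he (B0 * ((2 ^ N) ^ F + N ^ F))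
  refine ⟨A * (N + 1), by positivity, fun ψ α hr h1 h2 => ?_⟩
  set z : ι → ℂ := fun i => MvPolynomial.eval₂Hom ψ α (κ i) with hz
  set E : ℕ → ℂ := fun k => ∑ t ∈ Finset.powersetCard k Finset.univ, ∏ i ∈ t, z i with hE
  have hG : ∀ k : Fin N, ψ (lc * g k ^ (F / (k + 1))) =
      ψ lc ^ P k * E (k + 1) ^ (F / (k + 1)) := by
    intro k
    rw [map_mul, map_pow, hg k ψ α hr, eval_aeval_esymm, hP, mul_pow, ← pow_mul, pow_add, pow_one,
      mul_assoc]
  have hdvd : ∀ k : Fin N, ((k : ℕ) + 1) * (F / (k + 1)) = F := fun k =>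
    Nat.mul_div_cancel' (Nat.dvd_factorial (Nat.succ_pos _) k.2)
  have hB1 : ∀ k, c⁻¹ ^ P k ≤ B0 := fun k =>
    Finset.single_le_sum (f := fun k => c⁻¹ ^ P k) (fun _ _ => by positivity) (Finset.mem_univ k)
  have hl1 : ∀ k, ‖ψ lc‖ ^ P k ≤ B0 := fun k =>
    (pow_le_pow_left₀ (norm_nonneg _) h2 _).trans (hB1 k)
  have hl2 : ∀ k, 1 ≤ B0 * ‖ψ lc‖ ^ P k := by
    intro k
    calc (1 : ℝ) = c⁻¹ ^ P k * c ^ P k := by rw [← mul_pow, inv_mul_cancel₀ hc.ne', one_pow]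
      _ ≤ _ := by gcongr; exact hB1 k
  obtain ⟨m, hm0, hmz, hmax⟩ : ∃ m : ℝ, 0 ≤ m ∧ (∀ i, ‖z i‖ ≤ m) ∧ (m = 0 ∨ ∃ i, m = ‖z i‖) := by
    by_cases hι : Nonempty ι
    · obtain ⟨i, hi⟩ := Finite.exists_max fun i => ‖z i‖
      exact ⟨_, norm_nonneg _, hi, Or.inr ⟨i, rfl⟩⟩
    · rw [not_nonempty_iff] at hι
      exact ⟨0, le_rfl, fun i => hι.elim i, Or.inl rfl⟩
  have key := hA' (fun k => ψ (lc * g k ^ (F / (k + 1)))) m hm0 (fun k => ?_) ?_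
  · obtain ⟨k1, k2⟩ := key
    have hS1 : m ^ (e : ℝ) ≤ ∑ i, ‖z i‖ ^ (e : ℝ) := by
      rcases hmax with rfl | ⟨i, rfl⟩
      · rw [Real.zero_rpow he'.ne']
        exact Finset.sum_nonneg fun _ _ => by positivity
      · exact Finset.single_le_sum (f := fun i => ‖z i‖ ^ (e : ℝ)) (fun _ _ => by positivity)
          (Finset.mem_univ i)
    have hS2 : ∑ i, ‖z i‖ ^ (e : ℝ) ≤ N * m ^ (e : ℝ) := by
      calc _ ≤ ∑ i : ι, m ^ (e : ℝ) := by gcongr with i; exact hmz i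
        _ = _ := by simp [hN]
    have hme : 0 ≤ m ^ (e : ℝ) := by positivity
    have hN0 : (0 : ℝ) ≤ N := by positivity
    have ha : 0 ≤ absPower (fun k => ψ (lc * g k ^ (F / (k + 1)))) (e / F) :=
      Real.rpow_nonneg (Finset.sum_nonneg fun _ _ => by positivity) _
    constructor
    · refine k1.trans ?_
      gcongr
      · exact le_mul_of_one_le_right hA.le (by linarith)
    · calc _ ≤ N * m ^ (e : ℝ) := hS2
        _ ≤ (N + 1) * (A * absPower (fun k => ψ (lc * g k ^ (F / (k + 1)))) (e / F)) := by
          gcongr; linarith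
        _ = _ := by ring
  · rw [hG, norm_mul, norm_pow, norm_pow]
    have hEb := norm_esymm_le z m hm0 hmz (k + 1)
    calc _ ≤ B0 * (2 ^ N * m ^ ((k : ℕ) + 1)) ^ (F / (k + 1)) := by
          gcongr
          exact hl1 k
      _ = B0 * (2 ^ N) ^ (F / (k + 1)) * m ^ F := by
          rw [mul_pow, ← pow_mul m, hdvd k]; ring
      _ ≤ B0 * ((2 ^ N) ^ F + N ^ F) * m ^ F := by
          gcongr
          refine (pow_le_pow_right₀ (one_le_pow₀ one_le_two) (Nat.div_le_self _ _)).trans ?_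
          exact le_add_of_nonneg_right (by positivity)
  · rcases hmax with h | ⟨i, hi⟩
    · exact Or.inl h
    right
    obtain ⟨k, hk, hk'⟩ := exists_pow_le_norm_esymm z i
    refine ⟨⟨k, hk⟩, ?_⟩
    have hN1 : (1 : ℝ) ≤ N := by exact_mod_cast (Nat.zero_le k).trans_lt hk
    rw [hG ⟨k, hk⟩, norm_mul, norm_pow, norm_pow, hi]
    have hd := hdvd ⟨k, hk⟩
    simp only at hd
    calc ‖z i‖ ^ F = (‖z i‖ ^ (k + 1)) ^ (F / (k + 1)) := by rw [← pow_mul, hd]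
      _ ≤ (N * ‖E (k + 1)‖) ^ (F / (k + 1)) := by gcongr
      _ = N ^ (F / (k + 1)) * (1 * ‖E (k + 1)‖ ^ (F / (k + 1))) := by rw [mul_pow, one_mul]
      _ ≤ ((2 ^ N) ^ F + N ^ F) * ((B0 * ‖ψ lc‖ ^ P ⟨k, hk⟩) * ‖E (k + 1)‖ ^ (F / (k + 1))) := by
          gcongr
          · refine (pow_le_pow_right₀ hN1 (Nat.div_le_self _ _)).trans ?_
            exact le_add_of_nonneg_left (by positivity)
          · exact hl2 _
      _ = _ := by ring

end Symmetric

/-! ### Taylor expansions and lower bounds away from the roots -/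

section TaylorNorm

open Polynomial

/-- The sum of the terms `|f^{(ν)}(α) / ν!| r^ν` of the Taylor expansion of `f` at `α`. -/
def taylorNorm (α : ℂ) (r : ℝ) (f : ℂ[X]) : ℝ :=
  ∑ ν ∈ Finset.range (f.natDegree + 1), ‖(taylor α f).coeff ν‖ * r ^ ν

lemma taylorNorm_eq {α : ℂ} {r : ℝ} {f : ℂ[X]} {n : ℕ} (h : f.natDegree < n) :
    taylorNorm α r f = ∑ ν ∈ Finset.range n, ‖(taylor α f).coeff ν‖ * r ^ ν := by
  refine Finset.sum_subset (fun ν hν => ?_) fun ν _ hν => ?_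
  · simp only [Finset.mem_range] at hν ⊢; omega
  · rw [coeff_eq_zero_of_natDegree_lt, norm_zero, zero_mul]
    rw [natDegree_taylor]
    simpa using hν

lemma taylorNorm_nonneg {α : ℂ} {r : ℝ} {f : ℂ[X]} (hr : 0 ≤ r) : 0 ≤ taylorNorm α r f :=
  Finset.sum_nonneg fun _ _ => by positivity

lemma coeff_taylor_le {α : ℂ} {r : ℝ} {f : ℂ[X]} (hr : 0 ≤ r) (ν : ℕ) :
    ‖(taylor α f).coeff ν‖ * r ^ ν ≤ taylorNorm α r f := by
  rw [taylorNorm_eq (n := f.natDegree + ν + 1) (by omega)]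
  exact Finset.single_le_sum (f := fun ν => ‖(taylor α f).coeff ν‖ * r ^ ν)
    (fun _ _ => by positivity) (Finset.mem_range.2 (by omega))

lemma norm_eval_le_taylorNorm (α z : ℂ) (f : ℂ[X]) : ‖f.eval z‖ ≤ taylorNorm α ‖z - α‖ f := by
  have h : f.eval z = (taylor α f).eval (z - α) := by rw [taylor_eval]; simp
  rw [h, eval_eq_sum_range, taylorNorm, natDegree_taylor]
  refine (norm_sum_le _ _).trans (le_of_eq (Finset.sum_congr rfl fun ν _ => ?_))
  rw [norm_mul, norm_pow]

/-- In the variable w = z - α the factor is w - (a - α): it shifts the Taylor coefficients and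
subtracts a multiple of them. -/
lemma taylorNorm_linear_mul_le {α a : ℂ} {r : ℝ} (hr : 0 ≤ r) (g : ℂ[X]) :
    taylorNorm α r ((X - C a) * g) ≤ (r + ‖a - α‖) * taylorNorm α r g := by
  have h1 : ((X - C a) * g).natDegree < g.natDegree + 2 := by
    have := natDegree_mul_le (p := X - C a) (q := g)
    rw [natDegree_X_sub_C] at this
    omega
  have h2 : taylor α ((X - C a) * g) = X * taylor α g - C (a - α) * taylor α g := by
    rw [taylor_mul, map_sub, taylor_X, taylor_C, C_sub]; ring
  rw [taylorNorm_eq h1, h2]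
  have h3 : ∑ ν ∈ Finset.range (g.natDegree + 2), ‖(X * taylor α g).coeff ν‖ * r ^ ν =
      r * taylorNorm α r g := by
    rw [Finset.sum_range_succ', taylorNorm, Finset.mul_sum]
    simp only [coeff_X_mul, coeff_X_mul_zero, norm_zero, zero_mul, add_zero]
    exact Finset.sum_congr rfl fun ν _ => by ring
  have h4 : ∑ ν ∈ Finset.range (g.natDegree + 2), ‖(C (a - α) * taylor α g).coeff ν‖ * r ^ ν =
      ‖a - α‖ * taylorNorm α r g := by
    rw [taylorNorm_eq (n := g.natDegree + 2) (by omega), Finset.mul_sum]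
    exact Finset.sum_congr rfl fun ν _ => by rw [coeff_C_mul, norm_mul]; ring
  rw [add_mul, ← h3, ← h4, ← Finset.sum_add_distrib]
  refine Finset.sum_le_sum fun ν _ => ?_
  rw [← add_mul, coeff_sub]
  gcongr
  exact norm_sub_le _ _

lemma taylorNorm_le_prod {α : ℂ} {r : ℝ} (hr : 0 ≤ r) (c : ℂ) (s : Multiset ℂ) :
    taylorNorm α r (C c * (s.map fun a => X - C a).prod) ≤
      ‖c‖ * (s.map fun a => r + ‖a - α‖).prod := by
  induction s using Multiset.induction_on with
  | empty => simp [taylorNorm]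
  | cons a s ih =>
    simp only [Multiset.map_cons, Multiset.prod_cons]
    rw [mul_left_comm, mul_left_comm ‖c‖]
    refine (taylorNorm_linear_mul_le hr _).trans ?_
    gcongr

/-- A lower bound for a polynomial at a point that is far from its roots. -/
lemma mul_taylorNorm_le_norm_eval {α z : ℂ} {r c : ℝ} (hr : 0 ≤ r) (hc : 0 ≤ c) (hc1 : c ≤ 1)
    {f : ℂ[X]} {M : ℕ} (hM : f.natDegree ≤ M) (h : ∀ a ∈ f.roots, c * (r + ‖a - α‖) ≤ ‖z - a‖) :
    c ^ M * taylorNorm α r f ≤ ‖f.eval z‖ := by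
  have hf := (IsAlgClosed.splits f).eq_prod_roots
  set s := f.roots with hs
  have hcard : Multiset.card s ≤ M := (card_roots' f).trans hM
  have h1 : c ^ M * taylorNorm α r f ≤
      ‖f.leadingCoeff‖ * (c ^ Multiset.card s * (s.map fun a => r + ‖a - α‖).prod) := by
    conv_lhs => rw [hf]
    have h2 := taylorNorm_le_prod (α := α) hr f.leadingCoeff s
    have h3 : c ^ M ≤ c ^ Multiset.card s := pow_le_pow_of_le_one hc hc1 hcard
    calc _ ≤ c ^ Multiset.card s * (‖f.leadingCoeff‖ * (s.map fun a => r + ‖a - α‖).prod) := by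
          gcongr
          exact taylorNorm_nonneg hr
      _ = _ := by ring
  refine h1.trans ?_
  conv_rhs => rw [hf]
  rw [eval_mul, eval_C, norm_mul]
  gcongr
  clear hf h1 hcard
  clear_value s
  clear hs
  induction s using Multiset.induction_on with
  | empty => simp
  | cons a s ih =>
    simp only [Multiset.map_cons, Multiset.prod_cons, Multiset.card_cons, eval_mul, norm_mul,
      eval_sub, eval_X, eval_C, pow_succ']
    calc _ = (c * (r + ‖a - α‖)) * (c ^ Multiset.card s *
          (s.map fun a => r + ‖a - α‖).prod) := by ring
      _ ≤ _ := by
        have h0 : 0 ≤ (s.map fun a => r + ‖a - α‖).prod := by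
          refine Multiset.prod_nonneg fun x hx => ?_
          obtain ⟨b, -, rfl⟩ := Multiset.mem_map.1 hx
          positivity
        gcongr
        · exact h a (Multiset.mem_cons_self a s)
        · exact ih fun b hb => h b (Multiset.mem_cons_of_mem hb)

/-- A ball contains a ball of comparable radius that is far from `M` given points. -/
lemma exists_ball_far (M : ℕ) : ∃ ρ : ℝ, 0 < ρ ∧ ρ ≤ 1 ∧ ∀ (s : Finset ℂ) (β : ℂ) (r : ℝ),
    s.card ≤ M → 0 < r → ∃ ζ : ℂ, Metric.ball ζ (ρ * r) ⊆ Metric.ball β r ∧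
      ∀ z ∈ Metric.ball ζ (ρ * r), ∀ a ∈ s, ρ * r ≤ ‖z - a‖ := by
  have hM : (0 : ℝ) < M + 1 := by positivity
  refine ⟨1 / (4 * (M + 1)), by positivity, ?_, fun s β r hs hr => ?_⟩
  · rw [div_le_one (by positivity)]
    have : (0 : ℝ) ≤ M := by positivity
    linarith
  set d : ℝ := r / (M + 1) with hd
  have hd0 : 0 < d := by positivity
  have hρ : 1 / (4 * ((M : ℝ) + 1)) * r = d / 4 := by rw [hd]; field_simp
  rw [hρ]
  let p : Fin (M + 1) → ℂ := fun k => β + ((k : ℝ) * d : ℝ)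
  -- Pigeonhole: the M + 1 points `p k` are at mutual distance at least d, so no a is within d / 2
  -- of two of them, and M points cannot spoil them all.
  have hp : ∃ k, ∀ a ∈ s, d / 2 ≤ ‖p k - a‖ := by
    by_contra! hcon
    choose a ha ha' using hcon
    have hinj : Function.Injective a := by
      intro k l hkl
      by_contra hne
      have h1 : ‖p k - p l‖ < d := by
        calc ‖p k - p l‖ = ‖(p k - a k) - (p l - a l)‖ := by rw [hkl]; congr 1; ring
          _ ≤ ‖p k - a k‖ + ‖p l - a l‖ := norm_sub_le _ _
          _ < d / 2 + d / 2 := add_lt_add (ha' k) (ha' l)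
          _ = d := by ring
      have h2 : ‖p k - p l‖ = |((k : ℝ) - l)| * d := by
        have : p k - p l = ((((k : ℝ) - l) * d : ℝ) : ℂ) := by
          simp only [p]; push_cast; ring
        rw [this, Complex.norm_real, Real.norm_eq_abs, abs_mul, abs_of_pos hd0]
      have h3 : (1 : ℝ) ≤ |((k : ℝ) - l)| := by
        have : ((k : ℕ) : ℤ) - (l : ℕ) ≠ 0 := by
          intro h; apply hne; ext; omega
        have := Int.one_le_abs this
        exact_mod_cast this
      rw [h2] at h1
      nlinarith
    have := Finset.card_le_card (s := Finset.univ.image a) (t := s) (by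
      intro x hx; obtain ⟨k, -, rfl⟩ := Finset.mem_image.1 hx; exact ha k)
    rw [Finset.card_image_of_injective _ hinj, Finset.card_univ, Fintype.card_fin] at this
    omega
  obtain ⟨k, hk⟩ := hp
  refine ⟨p k, fun z hz => ?_, fun z hz a ha => ?_⟩
  · rw [Metric.mem_ball, dist_eq_norm] at hz ⊢
    have h1 : ‖p k - β‖ ≤ M * d := by
      have : p k - β = (((k : ℝ) * d : ℝ) : ℂ) := by simp [p]
      rw [this, Complex.norm_real, Real.norm_eq_abs, abs_of_nonneg (by positivity)]
      have : ((k : ℕ) : ℝ) ≤ M := by exact_mod_cast Nat.lt_succ_iff.1 k.2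
      gcongr
    have h2 : r = (M + 1) * d := by rw [hd]; field_simp
    calc ‖z - β‖ ≤ ‖z - p k‖ + ‖p k - β‖ := norm_sub_le_norm_sub_add_norm_sub _ _ _
      _ < d / 4 + M * d := by linarith
      _ < r := by rw [h2]; linarith
  · rw [Metric.mem_ball, dist_eq_norm] at hz
    have := norm_sub_le_norm_sub_add_norm_sub (p k) z a
    have h3 := hk a ha
    rw [norm_sub_rev] at hz
    linarith

/-- Take a smaller ball whose distance from the roots is comparable to r. There both r and the
distance of z to α are bounded by multiples of |z - a|, as the lower bound by the Taylor norm
requires. The center α of the expansion may lie outside the ball, up to R radii from β. -/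
lemma exists_ball_taylorNorm_le (M : ℕ) (R : ℝ) (hR : 0 ≤ R) : ∃ c : ℝ, 0 < c ∧
    ∀ (f : ℂ[X]) (α β : ℂ) (r : ℝ), f.natDegree ≤ M → 0 < r → ‖α - β‖ ≤ R * r →
      ∃ ζ : ℂ, Metric.ball ζ (c * r) ⊆ Metric.ball β r ∧
        ∀ z ∈ Metric.ball ζ (c * r), c * taylorNorm α r f ≤ ‖f.eval z‖ := by
  classical
  obtain ⟨ρ, hρ, hρ1, h⟩ := exists_ball_far M
  set c₀ : ℝ := (1 + (2 + R) / ρ)⁻¹ with hc₀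
  have hc₀0 : 0 < c₀ := by positivity
  have hc₀1 : c₀ ≤ 1 := by
    rw [hc₀]
    apply inv_le_one_of_one_le₀
    have : 0 ≤ (2 + R) / ρ := by positivity
    linarith
  refine ⟨min ρ (c₀ ^ M), by positivity, fun f α β r hf hr hαβ => ?_⟩
  obtain ⟨ζ, h1, h2⟩ := h f.roots.toFinset β r
    ((Multiset.toFinset_card_le _).trans ((card_roots' f).trans hf)) hr
  have hsub : Metric.ball ζ (min ρ (c₀ ^ M) * r) ⊆ Metric.ball ζ (ρ * r) :=
    Metric.ball_subset_ball (by gcongr; exact min_le_left _ _)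
  refine ⟨ζ, hsub.trans h1, fun z hz => ?_⟩
  have hz := hsub hz
  calc _ ≤ c₀ ^ M * taylorNorm α r f := by
        gcongr
        · exact taylorNorm_nonneg hr.le
        · exact min_le_right _ _
    _ ≤ _ := by
      refine mul_taylorNorm_le_norm_eval hr.le hc₀0.le hc₀1 hf fun a ha => ?_
      have h3 := h2 z hz a (by simpa using ha)
      have h4 := h1 hz
      rw [Metric.mem_ball, dist_eq_norm] at h4
      have h5 : ‖a - α‖ ≤ ‖z - a‖ + ‖z - β‖ + ‖α - β‖ := by
        calc ‖a - α‖ = ‖-(z - a) + (z - β) - (α - β)‖ := by congr 1; ring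
          _ ≤ ‖-(z - a) + (z - β)‖ + ‖α - β‖ := norm_sub_le _ _
          _ ≤ ‖-(z - a)‖ + ‖z - β‖ + ‖α - β‖ := by gcongr; exact norm_add_le _ _
          _ = _ := by rw [norm_neg]
      rw [hc₀, inv_mul_le_iff₀ (by positivity)]
      have h6 : r ≤ ‖z - a‖ / ρ := by rw [le_div_iff₀ hρ]; linarith
      calc r + ‖a - α‖ ≤ ‖z - a‖ + (2 + R) * r := by linarith
        _ ≤ ‖z - a‖ + (2 + R) * (‖z - a‖ / ρ) := by gcongr
        _ = _ := by ring

end TaylorNorm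

/-! ### Integrals of radial power functions in the plane -/

section Radial

lemma lintegral_radial (g : ℝ → ℝ≥0∞) (hg : Measurable g) :
    ∫⁻ z : ℂ, g ‖z‖ = ENNReal.ofReal (2 * Real.pi) *
      ∫⁻ r in Set.Ioi (0 : ℝ), ENNReal.ofReal r * g r := by
  rw [← Complex.lintegral_comp_polarCoord_symm, polarCoord_target]
  have h1 : ∀ p ∈ Set.Ioi (0 : ℝ) ×ˢ Set.Ioo (-Real.pi) Real.pi,
      ENNReal.ofReal p.1 • g ‖Complex.polarCoord.symm p‖ = ENNReal.ofReal p.1 * g p.1 := by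
    intro p hp
    rw [Complex.norm_polarCoord_symm, abs_of_pos hp.1, smul_eq_mul]
  rw [setLIntegral_congr_fun (measurableSet_Ioi.prod measurableSet_Ioo) h1,
    Measure.volume_eq_prod, setLIntegral_prod _ (by fun_prop)]
  simp only [lintegral_const, Measure.restrict_apply MeasurableSet.univ, Set.univ_inter,
    Real.volume_Ioo]
  rw [lintegral_mul_const _ (by fun_prop), mul_comm]
  congr 2
  ring

lemma lintegral_ball_rpow (a r₀ : ℝ) (ha : -2 < a) (hr : 0 < r₀) :
    ∫⁻ z in {z : ℂ | ‖z‖ ≤ r₀}, ENNReal.ofReal (‖z‖ ^ a) =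
      ENNReal.ofReal (2 * Real.pi / (a + 2) * r₀ ^ (a + 2)) := by
  have hm : MeasurableSet {z : ℂ | ‖z‖ ≤ r₀} := measurableSet_le (by fun_prop) (by fun_prop)
  rw [← lintegral_indicator hm]
  have h1 := lintegral_radial ((Set.Iic r₀).indicator fun r => ENNReal.ofReal (r ^ a))
    (Measurable.indicator (by fun_prop) measurableSet_Iic)
  have h2 : ({z : ℂ | ‖z‖ ≤ r₀}.indicator fun z => ENNReal.ofReal (‖z‖ ^ a)) =
    fun z : ℂ => (Set.Iic r₀).indicator (fun r => ENNReal.ofReal (r ^ a)) ‖z‖ := by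
    ext z; simp [Set.indicator]
  rw [h2, h1]
  have h3 : ∫⁻ r in Set.Ioi (0 : ℝ), ENNReal.ofReal r *
      (Set.Iic r₀).indicator (fun r => ENNReal.ofReal (r ^ a)) r =
      ∫⁻ r in Set.Ioc 0 r₀, ENNReal.ofReal (r ^ (a + 1)) := by
    rw [← Set.Ioi_inter_Iic, Set.inter_comm, ← Measure.restrict_restrict measurableSet_Iic,
      ← lintegral_indicator measurableSet_Iic]
    refine setLIntegral_congr_fun measurableSet_Ioi fun r hr => ?_
    have hr : (0 : ℝ) < r := hr
    by_cases h : r ≤ r₀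
    · simp only [Set.indicator, Set.mem_Iic, h, if_true]
      rw [← ENNReal.ofReal_mul hr.le, Real.rpow_add_one hr.ne', mul_comm]
    · simp [Set.indicator, h]
  rw [h3, ← ofReal_integral_eq_lintegral_ofReal, ← intervalIntegral.integral_of_le hr.le,
    integral_rpow (Or.inl (by linarith)), ← ENNReal.ofReal_mul (by positivity)]
  · congr 1
    rw [Real.zero_rpow (by linarith), add_assoc, one_add_one_eq_two]
    ring
  · have := intervalIntegral.intervalIntegrable_rpow' (a := 0) (b := r₀) (r := a + 1) (by linarith)
    rwa [intervalIntegrable_iff_integrableOn_Ioc_of_le hr.le] at this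
  · refine (ae_restrict_iff' measurableSet_Ioc).2 (Filter.Eventually.of_forall fun r hr => ?_)
    exact Real.rpow_nonneg hr.1.le _

lemma lintegral_compl_ball_rpow (a r₀ : ℝ) (ha : a < -2) (hr : 0 < r₀) :
    ∫⁻ z in {z : ℂ | r₀ < ‖z‖}, ENNReal.ofReal (‖z‖ ^ a) =
      ENNReal.ofReal (2 * Real.pi / (-(a + 2)) * r₀ ^ (a + 2)) := by
  have hm : MeasurableSet {z : ℂ | r₀ < ‖z‖} := measurableSet_lt (by fun_prop) (by fun_prop)
  rw [← lintegral_indicator hm]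
  have h1 := lintegral_radial ((Set.Ioi r₀).indicator fun r => ENNReal.ofReal (r ^ a))
    (Measurable.indicator (by fun_prop) measurableSet_Ioi)
  have h2 : ({z : ℂ | r₀ < ‖z‖}.indicator fun z => ENNReal.ofReal (‖z‖ ^ a)) =
    fun z : ℂ => (Set.Ioi r₀).indicator (fun r => ENNReal.ofReal (r ^ a)) ‖z‖ := by
    ext z; simp [Set.indicator]
  rw [h2, h1]
  have h3 : ∫⁻ r in Set.Ioi (0 : ℝ), ENNReal.ofReal r *
      (Set.Ioi r₀).indicator (fun r => ENNReal.ofReal (r ^ a)) r =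
      ∫⁻ r in Set.Ioi r₀, ENNReal.ofReal (r ^ (a + 1)) := by
    have : Set.Ioi r₀ = Set.Ioi r₀ ∩ Set.Ioi 0 := by
      rw [Set.Ioi_inter_Ioi, max_eq_left hr.le]
    conv_rhs => rw [this]
    rw [← Measure.restrict_restrict (measurableSet_Ioi (a := r₀)),
      ← lintegral_indicator (measurableSet_Ioi (a := r₀))]
    refine setLIntegral_congr_fun measurableSet_Ioi fun r hr => ?_
    have hr : (0 : ℝ) < r := hr
    by_cases h : r₀ < r
    · simp only [Set.indicator, Set.mem_Ioi, h, if_true]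
      rw [← ENNReal.ofReal_mul hr.le, Real.rpow_add_one hr.ne', mul_comm]
    · simp [Set.indicator, h]
  rw [h3, ← ofReal_integral_eq_lintegral_ofReal, integral_Ioi_rpow_of_lt (by linarith) hr,
    ← ENNReal.ofReal_mul (by positivity)]
  · congr 1
    rw [add_assoc, one_add_one_eq_two, div_neg]
    ring
  · exact integrableOn_Ioi_rpow_of_lt (by linarith) hr
  · refine (ae_restrict_iff' measurableSet_Ioi).2 (Filter.Eventually.of_forall fun r hr' => ?_)
    exact Real.rpow_nonneg (hr.trans hr').le _

/-- The integral over the plane of the minimum of two power functions, one of them integrable at the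
origin and the other one at infinity. -/
lemma lintegral_min_rpow_le (κ δ l l' : ℝ) (hll : l < l') (h1 : l * δ < κ) (h2 : κ < l' * δ) :
    ∃ A : ℝ, 0 < A ∧ ∀ (q q' : ℝ) (G : ℂ → ℝ≥0∞), 0 < q → 0 < q' →
      (∀ w, w ≠ 0 → G w ≤ ENNReal.ofReal (q ^ (-δ) * ‖w‖ ^ (κ - 2 - l * δ))) →
      (∀ w, w ≠ 0 → G w ≤ ENNReal.ofReal (q' ^ (-δ) * ‖w‖ ^ (κ - 2 - l' * δ))) →
      ∫⁻ w, G w ≤ ENNReal.ofReal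
        (A / (q ^ ((l' * δ - κ) / (l' - l)) * q' ^ ((κ - l * δ) / (l' - l)))) := by
  have hd : 0 < l' - l := by linarith
  have hp1 : 0 < κ - l * δ := by linarith
  have hp2 : 0 < l' * δ - κ := by linarith
  refine ⟨2 * Real.pi / (κ - l * δ) + 2 * Real.pi / (l' * δ - κ), by positivity,
    fun q q' G hq hq' hG hG' => ?_⟩
  set a := (l' * δ - κ) / (l' - l) with ha
  set b := (κ - l * δ) / (l' - l) with hb
  have hab : a + b = δ := by rw [ha, hb]; field_simp; ring
  -- The radius at which the two bounds agree. The first is integrated inside, the second outside,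
  -- and both integrals come out as multiples of the same quantity.
  set r₀ := (q / q') ^ (1 / (l' - l)) with hr₀
  have hr₀0 : 0 < r₀ := by positivity
  have e1 : q ^ (-δ) * r₀ ^ (κ - l * δ) = (q ^ a * q' ^ b)⁻¹ := by
    have : r₀ ^ (κ - l * δ) = (q / q') ^ b := by
      rw [hr₀, ← Real.rpow_mul (by positivity)]; congr 1; rw [hb]; ring
    rw [this, Real.div_rpow hq.le hq'.le, ← hab, neg_add, Real.rpow_add hq, Real.rpow_neg hq.le,
      Real.rpow_neg hq.le]
    have := Real.rpow_pos_of_pos hq b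
    field_simp
  have e2 : q' ^ (-δ) * r₀ ^ (κ - l' * δ) = (q ^ a * q' ^ b)⁻¹ := by
    have : r₀ ^ (κ - l' * δ) = (q / q') ^ (-a) := by
      rw [hr₀, ← Real.rpow_mul (by positivity)]; congr 1; rw [ha]; ring
    rw [this, Real.div_rpow hq.le hq'.le, ← hab, neg_add, Real.rpow_add hq',
      Real.rpow_neg hq'.le, Real.rpow_neg hq'.le, Real.rpow_neg hq.le]
    have := Real.rpow_pos_of_pos hq' a
    field_simp
  have hm : MeasurableSet {z : ℂ | ‖z‖ ≤ r₀} := measurableSet_le (by fun_prop) (by fun_prop)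
  have hcompl : {z : ℂ | ‖z‖ ≤ r₀}ᶜ = {z : ℂ | r₀ < ‖z‖} := by ext; simp
  have hne : ∀ᵐ w : ℂ, w ≠ 0 := by
    rw [ae_iff]; simp
  rw [← lintegral_add_compl G hm, hcompl]
  have i1 : ∫⁻ w in {z : ℂ | ‖z‖ ≤ r₀}, G w ≤
      ENNReal.ofReal (2 * Real.pi / (κ - l * δ) * (q ^ a * q' ^ b)⁻¹) := by
    calc _ ≤ ∫⁻ w in {z : ℂ | ‖z‖ ≤ r₀},
          ENNReal.ofReal (q ^ (-δ)) * ENNReal.ofReal (‖w‖ ^ (κ - 2 - l * δ)) := by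
          refine lintegral_mono_ae ((ae_restrict_of_ae hne).mono fun w hw => ?_)
          rw [← ENNReal.ofReal_mul (by positivity)]
          exact hG w hw
      _ = _ := by
        rw [lintegral_const_mul _ (by fun_prop), lintegral_ball_rpow _ _ (by linarith) hr₀0,
          ← ENNReal.ofReal_mul (by positivity), ← e1]
        congr 1
        rw [show κ - 2 - l * δ + 2 = κ - l * δ by ring]
        ring
  have i2 : ∫⁻ w in {z : ℂ | r₀ < ‖z‖}, G w ≤
      ENNReal.ofReal (2 * Real.pi / (l' * δ - κ) * (q ^ a * q' ^ b)⁻¹) := by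
    calc _ ≤ ∫⁻ w in {z : ℂ | r₀ < ‖z‖},
          ENNReal.ofReal (q' ^ (-δ)) * ENNReal.ofReal (‖w‖ ^ (κ - 2 - l' * δ)) := by
          refine lintegral_mono_ae ((ae_restrict_of_ae hne).mono fun w hw => ?_)
          rw [← ENNReal.ofReal_mul (by positivity)]
          exact hG' w hw
      _ = _ := by
        rw [lintegral_const_mul _ (by fun_prop), lintegral_compl_ball_rpow _ _ (by linarith) hr₀0,
          ← ENNReal.ofReal_mul (by positivity), ← e2]
        congr 1
        rw [show κ - 2 - l' * δ + 2 = κ - l' * δ by ring, neg_sub]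
        ring
  refine (add_le_add i1 i2).trans ?_
  rw [← ENNReal.ofReal_add (by positivity) (by positivity)]
  apply ENNReal.ofReal_le_ofReal
  rw [div_eq_mul_inv _ (q ^ a * q' ^ b), add_mul]

end Radial

/-! ### Balance terms and the radial integral -/

section Balance

variable {ι : Type*} {N : ℕ}

/-- The terms of the size of the reciprocal of the integral of `|w|^(κ-2) (∑ q_l |w|^l)^(-δ)`: for
`κ < N δ`, they are the values of `q_l r^l = q_l' r^l'`, raised to the power `δ` and multiplied by
`r^(-κ)`, at the radius `r` where both sides agree, for `l δ < κ < l' δ`. -/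
def balanceTerm (δ κ : ℝ) (q : ι × Fin (N + 1) → ℝ) :
    Option ((ι × Fin (N + 1)) × (ι × Fin (N + 1))) → ℝ
  -- In this case no index l satisfies κ < l δ, and a top coefficient bounded below makes the
  -- integral over the unit disc bounded.
  | none => if N * δ < κ then 1 else 0
  | some (x, y) => if (x.2 : ℕ) * δ < κ ∧ κ < (y.2 : ℕ) * δ then
      q x ^ (((y.2 : ℕ) * δ - κ) / ((y.2 : ℕ) - (x.2 : ℕ))) *
        q y ^ ((κ - (x.2 : ℕ) * δ) / ((y.2 : ℕ) - (x.2 : ℕ))) else 0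

lemma balanceTerm_nonneg {δ κ : ℝ} {q : ι × Fin (N + 1) → ℝ} (hq : ∀ x, 0 ≤ q x) (θ) :
    0 ≤ balanceTerm δ κ q θ := by
  rcases θ with _ | ⟨x, y⟩
  · simp only [balanceTerm]; split_ifs <;> norm_num
  · simp only [balanceTerm]
    have := hq x
    have := hq y
    split_ifs <;> positivity

/-- A radius at which all the terms `(q_l r^l)^δ r^(-κ)` are bounded by the balance terms. -/
lemma exists_radius [Finite ι] (N : ℕ) (δ κ B : ℝ) (hδ : 0 ≤ δ) (hκ : 0 ≤ κ) (hB : 0 < B)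
    (hnd : κ ≠ N * δ ∧ ∀ l ≤ N, (l : ℝ) * δ ≠ κ) :
    ∃ C : ℝ, 0 < C ∧ ∀ (q : ι × Fin (N + 1) → ℝ) (τ : ℝ), (∀ x, 0 ≤ q x) → (∀ x, q x ≤ B) →
      (∃ j, 1 / 2 ≤ q (j, Fin.last N)) → 0 < τ → (∀ θ, balanceTerm δ κ q θ ≤ τ) →
      ∃ r : ℝ, 0 < r ∧ r ≤ 1 / 2 ∧ ∀ x, (q x * r ^ (x.2 : ℕ)) ^ δ ≤ C * τ * r ^ κ := by
  have hhalf : ∀ (q : ι × Fin (N + 1) → ℝ), (∀ x, 0 ≤ q x) → (∀ x, q x ≤ B) → ∀ x,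
      (q x * (1 / 2) ^ (x.2 : ℕ)) ^ δ ≤ B ^ δ := by
    intro q hq hqB x
    have := hq x
    refine Real.rpow_le_rpow (by positivity) ?_ hδ
    calc q x * (1 / 2) ^ (x.2 : ℕ) ≤ q x * 1 := by
          gcongr; exact pow_le_one₀ (by norm_num) (by norm_num)
      _ ≤ B := by rw [mul_one]; exact hqB x
  rcases lt_or_gt_of_ne hnd.1 with hlt | hgt
  · have hδ0 : 0 < δ := by
      rcases hδ.eq_or_lt with rfl | h
      · simp at hlt; linarith
      · exact h
    set c : ℝ := (1 / 2) ^ δ * (1 / 2) ^ (N * δ - κ) with hc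
    have hc0 : 0 < c := by positivity
    refine ⟨1 + B ^ δ / c * 2 ^ κ, by positivity, fun q τ hq hqB hN hτ hθ => ?_⟩
    obtain ⟨j, hj⟩ := hN
    have := Fintype.ofFinite ι
    classical
    let s : Finset (ι × Fin (N + 1)) :=
      Finset.univ.filter fun y => κ < (y.2 : ℕ) * δ ∧ 0 < q y
    have hjs : (j, Fin.last N) ∈ s := by
      simp only [s, Finset.mem_filter, Finset.mem_univ, true_and, Fin.val_last]
      exact ⟨hlt, by linarith⟩
    -- For l δ > κ the function q^δ r^(lδ-κ) increases with r and reaches τ at the radius being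
    -- minimized. At the smallest of these radii all such terms are therefore at most τ.
    obtain ⟨y, hys, hy⟩ := s.exists_min_image
      (fun y => (τ / q y ^ δ) ^ (1 / ((y.2 : ℕ) * δ - κ))) ⟨_, hjs⟩
    obtain ⟨hyκ, hy0⟩ : κ < (y.2 : ℕ) * δ ∧ 0 < q y := by simpa [s] using hys
    set r₀ := (τ / q y ^ δ) ^ (1 / ((y.2 : ℕ) * δ - κ)) with hr₀
    have hr₀0 : 0 < r₀ := by positivity
    have hle : ∀ x ∈ s, q x ^ δ * r₀ ^ ((x.2 : ℕ) * δ - κ) ≤ τ := by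
      intro x hx
      obtain ⟨hxκ, hx0⟩ : κ < (x.2 : ℕ) * δ ∧ 0 < q x := by simpa [s] using hx
      have h1 : 0 < (x.2 : ℕ) * δ - κ := by linarith
      have h2 : r₀ ^ ((x.2 : ℕ) * δ - κ) ≤ τ / q x ^ δ := by
        calc _ ≤ ((τ / q x ^ δ) ^ (1 / ((x.2 : ℕ) * δ - κ))) ^ ((x.2 : ℕ) * δ - κ) :=
              Real.rpow_le_rpow hr₀0.le (hy x hx) h1.le
          _ = _ := by
            rw [← Real.rpow_mul (by positivity), one_div_mul_cancel h1.ne', Real.rpow_one]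
      rw [le_div_iff₀ (by positivity)] at h2
      linarith
    by_cases hr : r₀ ≤ 1 / 2
    · refine ⟨r₀, hr₀0, hr, fun x => ?_⟩
      have hC : τ * r₀ ^ κ ≤ (1 + B ^ δ / c * 2 ^ κ) * τ * r₀ ^ κ := by
        gcongr
        refine le_mul_of_one_le_left hτ.le ?_
        have : 0 ≤ B ^ δ / c * 2 ^ κ := by positivity
        linarith
      refine le_trans ?_ hC
      have hpow : (q x * r₀ ^ (x.2 : ℕ)) ^ δ = q x ^ δ * r₀ ^ (((x.2 : ℕ) : ℝ) * δ) := by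
        rw [Real.mul_rpow (hq x) (by positivity), ← Real.rpow_natCast, ← Real.rpow_mul hr₀0.le]
      rw [hpow]
      rcases (hq x).eq_or_lt with h0 | h0
      · rw [← h0, Real.zero_rpow hδ0.ne', zero_mul]; positivity
      suffices h : q x ^ δ * r₀ ^ ((x.2 : ℕ) * δ - κ) ≤ τ by
        calc _ = q x ^ δ * r₀ ^ ((x.2 : ℕ) * δ - κ) * r₀ ^ κ := by
              rw [mul_assoc, ← Real.rpow_add hr₀0]; congr 2; ring
          _ ≤ _ := by gcongr
      rcases lt_or_gt_of_ne (hnd.2 x.2 (Nat.lt_succ_iff.1 x.2.2)) with hx | hx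
      -- For l δ < κ the required bound at `r₀` is the bound τ of the balance term of x and y,
      -- raised to a positive power.
      · have hp := hθ (some (x, y))
        simp only [balanceTerm, hx, hyκ, and_self, if_true] at hp
        have hd : (0 : ℝ) < (y.2 : ℕ) - (x.2 : ℕ) := by
          have h1 : ((x.2 : ℕ) : ℝ) * δ < (y.2 : ℕ) * δ := hx.trans hyκ
          have := lt_of_mul_lt_mul_right h1 hδ0.le
          linarith
        set d : ℝ := (y.2 : ℕ) - (x.2 : ℕ) with hdd
        set u : ℝ := (y.2 : ℕ) * δ - κ with hu
        set v : ℝ := κ - (x.2 : ℕ) * δ with hv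
        have hu0 : 0 < u := by linarith
        have hv0 : 0 < v := by linarith
        have huv : u + v = d * δ := by rw [hu, hv, hdd]; ring
        have h1 : q x ^ δ * q y ^ (v / u * δ) ≤ τ ^ (d * δ / u) := by
          have h2 := Real.rpow_le_rpow (by positivity) hp (z := d * δ / u) (by positivity)
          rw [Real.mul_rpow (by positivity) (by positivity), ← Real.rpow_mul h0.le,
            ← Real.rpow_mul hy0.le] at h2
          rw [show u / d * (d * δ / u) = δ by field_simp,
            show v / d * (d * δ / u) = v / u * δ by field_simp] at h2
          exact h2
        have h3 : r₀ ^ ((x.2 : ℕ) * δ - κ) = q y ^ (v / u * δ) / τ ^ (v / u) := by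
          rw [hr₀, ← Real.rpow_mul (by positivity),
            show 1 / u * (((x.2 : ℕ) : ℝ) * δ - κ) = -(v / u) by rw [hv]; field_simp; ring,
            Real.rpow_neg (by positivity), Real.div_rpow hτ.le (by positivity), inv_div,
            ← Real.rpow_mul hy0.le, mul_comm δ]
        rw [h3, ← mul_div_assoc, div_le_iff₀ (by positivity)]
        refine h1.trans (le_of_eq ?_)
        rw [← Real.rpow_one_add' hτ.le (by positivity)]
        congr 1
        rw [← huv]; field_simp
      · exact hle x (by simp only [s, Finset.mem_filter, Finset.mem_univ, true_and]; exact ⟨hx, h0⟩)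
    -- The top coefficient is at least 1/2 and its term at `r₀` > 1/2 is at most τ, which bounds τ
    -- below. The radius 1/2 then serves.
    · push Not at hr
      refine ⟨1 / 2, by norm_num, le_rfl, fun x => (hhalf q hq hqB x).trans ?_⟩
      have hτc : c ≤ τ := by
        refine le_trans ?_ (hle _ hjs)
        rw [hc]
        simp only [Fin.val_last]
        have : 0 ≤ N * δ - κ := by linarith
        gcongr
      have h2 : ((1 : ℝ) / 2) ^ κ = (2 ^ κ)⁻¹ := by
        rw [one_div, Real.inv_rpow (by norm_num)]
      have h3 : (0 : ℝ) < 2 ^ κ := by positivity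
      rw [h2]
      calc B ^ δ = B ^ δ / c * 2 ^ κ * c * (2 ^ κ)⁻¹ := by field_simp
        _ ≤ (1 + B ^ δ / c * 2 ^ κ) * τ * (2 ^ κ)⁻¹ := by
          gcongr
          linarith
  -- For N δ < κ the balance term 1 forces τ ≥ 1, so radius 1/2 serves again.
  · refine ⟨B ^ δ * 2 ^ κ, by positivity, fun q τ hq hqB hN hτ hθ =>
      ⟨1 / 2, by norm_num, le_rfl, fun x => (hhalf q hq hqB x).trans ?_⟩⟩
    have h1 : 1 ≤ τ := by
      have := hθ none
      simpa [balanceTerm, hgt] using this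
    have h2 : ((1 : ℝ) / 2) ^ κ = (2 ^ κ)⁻¹ := by
      rw [one_div, Real.inv_rpow (by norm_num)]
    have h3 : (0 : ℝ) < 2 ^ κ := by positivity
    rw [h2]
    calc B ^ δ = B ^ δ * 2 ^ κ * 1 * (2 ^ κ)⁻¹ := by field_simp
      _ ≤ _ := by gcongr

/-- The integral of a function bounded by all `|w|^(κ-2) (q_l |w|^l)^(-δ)` on the unit disc is
bounded by the reciprocal of the sum of the balance terms. -/
lemma lintegral_le_balance [Fintype ι] (N : ℕ) (δ κ : ℝ) (hδ : 0 ≤ δ) :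
    ∃ C : ℝ, 0 < C ∧ ∀ (q : ι × Fin (N + 1) → ℝ) (G : ℂ → ℝ≥0∞), (∀ x, 0 ≤ q x) →
      (∃ j, 1 / 2 ≤ q (j, Fin.last N)) → (∀ w, 1 ≤ ‖w‖ → G w = 0) →
      (∀ w, w ≠ 0 → ∀ x, 0 < q x →
        G w ≤ ENNReal.ofReal (q x ^ (-δ) * ‖w‖ ^ (κ - 2 - (x.2 : ℕ) * δ))) →
      0 < ∑ θ, balanceTerm δ κ q θ →
      ∫⁻ w, G w ≤ ENNReal.ofReal (C / ∑ θ, balanceTerm δ κ q θ) := by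
  have hpair : ∀ p : (ι × Fin (N + 1)) × (ι × Fin (N + 1)), ∃ A : ℝ, 0 < A ∧
      (((p.1.2 : ℕ) : ℝ) * δ < κ → κ < ((p.2.2 : ℕ) : ℝ) * δ →
      ∀ (q q' : ℝ) (G : ℂ → ℝ≥0∞), 0 < q → 0 < q' →
      (∀ w, w ≠ 0 → G w ≤ ENNReal.ofReal (q ^ (-δ) * ‖w‖ ^ (κ - 2 - (p.1.2 : ℕ) * δ))) →
      (∀ w, w ≠ 0 → G w ≤ ENNReal.ofReal (q' ^ (-δ) * ‖w‖ ^ (κ - 2 - (p.2.2 : ℕ) * δ))) →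
      ∫⁻ w, G w ≤ ENNReal.ofReal (A / (q ^ (((p.2.2 : ℕ) * δ - κ) / ((p.2.2 : ℕ) - (p.1.2 : ℕ))) *
        q' ^ ((κ - (p.1.2 : ℕ) * δ) / ((p.2.2 : ℕ) - (p.1.2 : ℕ)))))) := by
    intro p
    by_cases h : ((p.1.2 : ℕ) : ℝ) * δ < κ ∧ κ < ((p.2.2 : ℕ) : ℝ) * δ
    · have hd := lt_of_mul_lt_mul_right (h.1.trans h.2) hδ
      obtain ⟨A, hA, hA'⟩ := lintegral_min_rpow_le κ δ _ _ hd h.1 h.2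
      exact ⟨A, hA, fun _ _ => hA'⟩
    · exact ⟨1, one_pos, fun h1 h2 => absurd ⟨h1, h2⟩ h⟩
  choose A hA hA' using hpair
  set A₀ : ℝ := 2 ^ δ * (2 * Real.pi / |κ - N * δ|) with hA₀
  have hA₀0 : 0 ≤ A₀ := by positivity
  have hS : 0 ≤ ∑ p, A p := Finset.sum_nonneg fun p _ => (hA p).le
  set Θ := Option ((ι × Fin (N + 1)) × (ι × Fin (N + 1))) with hΘ
  refine ⟨(A₀ + ∑ p, A p + 1) * Fintype.card Θ, by positivity,
    fun q G hq hN hG0 hG hY => ?_⟩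
  -- Up to the number of terms the sum is its largest term, and any single nonzero term bounds the
  -- integral.
  obtain ⟨θ, hθ⟩ := Finite.exists_max (balanceTerm δ κ q)
  have hsum : ∑ θ, balanceTerm δ κ q θ ≤ Fintype.card Θ * balanceTerm δ κ q θ := by
    refine (Finset.sum_le_sum fun θ' _ => hθ θ').trans (le_of_eq ?_)
    rw [Finset.sum_const, Finset.card_univ, nsmul_eq_mul]
  have hpos : 0 < balanceTerm δ κ q θ := by
    by_contra h
    have h0 : balanceTerm δ κ q θ = 0 := le_antisymm (not_lt.1 h) (balanceTerm_nonneg hq θ)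
    rw [h0, mul_zero] at hsum
    linarith
  have key : ∫⁻ w, G w ≤ ENNReal.ofReal ((A₀ + ∑ p, A p + 1) / balanceTerm δ κ q θ) := by
    rcases θ with _ | ⟨x, y⟩
    -- The exponent κ - 2 - N δ exceeds -2, so the bound by the top coefficient is integrable on the
    -- disc.
    · have hlt : N * δ < κ := by
        by_contra h
        simp [balanceTerm, h] at hpos
      obtain ⟨j, hj⟩ := hN
      have hb : balanceTerm δ κ q none = 1 := by simp [balanceTerm, hlt]
      rw [hb, div_one]
      have hm : MeasurableSet {z : ℂ | ‖z‖ ≤ 1} := measurableSet_le (by fun_prop) (by fun_prop)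
      have hne : ∀ᵐ w : ℂ, w ≠ 0 := by rw [ae_iff]; simp
      calc ∫⁻ w, G w = ∫⁻ w in {z : ℂ | ‖z‖ ≤ 1}, G w := by
            rw [← lintegral_indicator hm]
            refine lintegral_congr fun w => ?_
            by_cases hw : ‖w‖ ≤ 1
            · simp [Set.indicator, hw]
            · simp [Set.indicator, hw, hG0 w (not_le.1 hw).le]
        _ ≤ ∫⁻ w in {z : ℂ | ‖z‖ ≤ 1}, ENNReal.ofReal (2 ^ δ) *
              ENNReal.ofReal (‖w‖ ^ (κ - 2 - N * δ)) := by
            refine lintegral_mono_ae ((ae_restrict_of_ae hne).mono fun w hw => ?_)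
            refine (hG w hw (j, Fin.last N) (by linarith)).trans ?_
            rw [← ENNReal.ofReal_mul (by positivity), Fin.val_last]
            apply ENNReal.ofReal_le_ofReal
            gcongr
            rw [← inv_inv (2 : ℝ), Real.inv_rpow (by positivity), ← Real.rpow_neg (by positivity)]
            apply Real.rpow_le_rpow_of_nonpos (by positivity) _ (by linarith)
            linarith
        _ = ENNReal.ofReal A₀ := by
            rw [lintegral_const_mul _ (by fun_prop), lintegral_ball_rpow _ _ (by linarith) one_pos,
              ← ENNReal.ofReal_mul (by positivity), hA₀]
            congr 1
            rw [Real.one_rpow, mul_one, abs_of_pos (by linarith)]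
            congr 2
            ring
        _ ≤ _ := ENNReal.ofReal_le_ofReal (by linarith)
    · have hlt : ((x.2 : ℕ) : ℝ) * δ < κ ∧ κ < ((y.2 : ℕ) : ℝ) * δ := by
        by_contra h
        simp [balanceTerm, h] at hpos
      have hd := lt_of_mul_lt_mul_right (hlt.1.trans hlt.2) hδ
      have hb : balanceTerm δ κ q (some (x, y)) =
          q x ^ (((y.2 : ℕ) * δ - κ) / ((y.2 : ℕ) - (x.2 : ℕ))) *
        q y ^ ((κ - (x.2 : ℕ) * δ) / ((y.2 : ℕ) - (x.2 : ℕ))) := by simp [balanceTerm, hlt]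
      rw [hb] at hpos ⊢
      have hx0 : 0 < q x := by
        refine lt_of_le_of_ne (hq x) fun h => ?_
        rw [← h, Real.zero_rpow, zero_mul] at hpos
        · exact lt_irrefl _ hpos
        · exact (div_pos (by linarith) (by linarith)).ne'
      have hy0 : 0 < q y := by
        refine lt_of_le_of_ne (hq y) fun h => ?_
        rw [← h, Real.zero_rpow, mul_zero] at hpos
        · exact lt_irrefl _ hpos
        · exact (div_pos (by linarith) (by linarith)).ne'
      refine (hA' (x, y) hlt.1 hlt.2 (q x) (q y) G hx0 hy0 (fun w hw => hG w hw x hx0)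
        (fun w hw => hG w hw y hy0)).trans (ENNReal.ofReal_le_ofReal ?_)
      gcongr
      have := Finset.single_le_sum (f := A) (fun p _ => (hA p).le) (Finset.mem_univ (x, y))
      linarith
  refine key.trans (ENNReal.ofReal_le_ofReal ?_)
  rw [div_le_div_iff₀ hpos hY, mul_assoc]
  gcongr

end Balance

/-! ### Taylor coefficients at a center and lower bounds on its cell -/

section LocalEstimate

open Polynomial

lemma absPower_nonneg {n : ℕ} (v : Fin n → ℂ) (e : ℚ) : 0 ≤ absPower v e :=
  Real.rpow_nonneg (Finset.sum_nonneg fun _ _ => by positivity) _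

lemma sq_rpow_half {x e : ℝ} (hx : 0 ≤ x) : (x ^ 2) ^ (e / 2) = x ^ e := by
  rw [← Real.rpow_natCast, ← Real.rpow_mul hx]
  congr 1
  push_cast
  ring

lemma rpow_norm_le_absPower {n : ℕ} (v : Fin n → ℂ) {e : ℚ} (he : 0 ≤ e) (i : Fin n) :
    ‖v i‖ ^ (e : ℝ) ≤ absPower v e := by
  have he' : (0 : ℝ) ≤ e := by exact_mod_cast he
  rw [← sq_rpow_half (norm_nonneg _), absPower]
  apply Real.rpow_le_rpow (by positivity) _ (by positivity)
  exact Finset.single_le_sum (f := fun i => ‖v i‖ ^ 2) (fun _ _ => by positivity)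
    (Finset.mem_univ i)

lemma absPower_le_rpow {n : ℕ} (v : Fin n → ℂ) {e : ℚ} (he : 0 ≤ e) {s : ℝ}
    (hs : ∑ i, ‖v i‖ ≤ s) : absPower v e ≤ s ^ (e : ℝ) := by
  have he' : (0 : ℝ) ≤ e := by exact_mod_cast he
  have hs0 : 0 ≤ ∑ i, ‖v i‖ := Finset.sum_nonneg fun _ _ => by positivity
  rw [← sq_rpow_half (hs0.trans hs), absPower]
  apply Real.rpow_le_rpow (Finset.sum_nonneg fun _ _ => by positivity) _ (by positivity)
  calc _ ≤ (∑ i, ‖v i‖) ^ 2 := Finset.sum_sq_le_sq_sum_of_nonneg fun _ _ => norm_nonneg _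
    _ ≤ _ := by gcongr

lemma rpow_sum_le {ι : Type*} [Fintype ι] [Nonempty ι] (u : ι → ℝ) (hu : ∀ i, 0 ≤ u i) {e : ℝ}
    (he : 0 ≤ e) : (∑ i, u i) ^ e ≤ (Fintype.card ι : ℝ) ^ e * ∑ i, u i ^ e := by
  obtain ⟨i, hi⟩ := Finite.exists_max u
  calc (∑ i, u i) ^ e ≤ (Fintype.card ι * u i) ^ e := by
        apply Real.rpow_le_rpow (Finset.sum_nonneg fun i _ => hu i) _ he
        refine (Finset.sum_le_sum fun j _ => hi j).trans (le_of_eq ?_)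
        simp
    _ = (Fintype.card ι : ℝ) ^ e * u i ^ e := Real.mul_rpow (by positivity) (hu i)
    _ ≤ _ := by
      gcongr
      exact Finset.single_le_sum (f := fun i => u i ^ e)
        (fun i _ => Real.rpow_nonneg (hu i) _) (Finset.mem_univ i)

/-- The quotient `(∑ᵢ |Pᵢ(z)|²)^(ε/2) / (∑ⱼ |Qⱼ(z)|²)^(δ/2)`. -/
def polyRatio {I J : ℕ} (ε δ : ℚ) (P : Fin I → ℂ[X]) (Q : Fin J → ℂ[X]) (z : ℂ) : ℝ≥0∞ :=
  ENNReal.ofReal (absPower (fun i => (P i).eval z) ε) /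
    ENNReal.ofReal (absPower (fun j => (Q j).eval z) δ)

variable {I J : ℕ} {M : Fin I → ℕ}

/-- The power `|P_i^{(ν)}(α) / ν!|^ε`. -/
def localNum (ε : ℚ) (P : Fin I → ℂ[X]) (α : ℂ) (x : Σ i : Fin I, Fin (M i + 1)) : ℝ :=
  ‖(taylor α (P x.1)).coeff x.2‖ ^ (ε : ℝ)

/-- The absolute values of the Taylor coefficients of the polynomials `Q` at `α`. -/
def localCoeff (N : ℕ) (Q : Fin J → ℂ[X]) (α : ℂ) (y : Fin J × Fin (N + 1)) : ℝ :=
  ‖(taylor α (Q y.1)).coeff y.2‖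

/-- The sum of the balance terms of the Taylor coefficients of `Q` at `α`. -/
def localDen (N : ℕ) (ε δ : ℚ) (Q : Fin J → ℂ[X]) (α : ℂ) (x : Σ i : Fin I, Fin (M i + 1)) : ℝ :=
  ∑ θ, balanceTerm (δ : ℝ) ((x.2 : ℕ) * ε + 2) (localCoeff N Q α) θ

lemma localNum_nonneg (ε : ℚ) (P : Fin I → ℂ[X]) (α : ℂ) (x : Σ i : Fin I, Fin (M i + 1)) :
    0 ≤ localNum ε P α x := Real.rpow_nonneg (norm_nonneg _) _

lemma localCoeff_nonneg (N : ℕ) (Q : Fin J → ℂ[X]) (α : ℂ) (y : Fin J × Fin (N + 1)) :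
    0 ≤ localCoeff N Q α y := norm_nonneg _

lemma localDen_nonneg (N : ℕ) (ε δ : ℚ) (Q : Fin J → ℂ[X]) (α : ℂ)
    (x : Σ i : Fin I, Fin (M i + 1)) : 0 ≤ localDen N ε δ Q α x :=
  Finset.sum_nonneg fun θ _ => balanceTerm_nonneg (localCoeff_nonneg N Q α) θ

/-- Expand in monomials; the Taylor norm of X^k at α with r = 1 is at most (1 + |α|)^k, one linear
factor at a time. -/
lemma norm_coeff_taylor_le (f : ℂ[X]) {B R : ℝ} {n : ℕ} (hn : f.natDegree ≤ n)
    (hB : ∀ k, ‖f.coeff k‖ ≤ B) {α : ℂ} (hα : ‖α‖ ≤ R) (l : ℕ) :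
    ‖(taylor α f).coeff l‖ ≤ (n + 1) * (B * (1 + R) ^ n) := by
  have hR : 0 ≤ R := (norm_nonneg _).trans hα
  have hX : ∀ k, taylorNorm α 1 (X ^ k : ℂ[X]) ≤ (1 + ‖α‖) ^ k := by
    intro k
    induction k with
    | zero => simp [taylorNorm]
    | succ k ih =>
      have := taylorNorm_linear_mul_le (α := α) (a := 0) (zero_le_one' ℝ) (X ^ k)
      simp only [C_0, sub_zero, zero_sub, norm_neg] at this
      rw [pow_succ', pow_succ']
      exact this.trans (by gcongr)
  have hf : taylor α f = ∑ k ∈ Finset.range (n + 1), C (f.coeff k) * taylor α (X ^ k) := by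
    conv_lhs => rw [f.as_sum_range_C_mul_X_pow' (n := n + 1) (by omega)]
    rw [map_sum]
    exact Finset.sum_congr rfl fun k _ => by rw [taylor_mul, taylor_C]
  rw [hf, finsetSum_coeff]
  refine (norm_sum_le _ _).trans ?_
  calc _ ≤ ∑ k ∈ Finset.range (n + 1), B * (1 + R) ^ n := by
        refine Finset.sum_le_sum fun k hk => ?_
        have hk : k ≤ n := by have := Finset.mem_range.1 hk; omega
        rw [coeff_C_mul, norm_mul]
        have h1 := coeff_taylor_le (α := α) (f := X ^ k) (zero_le_one' ℝ) l
        rw [one_pow, mul_one] at h1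
        have h2 : (1 + ‖α‖) ^ k ≤ (1 + R) ^ n :=
          (pow_le_pow_left₀ (by positivity) (by linarith) k).trans
            (pow_le_pow_right₀ (by linarith) hk)
        exact mul_le_mul (hB k) (h1.trans ((hX k).trans h2)) (norm_nonneg _)
          ((norm_nonneg _).trans (hB k))
    _ = _ := by simp

/-- Near the center `α` of its cell, `Q` is bounded below by all the terms of its Taylor expansion
at `α`. -/
lemma localCoeff_mul_pow_le [NeZero J] {N : ℕ} {Q : Fin J → ℂ[X]} (hQ : ∀ j, (Q j).natDegree ≤ N)
    {R : ℝ} {α z : ℂ} (hα : ‖α‖ ≤ R) (hz : ‖z‖ ≤ 1) (hr : ‖z - α‖ ≤ 1)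
    (h0 : ∀ a ∈ (Q 0).roots, ‖z - α‖ ≤ ‖z - a‖)
    (hj : ∀ j, j ≠ 0 → ∀ a ∈ (X * Q 0 + Q j).roots, ‖z - α‖ ≤ ‖z - a‖)
    (y : Fin J × Fin (N + 1)) : ∃ j j',
    localCoeff N Q α y * ‖z - α‖ ^ (y.2 : ℕ) ≤
      3 ^ (N + 1) * (2 + R) * (‖(Q j).eval z‖ + ‖(Q j').eval z‖) := by
  have hR : 0 ≤ R := (norm_nonneg _).trans hα
  -- As z is no closer to a than to α, |a - α| ≤ 2 |z - a|; this is the source of the constant 1/3.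
  have hdist : ∀ a, ‖z - α‖ ≤ ‖z - a‖ → 1 / 3 * (‖z - α‖ + ‖a - α‖) ≤ ‖z - a‖ := by
    intro a ha
    have : ‖a - α‖ ≤ ‖a - z‖ + ‖z - α‖ := norm_sub_le_norm_sub_add_norm_sub _ _ _
    rw [norm_sub_rev a z] at this
    linarith
  have hlow : ∀ (f : ℂ[X]) (n : ℕ), f.natDegree ≤ n → (∀ a ∈ f.roots, ‖z - α‖ ≤ ‖z - a‖) →
      taylorNorm α ‖z - α‖ f ≤ 3 ^ n * ‖f.eval z‖ := by
    intro f n hf ha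
    have := mul_taylorNorm_le_norm_eval (α := α) (z := z) (r := ‖z - α‖) (c := 1 / 3)
      (norm_nonneg _) (by norm_num) (by norm_num) hf fun a h => hdist a (ha a h)
    rw [one_div, inv_pow, inv_mul_le_iff₀ (by positivity)] at this
    exact this
  have hQ0 := hlow (Q 0) N (hQ 0) h0
  by_cases hy : y.1 = 0
  · refine ⟨0, 0, ?_⟩
    rw [localCoeff, hy]
    refine (coeff_taylor_le (norm_nonneg _) _).trans (hQ0.trans ?_)
    have h1 : 0 ≤ 3 ^ N * ‖(Q 0).eval z‖ * (11 + 6 * R) := by positivity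
    calc _ ≤ 3 ^ N * ‖(Q 0).eval z‖ + 3 ^ N * ‖(Q 0).eval z‖ * (11 + 6 * R) := by linarith
      _ = _ := by ring
  · refine ⟨0, y.1, ?_⟩
    have h1 := hlow (X * Q 0 + Q y.1) (N + 1) (by
      refine natDegree_add_le_of_degree_le ?_ ((hQ _).trans (by omega))
      refine natDegree_mul_le.trans ?_
      have := hQ 0
      rw [natDegree_X]; omega) (hj y.1 hy)
    have h2 : taylorNorm α ‖z - α‖ (X * Q 0) ≤ (1 + R) * (3 ^ N * ‖(Q 0).eval z‖) := by
      have := taylorNorm_linear_mul_le (α := α) (a := 0) (norm_nonneg (z - α)) (Q 0)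
      simp only [C_0, sub_zero, zero_sub, norm_neg] at this
      refine this.trans ?_
      gcongr
      exact taylorNorm_nonneg (norm_nonneg _)
    -- Only z Q_0 and z Q_0 + Q_j have their roots among the centers; Q_j is recovered as their
    -- difference.
    have h3 : localCoeff N Q α y ≤ ‖(taylor α (X * Q 0 + Q y.1)).coeff y.2‖ +
        ‖(taylor α (X * Q 0)).coeff y.2‖ := by
      rw [localCoeff]
      have : (taylor α (Q y.1)).coeff y.2 = (taylor α (X * Q 0 + Q y.1)).coeff y.2 -
          (taylor α (X * Q 0)).coeff y.2 := by rw [map_add, coeff_add]; ring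
      rw [this]
      exact norm_sub_le _ _
    have h4 : ‖(X * Q 0 + Q y.1).eval z‖ ≤ ‖(Q 0).eval z‖ + ‖(Q y.1).eval z‖ := by
      rw [eval_add, eval_mul, eval_X]
      refine (norm_add_le _ _).trans ?_
      rw [norm_mul]
      gcongr
      exact mul_le_of_le_one_left (norm_nonneg _) hz
    calc _ ≤ (‖(taylor α (X * Q 0 + Q y.1)).coeff y.2‖ + ‖(taylor α (X * Q 0)).coeff y.2‖) *
          ‖z - α‖ ^ (y.2 : ℕ) := by gcongr
      _ ≤ 3 ^ (N + 1) * ‖(X * Q 0 + Q y.1).eval z‖ + (1 + R) * (3 ^ N * ‖(Q 0).eval z‖) := by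
        rw [add_mul]
        exact add_le_add ((coeff_taylor_le (norm_nonneg _) _).trans h1)
          ((coeff_taylor_le (norm_nonneg _) _).trans h2)
      _ ≤ 3 ^ (N + 1) * (‖(Q 0).eval z‖ + ‖(Q y.1).eval z‖) +
          (1 + R) * (3 ^ (N + 1) * (‖(Q 0).eval z‖ + ‖(Q y.1).eval z‖)) := by
        gcongr
        · norm_num
        · omega
        · exact le_add_of_nonneg_right (norm_nonneg _)
      _ = _ := by ring

end LocalEstimate

/-! ### The upper estimate, cell by cell -/

section UpperEstimate

open Polynomial

variable {I J : ℕ} {M : Fin I → ℕ}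

lemma measurable_absPower_eval {n : ℕ} (P : Fin n → ℂ[X]) (e : ℚ) :
    Measurable fun z : ℂ => absPower (fun i => (P i).eval z) e := by
  unfold absPower
  have : ∀ i, Measurable fun z : ℂ => (P i).eval z := fun i => (P i).continuous.measurable
  fun_prop

lemma absPower_eval_le [Nonempty (Fin I)] {ε : ℚ} (hε : 0 ≤ ε) {P : Fin I → ℂ[X]}
    (hP : ∀ i, (P i).natDegree ≤ M i) (α z : ℂ) :
    absPower (fun i => (P i).eval z) ε ≤
      (Fintype.card (Σ i : Fin I, Fin (M i + 1)) : ℝ) ^ (ε : ℝ) *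
        ∑ x : Σ i : Fin I, Fin (M i + 1), localNum ε P α x * ‖z - α‖ ^ ((x.2 : ℕ) * (ε : ℝ)) := by
  have hε' : (0 : ℝ) ≤ ε := by exact_mod_cast hε
  have : Nonempty (Σ i : Fin I, Fin (M i + 1)) := ⟨⟨Classical.arbitrary _, 0⟩⟩
  have h1 : ∑ i, ‖(P i).eval z‖ ≤ ∑ x : Σ i : Fin I, Fin (M i + 1),
      ‖(taylor α (P x.1)).coeff x.2‖ * ‖z - α‖ ^ (x.2 : ℕ) := by
    rw [Fintype.sum_sigma]
    refine Finset.sum_le_sum fun i _ => ?_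
    refine (norm_eval_le_taylorNorm α z (P i)).trans (le_of_eq ?_)
    rw [taylorNorm_eq (n := M i + 1) (by have := hP i; omega), Finset.sum_range]
  refine (absPower_le_rpow _ hε h1).trans
    ((rpow_sum_le _ (fun x => by positivity) hε').trans (le_of_eq ?_))
  congr 1
  refine Finset.sum_congr rfl fun x _ => ?_
  rw [Real.mul_rpow (norm_nonneg _) (by positivity), localNum, Real.rpow_natCast_mul (norm_nonneg _)]

/-- The integral over the cell of the center `α`. -/
lemma lintegral_cell_le [Nonempty (Fin I)] (N : ℕ) (ε δ : ℚ) (hε : 0 ≤ ε) (hδ : 0 ≤ δ) (K : ℝ)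
    (hK : 0 < K) : ∃ A : ℝ, 0 < A ∧ ∀ (P : Fin I → ℂ[X]) (Q : Fin J → ℂ[X]) (α : ℂ) (S : Set ℂ),
      MeasurableSet S → (∀ i, (P i).natDegree ≤ M i) →
      (∃ j, 1 / 2 ≤ localCoeff N Q α (j, Fin.last N)) →
      (∀ z ∈ S, ‖z - α‖ < 1 ∧ ∀ y, (localCoeff N Q α y * ‖z - α‖ ^ (y.2 : ℕ)) ^ (δ : ℝ) ≤
        K * absPower (fun j => (Q j).eval z) δ) →
      ∫⁻ z in S, polyRatio ε δ P Q z ≤ ENNReal.ofReal A * ∑ x : Σ i : Fin I, Fin (M i + 1),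
        ENNReal.ofReal (localNum ε P α x) / ENNReal.ofReal (localDen N ε δ Q α x) := by
  have hε' : (0 : ℝ) ≤ ε := by exact_mod_cast hε
  have hδ' : (0 : ℝ) ≤ δ := by exact_mod_cast hδ
  let V := Σ i : Fin I, Fin (M i + 1)
  choose C hC hC' using fun x : V =>
    lintegral_le_balance (ι := Fin J) N (δ : ℝ) ((x.2 : ℕ) * ε + 2) hδ'
  have hS0 : 0 ≤ ∑ x, C x := Finset.sum_nonneg fun x _ => (hC x).le
  set n : ℝ := (Fintype.card V : ℝ) ^ (ε : ℝ) with hn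
  have hn0 : 0 ≤ n := by positivity
  refine ⟨n * K * ∑ x, C x + 1, by positivity, fun P Q α S hS hP hN hz => ?_⟩
  set a : ℂ → ℝ := fun z => absPower (fun j => (Q j).eval z) δ with ha
  have hameas : Measurable a := measurable_absPower_eval Q δ
  -- The part of the integrand belonging to the Taylor index x, translated to the center and
  -- extended by zero.
  let G : V → ℂ → ℝ≥0∞ := fun x w => S.indicator
    (fun z => ENNReal.ofReal (‖z - α‖ ^ ((x.2 : ℕ) * (ε : ℝ))) * (ENNReal.ofReal (K * a z))⁻¹)
      (w + α)
  have hGmeas : ∀ x, Measurable (G x) := by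
    intro x
    refine (Measurable.indicator ?_ hS).comp (measurable_id.add_const α)
    exact Measurable.mul (by fun_prop) (by fun_prop)
  have hpt : ∀ z ∈ S, polyRatio ε δ P Q z ≤
      ∑ x, ENNReal.ofReal (n * K * localNum ε P α x) * G x (z - α) := by
    intro z hzS
    have h1 := absPower_eval_le hε hP α z
    have hG : ∀ x, G x (z - α) = ENNReal.ofReal (‖z - α‖ ^ ((x.2 : ℕ) * (ε : ℝ))) *
        (ENNReal.ofReal (K * a z))⁻¹ := fun x => by simp [G, hzS]
    have hinv : (ENNReal.ofReal (a z))⁻¹ = ENNReal.ofReal K * (ENNReal.ofReal (K * a z))⁻¹ := by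
      rw [ENNReal.ofReal_mul hK.le, ENNReal.mul_inv (Or.inl (by simpa using hK))
        (Or.inl ENNReal.ofReal_ne_top), ← mul_assoc,
        ENNReal.mul_inv_cancel (by simpa using hK) ENNReal.ofReal_ne_top, one_mul]
    rw [polyRatio, div_eq_mul_inv]
    change _ * (ENNReal.ofReal (a z))⁻¹ ≤ _
    rw [hinv, ← mul_assoc]
    simp_rw [hG, ← mul_assoc]
    rw [← Finset.sum_mul]
    gcongr
    rw [← ENNReal.ofReal_mul (absPower_nonneg _ _)]
    calc _ ≤ ENNReal.ofReal (∑ x : V, n * K * localNum ε P α x *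
          ‖z - α‖ ^ ((x.2 : ℕ) * (ε : ℝ))) := by
          apply ENNReal.ofReal_le_ofReal
          calc _ ≤ _ := mul_le_mul_of_nonneg_right h1 hK.le
            _ = _ := by
              rw [mul_right_comm, Finset.mul_sum]
              exact Finset.sum_congr rfl fun x _ => by ring
      _ = _ := by
        rw [ENNReal.ofReal_sum_of_nonneg fun x _ => by
          have := localNum_nonneg ε P α x; positivity]
        refine Finset.sum_congr rfl fun x _ => ?_
        rw [ENNReal.ofReal_mul]
        have := localNum_nonneg ε P α x; positivity
  have hGint : ∀ x, ENNReal.ofReal (n * K * localNum ε P α x) * ∫⁻ w, G x w ≤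
      ENNReal.ofReal (n * K * ∑ x, C x + 1) *
        (ENNReal.ofReal (localNum ε P α x) / ENNReal.ofReal (localDen N ε δ Q α x)) := by
    intro x
    rcases (localNum_nonneg ε P α x).eq_or_lt with h0 | h0
    · simp [← h0]
    rcases (localDen_nonneg N ε δ Q α x).eq_or_lt with h1 | h1
    · rw [← h1, ENNReal.ofReal_zero, ENNReal.div_zero (by simpa using h0), ENNReal.mul_top]
      · exact le_top
      · rw [Ne, ENNReal.ofReal_eq_zero, not_le]; positivity
    have hmain : ∫⁻ w, G x w ≤ ENNReal.ofReal (C x / localDen N ε δ Q α x) := by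
      refine hC' x (localCoeff N Q α) (G x) (localCoeff_nonneg N Q α) hN ?_ ?_ h1
      · intro w hw
        refine Set.indicator_of_notMem (fun hmem => ?_) _
        have := (hz _ hmem).1
        rw [add_sub_cancel_right] at this
        linarith
      · intro w hw y hy
        by_cases hmem : w + α ∈ S
        · have h2 := (hz _ hmem).2 y
          simp only [G, Set.indicator_of_mem hmem]
          rw [add_sub_cancel_right] at h2 ⊢
          have hw0 : 0 < ‖w‖ := norm_pos_iff.2 hw
          have h3 : 0 < (localCoeff N Q α y * ‖w‖ ^ (y.2 : ℕ)) ^ (δ : ℝ) := by positivity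
          rw [← ENNReal.ofReal_inv_of_pos (h3.trans_le h2), ← ENNReal.ofReal_mul (by positivity)]
          apply ENNReal.ofReal_le_ofReal
          calc _ ≤ ‖w‖ ^ ((x.2 : ℕ) * (ε : ℝ)) *
                ((localCoeff N Q α y * ‖w‖ ^ (y.2 : ℕ)) ^ (δ : ℝ))⁻¹ := by
                gcongr
            _ = _ := by
              rw [Real.mul_rpow hy.le (by positivity), mul_inv, ← Real.rpow_neg hy.le,
                ← Real.rpow_natCast_mul hw0.le, ← Real.rpow_neg hw0.le, mul_left_comm,
                ← Real.rpow_add hw0]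
              congr 2
              ring
        · simp [G, hmem]
    calc _ ≤ ENNReal.ofReal (n * K * localNum ε P α x) *
          ENNReal.ofReal (C x / localDen N ε δ Q α x) := by gcongr
      _ = ENNReal.ofReal (n * K * C x) *
          (ENNReal.ofReal (localNum ε P α x) / ENNReal.ofReal (localDen N ε δ Q α x)) := by
        have := hC x
        rw [← ENNReal.ofReal_div_of_pos h1, ← ENNReal.ofReal_mul (by positivity),
          ← ENNReal.ofReal_mul (by positivity)]
        congr 1
        ring
      _ ≤ _ := by
        gcongr
        have h2 : C x ≤ ∑ x, C x := Finset.single_le_sum (f := C) (fun x _ => (hC x).le)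
          (Finset.mem_univ x)
        have : n * K * C x ≤ n * K * ∑ x, C x := by gcongr
        linarith
  calc ∫⁻ z in S, polyRatio ε δ P Q z ≤
        ∫⁻ z in S, ∑ x, ENNReal.ofReal (n * K * localNum ε P α x) * G x (z - α) :=
        setLIntegral_mono' hS hpt
    _ ≤ ∫⁻ z, ∑ x, ENNReal.ofReal (n * K * localNum ε P α x) * G x (z - α) :=
        setLIntegral_le_lintegral _ _
    _ = ∑ x, ENNReal.ofReal (n * K * localNum ε P α x) * ∫⁻ w, G x w := by
        rw [lintegral_finsetSum]
        · refine Finset.sum_congr rfl fun x _ => ?_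
          rw [lintegral_const_mul' _ _ ENNReal.ofReal_ne_top, lintegral_sub_right_eq_self]
        · intro x _
          exact ((hGmeas x).comp (measurable_id.sub_const α)).const_mul _
    _ ≤ _ := by
        rw [Finset.mul_sum]
        exact Finset.sum_le_sum fun x _ => hGint x

/-- The upper estimate: the integral over the unit disc is bounded by the sum over all centers. -/
theorem lintegral_polyRatio_le [Nonempty (Fin I)] [NeZero J] (N D : ℕ) (ε δ : ℚ) (hε : 0 ≤ ε)
    (hδ : 0 ≤ δ) (R : ℝ) (hR : 0 ≤ R) : ∃ A : ℝ, 0 < A ∧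
      ∀ (P : Fin I → ℂ[X]) (Q : Fin J → ℂ[X]) (α : Fin D → ℂ),
      (∀ i, (P i).natDegree ≤ M i) → (∀ j, (Q j).natDegree ≤ N) → 1 / 2 ≤ ‖(Q 0).coeff N‖ →
      (∀ d, ‖α d‖ ≤ R) → (∃ d, α d = 0) → (∀ a ∈ (Q 0).roots, ∃ d, α d = a) →
      (∀ j, j ≠ 0 → ∀ a ∈ (X * Q 0 + Q j).roots, ∃ d, α d = a) →
      ∫⁻ z in Metric.ball (0 : ℂ) 1, polyRatio ε δ P Q z ≤ ENNReal.ofReal A *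
        ∑ d, ∑ x : Σ i : Fin I, Fin (M i + 1),
          ENNReal.ofReal (localNum ε P (α d) x) / ENNReal.ofReal (localDen N ε δ Q (α d) x) := by
  have hδ' : (0 : ℝ) ≤ δ := by exact_mod_cast hδ
  set K₀ : ℝ := 3 ^ (N + 1) * (2 + R) * 2 with hK₀
  have hK₀0 : 0 < K₀ := by positivity
  obtain ⟨A, hA, hA'⟩ := lintegral_cell_le (I := I) (J := J) (M := M) N ε δ hε hδ
    (K₀ ^ (δ : ℝ)) (by positivity)
  refine ⟨A, hA, fun P Q α hP hQ hlc hαR h0 hr0 hrj => ?_⟩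
  -- Cells may overlap where two centers are equally near: the upper bound needs only a cover.
  let S : Fin D → Set ℂ := fun d => Metric.ball 0 1 ∩ {z | ∀ d', ‖z - α d‖ ≤ ‖z - α d'‖}
  have hSm : ∀ d, MeasurableSet (S d) := by
    intro d
    refine measurableSet_ball.inter ?_
    rw [Set.ofPred_forall]
    exact MeasurableSet.iInter fun d' => measurableSet_le (by fun_prop) (by fun_prop)
  have hcover : Metric.ball (0 : ℂ) 1 ⊆ ⋃ d, S d := by
    intro z hz
    obtain ⟨d₀, -⟩ := h0
    have : Nonempty (Fin D) := ⟨d₀⟩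
    obtain ⟨d, hd⟩ := Finite.exists_min fun d => ‖z - α d‖
    exact Set.mem_iUnion.2 ⟨d, hz, hd⟩
  calc _ ≤ ∫⁻ z in ⋃ d, S d, polyRatio ε δ P Q z := lintegral_mono_set hcover
    _ ≤ ∑ d, ∫⁻ z in S d, polyRatio ε δ P Q z := by
      refine (lintegral_iUnion_le _ _).trans ?_
      rw [tsum_fintype]
    _ ≤ _ := by
      rw [Finset.mul_sum]
      refine Finset.sum_le_sum fun d _ => hA' P Q (α d) (S d) (hSm d) hP ⟨0, ?_⟩ ?_
      · rw [localCoeff, Fin.val_last]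
        by_cases h : (Q 0).natDegree = N
        · have h2 := coeff_taylor_natDegree (α d) (Q 0)
          rw [h] at h2
          rw [h2, leadingCoeff, h]
          exact hlc
        · have h2 := hQ 0
          rw [coeff_eq_zero_of_natDegree_lt (by omega), norm_zero] at hlc
          norm_num at hlc
      · rintro z ⟨hz1, hz2⟩
        rw [Metric.mem_ball, dist_zero_right] at hz1
        -- The origin is a center, so the nearest one is at distance at most |z| < 1. This is why z
        -- Q_0 is used instead of Q_0.
        have hz3 : ‖z - α d‖ < 1 := by
          obtain ⟨d₀, hd₀⟩ := h0
          have := hz2 d₀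
          rw [hd₀, sub_zero] at this
          exact this.trans_lt hz1
        refine ⟨hz3, fun y => ?_⟩
        obtain ⟨j, j', hjj⟩ := localCoeff_mul_pow_le hQ (hαR d) hz1.le hz3.le
          (fun a ha => by obtain ⟨d', rfl⟩ := hr0 a ha; exact hz2 d')
          (fun j hj a ha => by obtain ⟨d', rfl⟩ := hrj j hj a ha; exact hz2 d') y
        obtain ⟨k, hk⟩ : ∃ k, localCoeff N Q (α d) y * ‖z - α d‖ ^ (y.2 : ℕ) ≤
            K₀ * ‖(Q k).eval z‖ := by
          rcases le_total ‖(Q j).eval z‖ ‖(Q j').eval z‖ with h | h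
          · refine ⟨j', hjj.trans ?_⟩
            rw [hK₀, mul_assoc _ (2 : ℝ)]
            gcongr
            linarith
          · refine ⟨j, hjj.trans ?_⟩
            rw [hK₀, mul_assoc _ (2 : ℝ)]
            gcongr
            linarith
        have hq := localCoeff_nonneg N Q (α d) y
        calc _ ≤ (K₀ * ‖(Q k).eval z‖) ^ (δ : ℝ) :=
              Real.rpow_le_rpow (by positivity) hk hδ'
          _ = K₀ ^ (δ : ℝ) * ‖(Q k).eval z‖ ^ (δ : ℝ) :=
              Real.mul_rpow hK₀0.le (norm_nonneg _)
          _ ≤ _ := by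
            gcongr
            exact rpow_norm_le_absPower (fun j => (Q j).eval z) hδ k

end UpperEstimate

/-! ### The lower estimate, center by center -/

section LowerEstimate

open Polynomial

variable {I J : ℕ} {M : Fin I → ℕ}

/-- The pair of indices 0 and N gives the bound if κ < N δ, and the constant term 1 otherwise. It
serves centers away from the origin, where Q_0, being close to z^N, is bounded below. -/
lemma exists_le_balanceTerm {ι : Type*} (N : ℕ) (δ κ c₁ : ℝ) (hκ : 0 < κ) (hc₁ : 0 < c₁)
    (hnd : κ ≠ N * δ) : ∃ c : ℝ, 0 < c ∧ ∀ (q : ι × Fin (N + 1) → ℝ) (j : ι), c₁ ≤ q (j, 0) →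
      1 / 2 ≤ q (j, Fin.last N) → ∃ θ, c ≤ balanceTerm δ κ q θ := by
  rcases lt_or_gt_of_ne hnd with hlt | hgt
  · have hN : (0 : ℝ) < N := by
      rcases Nat.eq_zero_or_pos N with rfl | h
      · simp at hlt; linarith
      · exact_mod_cast h
    refine ⟨c₁ ^ ((N * δ - κ) / N) * (1 / 2) ^ (κ / N), by positivity, fun q j h0 hl => ?_⟩
    refine ⟨some ((j, 0), (j, Fin.last N)), ?_⟩
    simp only [balanceTerm, Fin.val_zero, Nat.cast_zero, zero_mul, hκ, Fin.val_last, hlt, and_self,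
      if_true, sub_zero]
    have : 0 ≤ N * δ - κ := by linarith
    have := hc₁.trans_le h0
    gcongr
  · exact ⟨1, one_pos, fun q j _ _ => ⟨none, by simp [balanceTerm, hgt]⟩⟩

/-- A lower bound for the integral by the values on a ball. -/
lemma le_lintegral_of_ball (ε δ : ℚ) (hε : 0 ≤ ε) (R : ℝ) (hR : 0 ≤ R)
    (x : Σ i : Fin I, Fin (M i + 1)) : ∃ c : ℝ, 0 < c ∧
      ∀ (P : Fin I → ℂ[X]) (Q : Fin J → ℂ[X]) (α β : ℂ) (r G : ℝ),
      (∀ i, (P i).natDegree ≤ M i) → 0 < r → Metric.ball β r ⊆ Metric.ball 0 1 →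
      ‖α - β‖ ≤ R * r → 0 < G →
      (∀ z ∈ Metric.ball β r, absPower (fun j => (Q j).eval z) δ ≤ G) →
      ENNReal.ofReal (c * localNum ε P α x * r ^ ((x.2 : ℕ) * (ε : ℝ) + 2) / G) ≤
        ∫⁻ z in Metric.ball (0 : ℂ) 1, polyRatio ε δ P Q z := by
  have hε' : (0 : ℝ) ≤ ε := by exact_mod_cast hε
  obtain ⟨c, hc, hball⟩ := exists_ball_taylorNorm_le (M x.1) R hR
  refine ⟨c ^ (ε : ℝ) * (Real.pi * c ^ 2), by positivity,
    fun P Q α β r G hP hr hsub hαβ hG hQ => ?_⟩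
  obtain ⟨ζ, h1, h2⟩ := hball (P x.1) α β r (hP x.1) hr hαβ
  set t : ℝ := c ^ (ε : ℝ) * localNum ε P α x * r ^ ((x.2 : ℕ) * (ε : ℝ)) with ht
  have hX := localNum_nonneg ε P α x
  have hpt : ∀ z ∈ Metric.ball ζ (c * r), ENNReal.ofReal (t / G) ≤ polyRatio ε δ P Q z := by
    intro z hz
    rw [ENNReal.ofReal_div_of_pos hG, polyRatio]
    gcongr
    · refine le_trans ?_ (rpow_norm_le_absPower (fun i => (P i).eval z) hε x.1)
      calc t = (c * (‖(taylor α (P x.1)).coeff x.2‖ * r ^ (x.2 : ℕ))) ^ (ε : ℝ) := by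
            rw [Real.mul_rpow hc.le (by positivity), Real.mul_rpow (norm_nonneg _) (by positivity),
              ← Real.rpow_natCast_mul hr.le, ht, localNum, mul_assoc]
        _ ≤ _ := by
          apply Real.rpow_le_rpow (by positivity) _ hε'
          refine le_trans ?_ (h2 z hz)
          gcongr
          exact coeff_taylor_le hr.le _
    · exact hQ z (h1 hz)
  calc _ = ENNReal.ofReal (t / G) * volume (Metric.ball ζ (c * r)) := by
        rw [Complex.volume_ball, ← ENNReal.ofReal_pow (by positivity),
          show (NNReal.pi : ℝ≥0∞) = ENNReal.ofReal Real.pi from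
            (ENNReal.ofReal_eq_coe_nnreal Real.pi_pos.le).symm,
          ← ENNReal.ofReal_mul (by positivity), ← ENNReal.ofReal_mul (by positivity), ht,
          Real.rpow_add hr, Real.rpow_two]
        congr 1
        ring
    _ = ∫⁻ z in Metric.ball ζ (c * r), ENNReal.ofReal (t / G) := by
        rw [setLIntegral_const]
    _ ≤ ∫⁻ z in Metric.ball ζ (c * r), polyRatio ε δ P Q z :=
        setLIntegral_mono' measurableSet_ball hpt
    _ ≤ _ := lintegral_mono_set (h1.trans hsub)

/-- The lower estimate: each term of the sum over the centers is bounded by the integral. -/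
theorem le_lintegral_polyRatio [NeZero J] (N : ℕ) (ε δ : ℚ) (hε : 0 ≤ ε) (hδ : 0 ≤ δ)
    (R B c₁ : ℝ) (hR : 0 ≤ R) (hB : 0 < B) (hc₁ : 0 < c₁) (x : Σ i : Fin I, Fin (M i + 1))
    (hnd : ∀ l ≤ N, (l : ℝ) * δ ≠ (x.2 : ℕ) * ε + 2) : ∃ A : ℝ, 0 < A ∧
      ∀ (P : Fin I → ℂ[X]) (Q : Fin J → ℂ[X]) (α : ℂ),
      (∀ i, (P i).natDegree ≤ M i) → (∀ j, (Q j).natDegree ≤ N) → 1 / 2 ≤ ‖(Q 0).coeff N‖ →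
      (∀ j k, ‖(Q j).coeff k‖ ≤ B) → (∀ z, 1 / 2 ≤ ‖z‖ → c₁ ≤ ‖(Q 0).eval z‖) → ‖α‖ ≤ R →
      ENNReal.ofReal (localNum ε P α x) / ENNReal.ofReal (localDen N ε δ Q α x) ≤
        ENNReal.ofReal A * ∫⁻ z in Metric.ball (0 : ℂ) 1, polyRatio ε δ P Q z := by
  have hε' : (0 : ℝ) ≤ ε := by exact_mod_cast hε
  have hδ' : (0 : ℝ) ≤ δ := by exact_mod_cast hδ
  set κ : ℝ := (x.2 : ℕ) * ε + 2 with hκ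
  have hκ0 : 0 < κ := by positivity
  obtain ⟨c₂, hc₂, hlow⟩ := le_lintegral_of_ball (J := J) ε δ hε (2 * R) (by positivity) x
  set B' : ℝ := (N + 1) * (B * (1 + R) ^ N) with hB'
  have hB'0 : 0 < B' := by positivity
  obtain ⟨C, hC, hrad⟩ := exists_radius (ι := Fin J) N (δ : ℝ) κ B' hδ' hκ0.le hB'0
    ⟨fun h => hnd N le_rfl h.symm, hnd⟩
  obtain ⟨c₃, hc₃, hbal⟩ := exists_le_balanceTerm (ι := Fin J) N (δ : ℝ) κ c₁ hκ0 hc₁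
    (fun h => hnd N le_rfl h.symm)
  set n : ℝ := (Fintype.card (Fin J × Fin (N + 1)) : ℝ) with hn
  have hJ : Nonempty (Fin J × Fin (N + 1)) := ⟨(0, 0)⟩
  have hn0 : 0 < n := by rw [hn]; exact_mod_cast Fintype.card_pos
  -- The first summand serves a ball around α, the second a ball around the origin.
  set K : ℝ := n ^ (δ : ℝ) * n * C + (n * B') ^ (δ : ℝ) * 2 ^ κ / c₃ with hK
  have hK0 : 0 < K := by positivity
  refine ⟨K / c₂, by positivity, fun P Q α hP hQ hlc hcoef hQ0 hα => ?_⟩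
  have hq := localCoeff_nonneg N Q α
  have hqB : ∀ y, localCoeff N Q α y ≤ B' := fun y =>
    norm_coeff_taylor_le (Q y.1) (hQ y.1) (hcoef y.1) hα _
  have hqN : 1 / 2 ≤ localCoeff N Q α (0, Fin.last N) := by
    rw [localCoeff, Fin.val_last]
    by_cases h : (Q 0).natDegree = N
    · have h2 := coeff_taylor_natDegree α (Q 0)
      rw [h] at h2
      rw [h2, leadingCoeff, h]
      exact hlc
    · have h2 := hQ 0
      rw [coeff_eq_zero_of_natDegree_lt (by omega), norm_zero] at hlc
      norm_num at hlc
  have hsum : ∀ (α z : ℂ) (r : ℝ), ‖z - α‖ ≤ r → ∑ j, ‖(Q j).eval z‖ ≤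
      ∑ y : Fin J × Fin (N + 1), localCoeff N Q α y * r ^ (y.2 : ℕ) := by
    intro α z r hz
    rw [Fintype.sum_prod_type]
    refine Finset.sum_le_sum fun j _ => (norm_eval_le_taylorNorm α z (Q j)).trans ?_
    rw [taylorNorm_eq (n := N + 1) (by have := hQ j; omega), Finset.sum_range]
    simp only [localCoeff]
    gcongr
  -- τ is left free: it is taken as the sum of the balance terms if that is positive, and
  -- arbitrarily small if it is zero.
  have key : ∀ τ, 0 < τ → (∀ θ, balanceTerm (δ : ℝ) κ (localCoeff N Q α) θ ≤ τ) →
      ENNReal.ofReal (c₂ * localNum ε P α x / (K * τ)) ≤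
        ∫⁻ z in Metric.ball (0 : ℂ) 1, polyRatio ε δ P Q z := by
    intro τ hτ hθ
    obtain ⟨β, r, hr, hsub, hαβ, hG⟩ : ∃ (β : ℂ) (r : ℝ), 0 < r ∧
        Metric.ball β r ⊆ Metric.ball 0 1 ∧ ‖α - β‖ ≤ 2 * R * r ∧
        ∀ z ∈ Metric.ball β r, absPower (fun j => (Q j).eval z) δ ≤ K * τ * r ^ κ := by
      -- A ball of radius at most 1/2 around such an α stays in the unit disc.
      by_cases hα2 : ‖α‖ ≤ 1 / 2
      · obtain ⟨r, hr, hr2, hrq⟩ := hrad (localCoeff N Q α) τ hq hqB ⟨0, hqN⟩ hτ hθ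
        refine ⟨α, r, hr, ?_, by rw [sub_self, norm_zero]; positivity, fun z hz => ?_⟩
        · intro z hz
          rw [Metric.mem_ball, dist_eq_norm] at hz
          rw [Metric.mem_ball, dist_zero_right]
          calc ‖z‖ ≤ ‖z - α‖ + ‖α‖ := norm_le_norm_sub_add z α
            _ < 1 := by linarith
        · rw [Metric.mem_ball, dist_eq_norm] at hz
          calc _ ≤ _ := absPower_le_rpow _ hδ (hsum α z r hz.le)
            _ ≤ n ^ (δ : ℝ) * ∑ y : Fin J × Fin (N + 1),
                (localCoeff N Q α y * r ^ (y.2 : ℕ)) ^ (δ : ℝ) :=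
              rpow_sum_le _ (fun y => mul_nonneg (hq y) (by positivity)) hδ'
            _ ≤ n ^ (δ : ℝ) * ∑ y : Fin J × Fin (N + 1), C * τ * r ^ κ := by
              gcongr with y
              exact hrq y
            _ = n ^ (δ : ℝ) * n * C * τ * r ^ κ := by
              rw [Finset.sum_const, Finset.card_univ, nsmul_eq_mul]; ring
            _ ≤ _ := by
              gcongr
              rw [hK]
              exact le_add_of_nonneg_right (by positivity)
      -- A ball around α might leave the disc. But here τ is bounded below, so the ball of radius
      -- 1/2 around the origin does; α is at most R, that is 2R radii, away from it.
      · push Not at hα2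
        refine ⟨0, 1 / 2, by norm_num, Metric.ball_subset_ball (by norm_num), ?_, fun z hz => ?_⟩
        · rw [sub_zero]; linarith
        · rw [Metric.mem_ball, dist_eq_norm] at hz
          have hτ3 : c₃ ≤ τ := by
            obtain ⟨θ, hθ'⟩ := hbal (localCoeff N Q α) 0 (by
              rw [localCoeff]
              simp only [Fin.val_zero, taylor_coeff_zero]
              exact hQ0 α hα2.le) hqN
            exact hθ'.trans (hθ θ)
          have h1 : ∑ y : Fin J × Fin (N + 1), localCoeff N Q 0 y * (1 / 2) ^ (y.2 : ℕ) ≤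
              n * B' := by
            calc _ ≤ ∑ y : Fin J × Fin (N + 1), B' := by
                  refine Finset.sum_le_sum fun y _ => ?_
                  have h2 := norm_coeff_taylor_le (Q y.1) (hQ y.1) (hcoef y.1)
                    (show ‖(0 : ℂ)‖ ≤ R by simpa using hR) y.2
                  calc _ ≤ B' * 1 := by
                        apply mul_le_mul h2 _ (by positivity) hB'0.le
                        exact pow_le_one₀ (by norm_num) (by norm_num)
                    _ = _ := mul_one _
              _ = _ := by rw [Finset.sum_const, Finset.card_univ, nsmul_eq_mul]
          have h3 : ((1 : ℝ) / 2) ^ κ = (2 ^ κ)⁻¹ := by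
            rw [one_div, Real.inv_rpow (by norm_num)]
          have h4 : (0 : ℝ) < 2 ^ κ := by positivity
          rw [h3]
          calc _ ≤ (n * B') ^ (δ : ℝ) := absPower_le_rpow _ hδ ((hsum 0 z _ hz.le).trans h1)
            _ = (n * B') ^ (δ : ℝ) * 2 ^ κ / c₃ * c₃ * (2 ^ κ)⁻¹ := by field_simp
            _ ≤ K * τ * (2 ^ κ)⁻¹ := by
              gcongr
              rw [hK]
              exact le_add_of_nonneg_left (by positivity)
    have hmain := hlow P Q α β r (K * τ * r ^ κ) hP hr hsub hαβ (by positivity) hG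
    refine le_trans (ENNReal.ofReal_le_ofReal (le_of_eq ?_)) hmain
    have : 0 < r ^ κ := by positivity
    rw [← hκ]
    field_simp
  set Int := ∫⁻ z in Metric.ball (0 : ℂ) 1, polyRatio ε δ P Q z with hInt
  rcases (localNum_nonneg ε P α x).eq_or_lt with hX | hX
  · simp [← hX]
  rcases (localDen_nonneg N ε δ Q α x).eq_or_lt with hY | hY
  · have hθ0 : ∀ θ, balanceTerm (δ : ℝ) κ (localCoeff N Q α) θ ≤ 0 := by
      intro θ
      rw [hY, localDen]
      exact Finset.single_le_sum (f := fun θ => balanceTerm (δ : ℝ) κ (localCoeff N Q α) θ)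
        (fun θ _ => balanceTerm_nonneg hq θ) (Finset.mem_univ θ)
    -- All balance terms vanish, so the lower bound holds for every τ > 0 and grows beyond all
    -- limits as τ tends to 0.
    have htop : Int = ⊤ := by
      refine ENNReal.eq_top_of_forall_nnreal_le fun s => ?_
      have hs : (0 : ℝ) < s + 1 := by positivity
      have h1 := key (c₂ * localNum ε P α x / (K * (s + 1))) (by positivity) fun θ =>
        (hθ0 θ).trans (by positivity)
      refine le_trans ?_ h1
      rw [← ENNReal.ofReal_coe_nnreal]
      apply ENNReal.ofReal_le_ofReal
      rw [le_div_iff₀ (by positivity), mul_div_assoc', mul_div_assoc', div_le_iff₀ (by positivity)]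
      have : 0 ≤ K * (c₂ * localNum ε P α x) := by positivity
      nlinarith
    rw [htop, ENNReal.mul_top]
    · exact le_top
    · rw [Ne, ENNReal.ofReal_eq_zero, not_le]; positivity
  · have h1 := key (localDen N ε δ Q α x) hY fun θ =>
      Finset.single_le_sum (f := fun θ => balanceTerm (δ : ℝ) κ (localCoeff N Q α) θ)
        (fun θ _ => balanceTerm_nonneg hq θ) (Finset.mem_univ θ)
    calc _ = ENNReal.ofReal (K / c₂) *
          ENNReal.ofReal (c₂ * localNum ε P α x / (K * localDen N ε δ Q α x)) := by
          rw [← ENNReal.ofReal_div_of_pos hY, ← ENNReal.ofReal_mul (by positivity)]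
          congr 1
          field_simp
      _ ≤ _ := by gcongr

end LowerEstimate

/-! ### Descent of the stratum numerators and denominators -/

section StrataDescent

variable {R : Type*} [CommRing R] {D : ℕ} {V Θ : Type*} [Fintype V] [Fintype Θ]

/-- The polynomial `f` at the root with index `d`. -/
def atRoot (d : Fin D) (f : Polynomial R) : MvPolynomial (Fin D) R :=
  Polynomial.aeval (MvPolynomial.X d) f

lemma rename_atRoot (s : Equiv.Perm (Fin D)) (d : Fin D) (f : Polynomial R) :
    MvPolynomial.rename s (atRoot d f) = atRoot (s d) f := by
  rw [atRoot, atRoot, ← Polynomial.aeval_algHom_apply, MvPolynomial.rename_X]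

lemma eval_atRoot (ψ : R →+* ℂ) (α : Fin D → ℂ) (d : Fin D) (f : Polynomial R) :
    MvPolynomial.eval₂Hom ψ α (atRoot d f) = (f.map ψ).eval (α d) := by
  rw [atRoot, Polynomial.aeval_def, Polynomial.hom_eval₂, Polynomial.eval_map]
  congr 1
  · ext r; simp [MvPolynomial.algebraMap_eq]
  · simp

/-- The power of the absolute value of `f v` at a root. -/
def rootNum (f : V → Polynomial R) (e : ℚ) (ψ : R →+* ℂ) (α : Fin D → ℂ) (k : Fin D × V) : ℝ≥0 :=
  ‖((f k.2).map ψ).eval (α k.1)‖₊ ^ (e : ℝ)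

/-- The sum of the powers of the absolute values of the `f v θ` at a root. -/
def rootDen (f : V → Θ → Polynomial R) (e : ℚ) (ψ : R →+* ℂ) (α : Fin D → ℂ) (k : Fin D × V) :
    ℝ≥0 :=
  ∑ θ, ‖((f k.2 θ).map ψ).eval (α k.1)‖₊ ^ (e : ℝ)

/-- The numbers that the absolute power `(g, e')` is comparable to, as long as `‖lc‖` is bounded
above and below. -/
def IsDescentOf {n : ℕ} (H : Polynomial R) (lc : R) (g : Fin n → R) (e' : ℚ)
    (F : (R →+* ℂ) → (Fin D → ℂ) → ℝ≥0) : Prop :=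
  0 < e' ∧ (∀ ψ : R →+* ℂ, ψ lc = 0 → ∀ i, ψ (g i) = 0) ∧
    ∀ c : ℝ, 0 < c → ∃ A : ℝ, 0 < A ∧ ∀ (ψ : R →+* ℂ) (α : Fin D → ℂ),
      IsRootFamily H lc ψ α → c ≤ ‖ψ lc‖ → ‖ψ lc‖ ≤ c⁻¹ →
      absPower (fun i => ψ (g i)) e' ≤ A * F ψ α ∧ F ψ α ≤ A * absPower (fun i => ψ (g i)) e'

lemma exists_isDescentOf (H : Polynomial R) (lc : R) {ι : Type*} [Fintype ι]
    (κ : ι → MvPolynomial (Fin D) R)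
    (hκ : ∀ s : Equiv.Perm (Fin D), ∃ τ : Equiv.Perm ι, ∀ i, MvPolynomial.rename s (κ i) = κ (τ i))
    (e : ℚ) (he : 0 < e) (F : (R →+* ℂ) → (Fin D → ℂ) → ℝ≥0)
    (hF : ∀ ψ α, F ψ α = ∑ i, ‖MvPolynomial.eval₂Hom ψ α (κ i)‖₊ ^ (e : ℝ)) :
    ∃ (n : ℕ) (g : Fin n → R) (e' : ℚ), IsDescentOf H lc g e' F := by
  obtain ⟨n, g, e', h1, h2, h3⟩ := exists_absPower_descent H lc κ hκ e he
  refine ⟨n, g, e', h1, h2, fun c hc => ?_⟩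
  obtain ⟨A, hA, hA'⟩ := h3 c hc
  refine ⟨A, hA, fun ψ α hr hc1 hc2 => ?_⟩
  have h4 : (F ψ α : ℝ) = ∑ i, ‖MvPolynomial.eval₂Hom ψ α (κ i)‖ ^ (e : ℝ) := by
    rw [hF]; push_cast; rfl
  rw [h4]
  exact hA' ψ α hr hc1 hc2

/-- The permutation of the tuples of pairs induced by a permutation of the roots. -/
def permTuples (n : ℕ) (Λ : Type*) (s : Equiv.Perm (Fin D)) :
    Equiv.Perm ((Fin n ↪ Fin D × V) × Λ) :=
  (Equiv.embeddingCongr (Equiv.refl _) (s.prodCongr (Equiv.refl V))).prodCongr (Equiv.refl _)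

/-- Multiplying out the factors Y, each a sum over Θ, turns the numerator into a sum over tuples
with a choice of θ at each place after the first. Each term is the e-th power of the absolute value
of one polynomial in the roots, and permuting the roots permutes the tuples. -/
theorem exists_stratNum_descent (H : Polynomial R) (lc : R) (fx : V → Polynomial R)
    (fy : V → Θ → Polynomial R) (e : ℚ) (he : 0 < e) (n : ℕ) :
    ∃ (m : ℕ) (g : Fin m → R) (e' : ℚ), IsDescentOf (D := D) H lc g e'
      fun ψ α => stratNum (rootNum fx e ψ α) (rootDen fy e ψ α) n := by
  classical
  refine exists_isDescentOf H lc
    (ι := (Fin (n + 1) ↪ Fin D × V) × (Fin n → Θ))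
    (fun x => atRoot (x.1 0).1 (fx (x.1 0).2) *
      ∏ i : Fin n, atRoot (x.1 i.succ).1 (fy (x.1 i.succ).2 (x.2 i)))
    (fun s => ⟨permTuples (n + 1) (Fin n → Θ) s, fun x => ?_⟩) e he _ fun ψ α => ?_
  · rw [map_mul, map_prod, rename_atRoot]
    simp_rw [rename_atRoot]
    rfl
  · rw [stratNum, Fintype.sum_prod_type]
    refine Finset.sum_congr (by congr!) fun x _ => ?_
    simp only [rootNum, rootDen, map_mul, map_prod, eval_atRoot, nnnorm_mul, nnnorm_prod,
      NNReal.mul_rpow, ← NNReal.finsetProd_rpow]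
    rw [Finset.prod_univ_sum, Fintype.piFinset_univ, Finset.mul_sum]

theorem exists_stratDen_descent (H : Polynomial R) (lc : R)
    (fy : V → Θ → Polynomial R) (e : ℚ) (he : 0 < e) (n : ℕ) :
    ∃ (m : ℕ) (g : Fin m → R) (e' : ℚ), IsDescentOf (D := D) H lc g e'
      fun ψ α => stratDen (rootDen fy e ψ α) n := by
  classical
  refine exists_isDescentOf H lc
    (ι := (Fin (n + 1) ↪ Fin D × V) × (Fin (n + 1) → Θ))
    (fun x => ∏ i, atRoot (x.1 i).1 (fy (x.1 i).2 (x.2 i)))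
    (fun s => ⟨permTuples (n + 1) (Fin (n + 1) → Θ) s, fun x => ?_⟩) e he _ fun ψ α => ?_
  · rw [map_prod]
    simp_rw [rename_atRoot]
    rfl
  · rw [stratDen, Fintype.sum_prod_type]
    refine Finset.sum_congr (by congr!) fun x _ => ?_
    simp only [rootDen, map_prod, eval_atRoot, nnnorm_prod, ← NNReal.finsetProd_rpow]
    rw [Finset.prod_univ_sum, Fintype.piFinset_univ]

end StrataDescent

/-! ### Making a chain strict -/

section Prune

/-- A chain of sets becomes strict after its repetitions are left out. -/
lemma exists_strictAnti_chain {X T : Type*} (Good : Set X → Set X → T → Prop) (m : ℕ)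
    (W : ℕ → Set X) (hW : ∀ t < m, W (t + 1) ⊆ W t) (hm : W m = ∅)
    (h : ∀ t < m, W (t + 1) ≠ W t → ∃ τ, Good (W t) (W (t + 1)) τ) :
    ∃ (n : ℕ) (U : Fin (n + 1) → Set X) (τ : Fin n → T), (∀ l, ∃ t ≤ m, U l = W t) ∧
      StrictAnti U ∧ U 0 = W 0 ∧ U (Fin.last n) = ∅ ∧
      ∀ l : Fin n, Good (U l.castSucc) (U l.succ) (τ l) := by
  induction m generalizing W with
  | zero =>
    refine ⟨0, fun _ => W 0, Fin.elim0, fun _ => ⟨0, le_rfl, rfl⟩, ?_, rfl, hm, fun l => l.elim0⟩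
    intro a b hab
    omega
  | succ m ih =>
    obtain ⟨n, U, τ, h1, h2, h3, h4, h5⟩ := ih (fun t => W (t + 1))
      (fun t ht => hW (t + 1) (by omega)) hm (fun t ht => h (t + 1) (by omega))
    have h1' : ∀ l, ∃ t ≤ m + 1, U l = W t := fun l => by
      obtain ⟨t, ht, h⟩ := h1 l
      exact ⟨t + 1, by omega, h⟩
    -- A repetition is skipped; otherwise `W 0` is put in front of the chain obtained from the
    -- shifted sequence.
    by_cases heq : W 1 = W 0
    · exact ⟨n, U, τ, h1', h2, h3.trans heq, h4, h5⟩
    · obtain ⟨τ₀, hτ₀⟩ := h 0 (by omega) heq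
      refine ⟨n + 1, Fin.cons (W 0) U, Fin.cons τ₀ τ, ?_, ?_, rfl, ?_, ?_⟩
      · intro l
        induction l using Fin.cases with
        | zero => exact ⟨0, by omega, rfl⟩
        | succ l => exact h1' l
      · rw [Fin.strictAnti_iff_succ_lt]
        intro l
        induction l using Fin.cases with
        | zero =>
          change U 0 < W 0
          rw [h3]
          exact lt_of_le_of_ne (hW 0 (by omega)) heq
        | succ l =>
          rw [Fin.castSucc_succ, Fin.cons_succ, Fin.cons_succ]
          exact h2 l.castSucc_lt_succ
      · rw [← Fin.succ_last, Fin.cons_succ, h4]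
      · intro l
        induction l using Fin.cases with
        | zero =>
          change Good (W 0) (U 0) τ₀
          rw [h3]
          exact hτ₀
        | succ l =>
          rw [Fin.castSucc_succ, Fin.cons_succ, Fin.cons_succ, Fin.cons_succ]
          exact h5 l

end Prune

/-! ### Polynomials close to a monic power -/

section NearMonic

open Polynomial

lemma norm_coeff_le_polyNorm (f : ℂ[X]) (k : ℕ) : ‖f.coeff k‖ ≤ polyNorm f := by
  by_cases hk : k ∈ f.support
  · exact Finset.single_le_sum (f := fun k => ‖f.coeff k‖) (fun _ _ => norm_nonneg _) hk
  · rw [notMem_support_iff.1 hk, norm_zero]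
    exact Finset.sum_nonneg fun _ _ => norm_nonneg _

lemma norm_eval_le_polyNorm (f : ℂ[X]) {n : ℕ} (hf : f.natDegree ≤ n) {z : ℂ} {m : ℝ} (hm : 1 ≤ m)
    (hz : ‖z‖ ≤ m) : ‖f.eval z‖ ≤ polyNorm f * m ^ n := by
  rw [eval_eq_sum, Polynomial.sum, polyNorm, Finset.sum_mul]
  refine (norm_sum_le _ _).trans (Finset.sum_le_sum fun k hk => ?_)
  rw [norm_mul, norm_pow]
  gcongr
  calc ‖z‖ ^ k ≤ m ^ k := by gcongr
    _ ≤ m ^ n := pow_le_pow_right₀ hm ((le_natDegree_of_mem_supp k hk).trans hf)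

/-- A polynomial close to `z^N` is bounded below outside of a disc. -/
lemma le_norm_eval_of_near_monic {f : ℂ[X]} {N : ℕ} (hN : f.natDegree ≤ N)
    (hf : polyNorm (f - X ^ N) < (1 / 2) ^ (N + 1)) {z : ℂ} (hz : 1 / 2 ≤ ‖z‖) :
    (1 / 2) ^ (N + 1) ≤ ‖f.eval z‖ := by
  have hdeg : (f - X ^ N).natDegree ≤ N :=
    natDegree_sub_le_of_le hN (natDegree_X_pow_le N) |>.trans (by simp)
  have h1 : ‖z‖ ^ N - ‖(f - X ^ N).eval z‖ ≤ ‖f.eval z‖ := by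
    have : f.eval z = z ^ N + (f - X ^ N).eval z := by simp
    rw [this, ← norm_pow]
    have := norm_sub_le_norm_add (z ^ N) ((f - X ^ N).eval z)
    linarith
  -- For |z| ≤ 1 the main term is at least 2^(-N), twice the bound on the perturbation. For |z| ≥ 1
  -- the perturbation is at most half of |z|^N.
  rcases le_total ‖z‖ 1 with h | h
  · have h2 := norm_eval_le_polyNorm (f - X ^ N) hdeg le_rfl h
    rw [one_pow, mul_one] at h2
    have h3 : ((1 : ℝ) / 2) ^ N ≤ ‖z‖ ^ N := by gcongr
    rw [pow_succ] at hf ⊢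
    linarith
  · have h2 := norm_eval_le_polyNorm (f - X ^ N) hdeg h le_rfl
    have h3 : (1 : ℝ) ≤ ‖z‖ ^ N := one_le_pow₀ h
    have h4 : ((1 : ℝ) / 2) ^ (N + 1) ≤ 1 / 2 := by
      rw [pow_succ]
      have : ((1 : ℝ) / 2) ^ N ≤ 1 := pow_le_one₀ (by norm_num) (by norm_num)
      linarith
    have h5 : polyNorm (f - X ^ N) * ‖z‖ ^ N ≤ 1 / 2 * ‖z‖ ^ N := by
      gcongr; linarith
    linarith

/-- Cauchy's bound for the roots. -/
lemma norm_le_of_isRoot {f : ℂ[X]} {n : ℕ} {B : ℝ} (hn : f.natDegree ≤ n + 1)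
    (hlc : 1 / 2 ≤ ‖f.coeff (n + 1)‖) (hB : ∀ k, ‖f.coeff k‖ ≤ B) {a : ℂ} (ha : f.eval a = 0) :
    ‖a‖ ≤ 1 + 2 * (n + 1) * B := by
  have hB0 : 0 ≤ B := (norm_nonneg _).trans (hB 0)
  rcases le_total ‖a‖ 1 with h | h
  · have : 0 ≤ 2 * ((n : ℝ) + 1) * B := by positivity
    linarith
  rw [eval_eq_sum_range' (n := n + 2) (by omega), Finset.sum_range_succ] at ha
  have h1 : ‖f.coeff (n + 1)‖ * ‖a‖ ^ (n + 1) ≤ (n + 1) * B * ‖a‖ ^ n := by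
    calc _ = ‖∑ k ∈ Finset.range (n + 1), f.coeff k * a ^ k‖ := by
          rw [← norm_pow, ← norm_mul, eq_neg_of_add_eq_zero_right ha, norm_neg]
      _ ≤ ∑ k ∈ Finset.range (n + 1), B * ‖a‖ ^ n := by
          refine (norm_sum_le _ _).trans (Finset.sum_le_sum fun k hk => ?_)
          rw [norm_mul, norm_pow]
          gcongr
          · exact hB k
          · have := Finset.mem_range.1 hk; omega
      _ = _ := by simp; ring
  have h2 : 0 < ‖a‖ ^ n := by positivity
  have h3 : 1 / 2 * ‖a‖ * ‖a‖ ^ n ≤ (n + 1) * B * ‖a‖ ^ n := by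
    calc _ = 1 / 2 * ‖a‖ ^ (n + 1) := by rw [pow_succ]; ring
      _ ≤ ‖f.coeff (n + 1)‖ * ‖a‖ ^ (n + 1) := by gcongr
      _ ≤ _ := h1
  have h4 := le_of_mul_le_mul_right h3 h2
  linarith

end NearMonic

/-! ### Generic coefficients and the polynomial of the centers -/

section Generic

open Polynomial

variable {I J : ℕ} (M : Fin I → ℕ) (N : Fin J → ℕ)

/-- The polynomial `P_i` with indeterminate coefficients. -/
def genP (i : Fin I) : (MvPolynomial (CoeffIndex M N) ℤ)[X] :=
  ∑ μ : Fin (M i + 1), C (MvPolynomial.X (Sum.inl ⟨i, μ⟩)) * X ^ (μ : ℕ)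

/-- The polynomial `Q_j` with indeterminate coefficients. -/
def genQ (j : Fin J) : (MvPolynomial (CoeffIndex M N) ℤ)[X] :=
  ∑ ν : Fin (N j + 1), C (MvPolynomial.X (Sum.inr ⟨j, ν⟩)) * X ^ (ν : ℕ)

/-- The product of `z Q_0` and the polynomials `z Q_0 + Q_j` for `j ≠ 0`; its roots are the centers
of the local estimates. -/
def genCenters [NeZero J] : (MvPolynomial (CoeffIndex M N) ℤ)[X] :=
  ∏ j : Fin J, (X * genQ M N 0 + if j = 0 then 0 else genQ M N j)

/-- The leading coefficient of `genCenters`. -/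
def genLead [NeZero J] : MvPolynomial (CoeffIndex M N) ℤ :=
  MvPolynomial.X (Sum.inr ⟨0, Fin.last (N 0)⟩) ^ J

variable {M N}

/-- The evaluation of polynomials in the coefficients. -/
def evalAt (b : CoeffIndex M N → ℂ) : MvPolynomial (CoeffIndex M N) ℤ →+* ℂ :=
  (MvPolynomial.aeval b : MvPolynomial (CoeffIndex M N) ℤ →ₐ[ℤ] ℂ).toRingHom

lemma evalAt_apply (b : CoeffIndex M N → ℂ) (f : MvPolynomial (CoeffIndex M N) ℤ) :
    evalAt b f = MvPolynomial.aeval b f := rfl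

lemma map_genP (b : CoeffIndex M N → ℂ) (i : Fin I) : (genP M N i).map (evalAt b) = polyP b i := by
  simp [genP, polyP, Polynomial.map_sum, evalAt_apply]

lemma map_genQ (b : CoeffIndex M N → ℂ) (j : Fin J) : (genQ M N j).map (evalAt b) = polyQ b j := by
  simp [genQ, polyQ, Polynomial.map_sum, evalAt_apply]

lemma natDegree_sum_C_mul_X_pow_le {R : Type*} [CommRing R] (n : ℕ) (c : Fin (n + 1) → R) :
    (∑ k : Fin (n + 1), C (c k) * X ^ (k : ℕ)).natDegree ≤ n := by
  refine natDegree_sum_le_of_forall_le _ _ fun k _ => (natDegree_C_mul_X_pow_le _ _).trans ?_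
  have := k.2
  omega

lemma coeff_sum_C_mul_X_pow {R : Type*} [CommRing R] (n : ℕ) (c : Fin (n + 1) → R)
    (k : Fin (n + 1)) : (∑ k : Fin (n + 1), C (c k) * X ^ (k : ℕ)).coeff k = c k := by
  rw [finsetSum_coeff, Finset.sum_eq_single k]
  · simp
  · intro l _ hl
    rw [coeff_C_mul_X_pow, if_neg]
    intro h
    exact hl (Fin.ext h.symm)
  · simp

lemma natDegree_polyP_le (b : CoeffIndex M N → ℂ) (i : Fin I) : (polyP b i).natDegree ≤ M i :=
  natDegree_sum_C_mul_X_pow_le _ _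

lemma natDegree_polyQ_le (b : CoeffIndex M N → ℂ) (j : Fin J) : (polyQ b j).natDegree ≤ N j :=
  natDegree_sum_C_mul_X_pow_le _ _

lemma coeff_polyP (b : CoeffIndex M N → ℂ) (i : Fin I) (μ : Fin (M i + 1)) :
    (polyP b i).coeff μ = b (Sum.inl ⟨i, μ⟩) :=
  coeff_sum_C_mul_X_pow (M i) (fun μ => b (Sum.inl ⟨i, μ⟩)) μ

lemma coeff_polyQ (b : CoeffIndex M N → ℂ) (j : Fin J) (ν : Fin (N j + 1)) :
    (polyQ b j).coeff ν = b (Sum.inr ⟨j, ν⟩) :=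
  coeff_sum_C_mul_X_pow (N j) (fun ν => b (Sum.inr ⟨j, ν⟩)) ν

variable [NeZero J]

/-- The factors of the polynomial whose roots are the centers. -/
def centerFactor (Q : Fin J → ℂ[X]) (j : Fin J) : ℂ[X] :=
  X * Q 0 + if j = 0 then 0 else Q j

lemma map_genCenters (b : CoeffIndex M N → ℂ) :
    (genCenters M N).map (evalAt b) = ∏ j, centerFactor (polyQ b) j := by
  simp only [genCenters, centerFactor, Polynomial.map_prod, Polynomial.map_add, Polynomial.map_mul,
    Polynomial.map_X, map_genQ]
  refine Finset.prod_congr rfl fun j _ => ?_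
  split_ifs <;> simp [map_genQ]

lemma evalAt_genLead (b : CoeffIndex M N → ℂ) :
    evalAt b (genLead M N) = (polyQ b 0).coeff (N 0) ^ J := by
  have := coeff_polyQ b 0 (Fin.last (N 0))
  rw [Fin.val_last] at this
  rw [this, genLead, map_pow, evalAt_apply, MvPolynomial.aeval_X]

lemma natDegree_centerFactor_le {Q : Fin J → ℂ[X]} {n : ℕ} (hQ : ∀ j, (Q j).natDegree ≤ n)
    (j : Fin J) : (centerFactor Q j).natDegree ≤ n + 1 := by
  refine natDegree_add_le_of_degree_le ?_ ?_
  · refine natDegree_mul_le.trans ?_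
    have := hQ 0
    rw [natDegree_X]; omega
  · split_ifs
    · simp
    · exact (hQ j).trans (by omega)

/-- The factor X lifts Q_0 above the degree of Q_j, so adding Q_j leaves the top coefficient alone.
-/
lemma coeff_centerFactor {Q : Fin J → ℂ[X]} {n : ℕ} (hQ : ∀ j, (Q j).natDegree ≤ n)
    (j : Fin J) : (centerFactor Q j).coeff (n + 1) = (Q 0).coeff n := by
  rw [centerFactor, coeff_add, coeff_X_mul]
  split_ifs
  · simp
  · rw [coeff_eq_zero_of_natDegree_lt (p := Q j) (by have := hQ j; omega), add_zero]

lemma exists_eq_map_univ {s : Multiset ℂ} {n : ℕ} (h : Multiset.card s = n) :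
    ∃ α : Fin n → ℂ, s = Finset.univ.val.map α := by
  obtain ⟨l, rfl⟩ : ∃ l : List ℂ, (l : Multiset ℂ) = s := ⟨s.toList, s.coe_toList⟩
  rw [Multiset.coe_card] at h
  subst h
  exact ⟨l.get, by rw [Fin.univ_val_map, List.ofFn_get]⟩

/-- The roots of the product of the center factors, as a family. -/
lemma exists_isRootFamily (hN : Antitone N) {b : CoeffIndex M N → ℂ}
    (hb : evalAt b (genLead M N) ≠ 0) : ∃ α : Fin (J * (N 0 + 1)) → ℂ,
      IsRootFamily (genCenters M N) (genLead M N) (evalAt b) α := by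
  have hQ : ∀ j, (polyQ b j).natDegree ≤ N 0 := fun j =>
    (natDegree_polyQ_le b j).trans (hN (Fin.zero_le j))
  have ha : (polyQ b 0).coeff (N 0) ≠ 0 := by
    intro h
    rw [evalAt_genLead, h, zero_pow (NeZero.ne J)] at hb
    exact hb rfl
  have hdeg : ∀ j, (centerFactor (polyQ b) j).natDegree = N 0 + 1 := fun j =>
    natDegree_eq_of_le_of_coeff_ne_zero (natDegree_centerFactor_le hQ j)
      (by rw [coeff_centerFactor hQ]; exact ha)
  have hlc : ∀ j, (centerFactor (polyQ b) j).leadingCoeff = (polyQ b 0).coeff (N 0) := fun j => by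
    rw [leadingCoeff, hdeg, coeff_centerFactor hQ]
  set f := ∏ j, centerFactor (polyQ b) j with hf
  have hfd : f.natDegree = J * (N 0 + 1) := by
    rw [hf, natDegree_prod _ _ fun j _ h => ?_]
    · simp [hdeg]
    · have := hlc j
      rw [h, leadingCoeff_zero] at this
      exact ha this.symm
  have hfl : f.leadingCoeff = evalAt b (genLead M N) := by
    rw [hf, leadingCoeff_prod, evalAt_genLead]
    simp [hlc]
  have hsp := IsAlgClosed.splits f
  obtain ⟨α, hα⟩ := exists_eq_map_univ (s := f.roots) (n := J * (N 0 + 1)) (by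
    rw [← hsp.natDegree_eq_card_roots, hfd])
  refine ⟨α, ?_⟩
  rw [IsRootFamily, map_genCenters, ← hf, ← hfl]
  conv_lhs => rw [hsp.eq_prod_roots, hα, Multiset.map_map]
  rfl

lemma IsRootFamily.exists_eq {b : CoeffIndex M N → ℂ} {D : ℕ} {α : Fin D → ℂ}
    (h : IsRootFamily (genCenters M N) (genLead M N) (evalAt b) α)
    (hb : evalAt b (genLead M N) ≠ 0) {j : Fin J} {a : ℂ}
    (ha : (centerFactor (polyQ b) j).eval a = 0) : ∃ d, α d = a := by
  rw [IsRootFamily, map_genCenters] at h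
  have h1 := congrArg (eval a) h
  rw [eval_prod, Finset.prod_eq_zero (Finset.mem_univ j) ha, eval_mul, eval_C, eval_prod] at h1
  obtain ⟨d, -, hd⟩ := Finset.prod_eq_zero_iff.1 ((mul_eq_zero.1 h1.symm).resolve_left hb)
  refine ⟨d, ?_⟩
  rw [eval_sub, eval_X, eval_C, sub_eq_zero] at hd
  exact hd.symm

lemma IsRootFamily.exists_eval_eq_zero {b : CoeffIndex M N → ℂ} {D : ℕ} {α : Fin D → ℂ}
    (h : IsRootFamily (genCenters M N) (genLead M N) (evalAt b) α) (d : Fin D) :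
    ∃ j, (centerFactor (polyQ b) j).eval (α d) = 0 := by
  rw [IsRootFamily, map_genCenters] at h
  have h1 := congrArg (eval (α d)) h
  rw [eval_prod, eval_mul, eval_prod, Finset.prod_eq_zero (Finset.mem_univ d) (by simp),
    mul_zero] at h1
  obtain ⟨j, -, hj⟩ := Finset.prod_eq_zero_iff.1 h1
  exact ⟨j, hj⟩

end Generic

/-! ### Clearing the denominators of the exponents -/

section Weights

open Polynomial

/-- Finitely many nonnegative rational numbers have a common denominator. -/
lemma exists_common_denominator (s : Finset ℚ) :
    ∃ m : ℕ, 0 < m ∧ ∀ ρ ∈ s, 0 ≤ ρ → (⌊ρ * m⌋₊ : ℚ) = ρ * m := by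
  refine ⟨∏ ρ ∈ s, ρ.den, Finset.prod_pos fun ρ _ => ρ.den_pos, fun ρ hρ h0 => ?_⟩
  obtain ⟨k, hk⟩ := Finset.dvd_prod_of_mem (fun ρ : ℚ => ρ.den) hρ
  have h1 : ρ * (∏ ρ ∈ s, ρ.den : ℕ) = (ρ.num.toNat * k : ℕ) := by
    rw [hk]
    push_cast
    have h2 : ((ρ.num.toNat : ℤ) : ℚ) = ρ.num := by
      rw [Int.toNat_of_nonneg (Rat.num_nonneg.2 h0)]
    rw [← mul_assoc, Rat.mul_den_eq_num, ← h2]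
    push_cast
    rfl
  rw [h1, Nat.floor_natCast]

lemma norm_pow_floor_rpow {ρ : ℚ} {m : ℕ} (hm : 0 < m) (hρ : (⌊ρ * m⌋₊ : ℚ) = ρ * m) (z : ℂ) :
    ‖z ^ ⌊ρ * m⌋₊‖ ^ (((1 / m : ℚ) : ℝ)) = ‖z‖ ^ (ρ : ℝ) := by
  rw [norm_pow, ← Real.rpow_natCast, ← Real.rpow_mul (norm_nonneg _)]
  congr 1
  have h : ((⌊ρ * m⌋₊ : ℚ) : ℝ) = ((ρ * m : ℚ) : ℝ) := by rw [hρ]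
  push_cast at h ⊢
  rw [h]
  have : (m : ℝ) ≠ 0 := by positivity
  field_simp

lemma map_hasseDeriv {R S : Type*} [CommRing R] [CommRing S] (ψ : R →+* S) (k : ℕ) (f : R[X]) :
    (hasseDeriv k f).map ψ = hasseDeriv k (f.map ψ) := by
  ext n
  simp [hasseDeriv_coeff]

variable {I J : ℕ} (M : Fin I → ℕ) (N : Fin J → ℕ) [NeZero J]

/-- The first exponent of a balance term. -/
def balanceExp₁ (δ κ : ℚ) (l l' : ℕ) : ℚ := (l' * δ - κ) / (l' - l)

/-- The second exponent of a balance term. -/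
def balanceExp₂ (δ κ : ℚ) (l l' : ℕ) : ℚ := (κ - l * δ) / (l' - l)

/-- The polynomials in the root `α` whose absolute values are the powers with exponent `m` of the
local numerators. -/
def numFamily (ε : ℚ) (m : ℕ) (x : Σ i : Fin I, Fin (M i + 1)) :
    (MvPolynomial (CoeffIndex M N) ℤ)[X] :=
  hasseDeriv x.2 (genP M N x.1) ^ ⌊ε * m⌋₊

/-- The polynomials in the root `α` whose absolute values are the powers with exponent `m` of the
balance terms. -/
def denFamily (ε δ : ℚ) (m : ℕ) (x : Σ i : Fin I, Fin (M i + 1)) :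
    Option ((Fin J × Fin (N 0 + 1)) × (Fin J × Fin (N 0 + 1))) →
      (MvPolynomial (CoeffIndex M N) ℤ)[X]
  | none => if (N 0 : ℚ) * δ < (x.2 : ℕ) * ε + 2 then 1 else 0
  | some (y, y') =>
    if ((y.2 : ℕ) : ℚ) * δ < (x.2 : ℕ) * ε + 2 ∧ (x.2 : ℕ) * ε + 2 < ((y'.2 : ℕ) : ℚ) * δ then
      hasseDeriv y.2 (genQ M N y.1) ^ ⌊balanceExp₁ δ ((x.2 : ℕ) * ε + 2) y.2 y'.2 * m⌋₊ *
      hasseDeriv y'.2 (genQ M N y'.1) ^ ⌊balanceExp₂ δ ((x.2 : ℕ) * ε + 2) y.2 y'.2 * m⌋₊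
    else 0

/-- There is a common denominator `m` of all the exponents. -/
lemma exists_family_eq (ε δ : ℚ) (hε : 0 ≤ ε) (hδ : 0 ≤ δ) : ∃ m : ℕ, 0 < m ∧
    ∀ (D : ℕ) (b : CoeffIndex M N → ℂ) (α : Fin D → ℂ)
      (k : Fin D × (Σ i : Fin I, Fin (M i + 1))),
      (rootNum (numFamily M N ε m) (1 / m) (evalAt b) α k : ℝ) =
        localNum ε (polyP b) (α k.1) k.2 ∧
      (rootDen (denFamily M N ε δ m) (1 / m) (evalAt b) α k : ℝ) =
        localDen (N 0) ε δ (polyQ b) (α k.1) k.2 := by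
  classical
  let W := (Σ i : Fin I, Fin (M i + 1)) × (Fin J × Fin (N 0 + 1)) × (Fin J × Fin (N 0 + 1))
  -- With m a common denominator the floors in the exponents are exact for nonnegative exponents.
  -- Negative ones occur only for pairs whose balance term is 0 by definition.
  obtain ⟨m, hm, hρ⟩ := exists_common_denominator ({ε} ∪
    (Finset.univ.image fun w : W => balanceExp₁ δ ((w.1.2 : ℕ) * ε + 2) w.2.1.2 w.2.2.2) ∪
    (Finset.univ.image fun w : W => balanceExp₂ δ ((w.1.2 : ℕ) * ε + 2) w.2.1.2 w.2.2.2))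
  refine ⟨m, hm, fun D b α k => ⟨?_, ?_⟩⟩
  · rw [rootNum, NNReal.coe_rpow, coe_nnnorm, numFamily, Polynomial.map_pow, map_hasseDeriv,
      map_genP, eval_pow, norm_pow_floor_rpow hm (hρ ε (by simp) hε), localNum, taylor_coeff]
  · rw [rootDen, localDen, NNReal.coe_sum]
    refine Finset.sum_congr rfl fun θ _ => ?_
    have hm' : (((1 / m : ℚ) : ℝ)) ≠ 0 := by
      have : (0 : ℚ) < 1 / m := by positivity
      exact_mod_cast this.ne'
    rw [NNReal.coe_rpow, coe_nnnorm]
    rcases θ with _ | ⟨y, y'⟩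
    · have hiff : ((N 0 : ℝ) * δ < (k.2.2 : ℕ) * ε + 2) ↔
          ((N 0 : ℚ) * δ < (k.2.2 : ℕ) * ε + 2) := by exact_mod_cast Iff.rfl
      simp only [balanceTerm, denFamily, hiff]
      split_ifs
      · simp
      · rw [Polynomial.map_zero, eval_zero, norm_zero, Real.zero_rpow hm']
    · have hiff : (((y.2 : ℕ) : ℝ) * δ < (k.2.2 : ℕ) * ε + 2 ∧
          ((k.2.2 : ℕ) : ℝ) * ε + 2 < ((y'.2 : ℕ) : ℝ) * δ) ↔
          (((y.2 : ℕ) : ℚ) * δ < (k.2.2 : ℕ) * ε + 2 ∧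
          ((k.2.2 : ℕ) : ℚ) * ε + 2 < ((y'.2 : ℕ) : ℚ) * δ) := by exact_mod_cast Iff.rfl
      simp only [balanceTerm, denFamily, hiff]
      split_ifs with h
      · have hlt : (y.2 : ℕ) < (y'.2 : ℕ) := by
          exact_mod_cast lt_of_mul_lt_mul_right (h.1.trans h.2) hδ
        have hd : (0 : ℚ) < ((y'.2 : ℕ) : ℚ) - (y.2 : ℕ) := by
          have : ((y.2 : ℕ) : ℚ) < (y'.2 : ℕ) := by exact_mod_cast hlt
          linarith
        have e1 := hρ (balanceExp₁ δ ((k.2.2 : ℕ) * ε + 2) y.2 y'.2)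
          (Finset.mem_union_left _ (Finset.mem_union_right _
            (Finset.mem_image.2 ⟨(k.2, y, y'), Finset.mem_univ _, rfl⟩)))
          (div_nonneg (by linarith [h.2]) hd.le)
        have e2 := hρ (balanceExp₂ δ ((k.2.2 : ℕ) * ε + 2) y.2 y'.2)
          (Finset.mem_union_right _
            (Finset.mem_image.2 ⟨(k.2, y, y'), Finset.mem_univ _, rfl⟩))
          (div_nonneg (by linarith [h.1]) hd.le)
        rw [Polynomial.map_mul, Polynomial.map_pow, Polynomial.map_pow, map_hasseDeriv,
          map_hasseDeriv, map_genQ, map_genQ, eval_mul, eval_pow, eval_pow, norm_mul,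
          Real.mul_rpow (norm_nonneg _) (norm_nonneg _), norm_pow_floor_rpow hm e1,
          norm_pow_floor_rpow hm e2, localCoeff, localCoeff, taylor_coeff, taylor_coeff]
        simp only [balanceExp₁, balanceExp₂]
        push_cast
        rfl
      · rw [Polynomial.map_zero, eval_zero, norm_zero, Real.zero_rpow hm']

end Weights

/-! ### Comparison of the integral with the sum over the centers -/

section IntegralEquiv

open Polynomial

variable {I J : ℕ} (M : Fin I → ℕ) (N : Fin J → ℕ) [NeZero J]

/-- Nondegeneracy is applied to the multiple ([δ] + 1) l, where the factor [δ] + 1 cancels. -/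
lemma Nondegenerate.ne {M : Fin I → ℕ} {N : Fin J → ℕ} {ε δ : ℚ} (h : Nondegenerate M N ε δ)
    (x : Σ i : Fin I, Fin (M i + 1)) : ∀ l ≤ N 0, (l : ℝ) * δ ≠ (x.2 : ℕ) * ε + 2 := by
  intro l hl heq
  have h1 := h x.1 0 x.2 (Nat.lt_succ_iff.1 x.2.2) ((⌊δ⌋₊ + 1) * l) (by gcongr)
  apply h1
  have h2 : ((l * δ : ℚ) : ℝ) = (((x.2 : ℕ) * ε + 2 : ℚ) : ℝ) := by push_cast; exact heq
  have h3 : (l : ℚ) * δ = (x.2 : ℕ) * ε + 2 := by exact_mod_cast h2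
  have h4 : ((⌊δ⌋₊ : ℚ) + 1) ≠ 0 := by positivity
  push_cast
  rw [mul_div_assoc, mul_comm (((⌊δ⌋₊ : ℚ) + 1)), div_mul_cancel₀ _ h4, ← h3]
  ring

/-- The integral is comparable to the sum of the local quotients over all centers. -/
theorem exists_integral_equiv [Nonempty (Fin I)] (hN : Antitone N) (ε δ : ℚ) (hε : 0 ≤ ε)
    (hδ : 0 ≤ δ) (hnd : Nondegenerate M N ε δ) (D : ℕ) (C : ℝ) (hC : 0 < C) : ∃ A : ℝ, 0 < A ∧
      ∀ (b : CoeffIndex M N → ℂ) (α : Fin D → ℂ),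
      IsRootFamily (genCenters M N) (genLead M N) (evalAt b) α →
      evalAt b (genLead M N) ≠ 0 →
      polyNorm (polyQ b 0 - X ^ N 0) < (1 / 2) ^ (N 0 + 1) →
      (∀ j, j ≠ 0 → polyNorm (polyQ b j) < C) →
      ∫⁻ z in Metric.ball (0 : ℂ) 1, ratPower ε δ b z ≤ ENNReal.ofReal A *
        ∑ k : Fin D × (Σ i : Fin I, Fin (M i + 1)),
          ENNReal.ofReal (localNum ε (polyP b) (α k.1) k.2) /
            ENNReal.ofReal (localDen (N 0) ε δ (polyQ b) (α k.1) k.2) ∧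
      ∑ k : Fin D × (Σ i : Fin I, Fin (M i + 1)),
          ENNReal.ofReal (localNum ε (polyP b) (α k.1) k.2) /
            ENNReal.ofReal (localDen (N 0) ε δ (polyQ b) (α k.1) k.2) ≤
        ENNReal.ofReal A * ∫⁻ z in Metric.ball (0 : ℂ) 1, ratPower ε δ b z := by
  -- Bounds all coefficients: those of Q_0 are within 1/2 of 0 or 1, the others are below C.
  set B : ℝ := C + 2 with hB
  -- Cauchy's bound for the centers; a coefficient of z Q_0 + Q_j is a sum of two coefficients,
  -- hence 2B.
  set R : ℝ := 1 + 2 * ((N 0 : ℝ) + 1) * (2 * B) with hR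
  have hB0 : 0 < B := by positivity
  have hR0 : 0 ≤ R := by positivity
  obtain ⟨A₁, hA₁, hup⟩ := lintegral_polyRatio_le (I := I) (J := J) (M := M) (N 0) D ε δ hε hδ R hR0
  choose A₂ hA₂ hlow using fun x : Σ i : Fin I, Fin (M i + 1) =>
    le_lintegral_polyRatio (J := J) (N 0) ε δ hε hδ R B ((1 / 2) ^ (N 0 + 1)) hR0 hB0
      (by positivity) x (hnd.ne x)
  have hS0 : 0 ≤ ∑ k : Fin D × (Σ i : Fin I, Fin (M i + 1)), A₂ k.2 :=
    Finset.sum_nonneg fun k _ => (hA₂ _).le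
  refine ⟨A₁ + ∑ k : Fin D × (Σ i : Fin I, Fin (M i + 1)), A₂ k.2, by positivity,
    fun b α hα hlead hnear hbd => ?_⟩
  have hP := natDegree_polyP_le b
  have hQ : ∀ j, (polyQ b j).natDegree ≤ N 0 := fun j =>
    (natDegree_polyQ_le b j).trans (hN (Fin.zero_le j))
  have hs : ((1 : ℝ) / 2) ^ (N 0 + 1) ≤ 1 / 2 := by
    rw [pow_succ]
    have : ((1 : ℝ) / 2) ^ N 0 ≤ 1 := pow_le_one₀ (by norm_num) (by norm_num)
    linarith
  have hlc : 1 / 2 ≤ ‖(polyQ b 0).coeff (N 0)‖ := by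
    have h1 := norm_coeff_le_polyNorm (polyQ b 0 - X ^ N 0) (N 0)
    rw [coeff_sub, coeff_X_pow_self, norm_sub_rev] at h1
    have h2 := norm_sub_norm_le (1 : ℂ) ((polyQ b 0).coeff (N 0))
    rw [norm_one] at h2
    linarith
  have hcoef : ∀ j k, ‖(polyQ b j).coeff k‖ ≤ B := by
    intro j k
    by_cases hj : j = 0
    · subst hj
      have h1 := norm_coeff_le_polyNorm (polyQ b 0 - X ^ N 0) k
      rw [coeff_sub] at h1
      have h2 : ‖((X : ℂ[X]) ^ N 0).coeff k‖ ≤ 1 := by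
        rw [coeff_X_pow]; split_ifs <;> simp
      have h3 := norm_sub_norm_le ((polyQ b 0).coeff k) (((X : ℂ[X]) ^ N 0).coeff k)
      linarith
    · have h1 := norm_coeff_le_polyNorm (polyQ b j) k
      have h2 := hbd j hj
      linarith
  have hbig : ∀ z : ℂ, 1 / 2 ≤ ‖z‖ → (1 / 2) ^ (N 0 + 1) ≤ ‖(polyQ b 0).eval z‖ := fun z hz =>
    le_norm_eval_of_near_monic (hQ 0) hnear hz
  have hαR : ∀ d, ‖α d‖ ≤ R := by
    intro d
    obtain ⟨j, hj⟩ := hα.exists_eval_eq_zero d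
    refine norm_le_of_isRoot (natDegree_centerFactor_le hQ j)
      (by rw [coeff_centerFactor hQ]; exact hlc) (fun k => ?_) hj
    rw [centerFactor, coeff_add]
    refine (norm_add_le _ _).trans ?_
    have h1 : ‖(X * polyQ b 0).coeff k‖ ≤ B := by
      cases k with
      | zero => simp [hB0.le]
      | succ k => rw [coeff_X_mul]; exact hcoef 0 k
    have h2 : ‖(if j = 0 then 0 else polyQ b j : ℂ[X]).coeff k‖ ≤ B := by
      split_ifs
      · simp [hB0.le]
      · exact hcoef j k
    linarith
  constructor
  · have h1 := hup (polyP b) (polyQ b) α hP hQ hlc hαR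
      (hα.exists_eq hlead (j := 0) (by simp [centerFactor]))
      (fun a ha => hα.exists_eq hlead (j := 0) (by
        have := (mem_roots'.1 ha).2
        rw [IsRoot.def] at this
        simp [centerFactor, this]))
      (fun j hj a ha => hα.exists_eq hlead (j := j) (by
        have := (mem_roots'.1 ha).2
        rw [IsRoot.def] at this
        rw [centerFactor, if_neg hj, this]))
    rw [← Fintype.sum_prod_type'] at h1
    refine h1.trans ?_
    gcongr
    exact le_add_of_nonneg_right hS0
  · calc _ ≤ ∑ k : Fin D × (Σ i : Fin I, Fin (M i + 1)), ENNReal.ofReal (A₂ k.2) *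
          ∫⁻ z in Metric.ball (0 : ℂ) 1, ratPower ε δ b z :=
          Finset.sum_le_sum fun k _ =>
            hlow k.2 (polyP b) (polyQ b) (α k.1) hP hQ hlc hcoef hbig (hαR _)
      _ ≤ _ := by
        rw [← Finset.sum_mul, ← ENNReal.ofReal_sum_of_nonneg fun k _ => (hA₂ _).le]
        gcongr
        linarith

end IntegralEquiv

/-! ### The chain of varieties and its rational powers -/

section Assembly

lemma absPower_eq_zero_iff {n : ℕ} (v : Fin n → ℂ) {e : ℚ} (he : 0 < e) :
    absPower v e = 0 ↔ ∀ i, v i = 0 := by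
  have he' : (0 : ℝ) < e := by exact_mod_cast he
  rw [absPower, Real.rpow_eq_zero (Finset.sum_nonneg fun _ _ => by positivity) (by positivity),
    Finset.sum_eq_zero_iff_of_nonneg fun _ _ => by positivity]
  simp

namespace IsDescentOf

variable {R : Type*} [CommRing R] {D n : ℕ} {H : Polynomial R} {lc : R} {g : Fin n → R} {e' : ℚ}
  {F : (R →+* ℂ) → (Fin D → ℂ) → ℝ≥0}

lemma eq_zero (h : IsDescentOf H lc g e' F) {ψ : R →+* ℂ} (hlc : ψ lc = 0) :
    absPower (fun i => ψ (g i)) e' = 0 :=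
  (absPower_eq_zero_iff _ h.1).2 (h.2.1 ψ hlc)

/-- The comparison is used with c adapted to the given ψ. Its constant then depends on ψ, but
whether a value is zero does not. -/
lemma eq_zero_iff (h : IsDescentOf H lc g e' F) {ψ : R →+* ℂ} {α : Fin D → ℂ}
    (hr : IsRootFamily H lc ψ α) (hlc : ψ lc ≠ 0) :
    absPower (fun i => ψ (g i)) e' = 0 ↔ F ψ α = 0 := by
  have h0 : 0 < ‖ψ lc‖ := norm_pos_iff.2 hlc
  obtain ⟨A, hA, hA'⟩ := h.2.2 (min ‖ψ lc‖ ‖ψ lc‖⁻¹) (by positivity)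
  obtain ⟨h1, h2⟩ := hA' ψ α hr (min_le_left _ _) (by
    rw [le_inv_comm₀ h0 (by positivity)]
    exact min_le_right _ _)
  constructor
  · intro h3
    rw [h3, mul_zero] at h2
    exact le_antisymm (by exact_mod_cast h2) zero_le
  · intro h3
    rw [h3, NNReal.coe_zero, mul_zero] at h1
    exact le_antisymm h1 (absPower_nonneg _ _)

end IsDescentOf

lemma inv_ofReal_le {A L : ℝ} {y : ℝ≥0∞} (hA : 0 < A) (h : y ≤ ENNReal.ofReal A * ENNReal.ofReal L) :
    (ENNReal.ofReal L)⁻¹ ≤ ENNReal.ofReal A * y⁻¹ := by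
  have hA0 : ENNReal.ofReal A ≠ 0 := by simpa using hA
  calc (ENNReal.ofReal L)⁻¹ = ENNReal.ofReal A * (ENNReal.ofReal A * ENNReal.ofReal L)⁻¹ := by
        rw [ENNReal.mul_inv (Or.inl hA0) (Or.inl ENNReal.ofReal_ne_top), ← mul_assoc,
          ENNReal.mul_inv_cancel hA0 ENNReal.ofReal_ne_top, one_mul]
    _ ≤ _ := by gcongr

lemma div_le_of_equiv {A A' K x L y : ℝ} (hA : 0 < A) (hA' : 0 < A') (h1 : K ≤ A * x)
    (h2 : y ≤ A' * L) : ENNReal.ofReal K / ENNReal.ofReal L ≤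
      ENNReal.ofReal (A * A') * (ENNReal.ofReal x / ENNReal.ofReal y) := by
  have h3 : (ENNReal.ofReal L)⁻¹ ≤ ENNReal.ofReal A' * (ENNReal.ofReal y)⁻¹ :=
    inv_ofReal_le hA' (by rw [← ENNReal.ofReal_mul hA'.le]; exact ENNReal.ofReal_le_ofReal h2)
  calc _ ≤ (ENNReal.ofReal A * ENNReal.ofReal x) *
        (ENNReal.ofReal A' * (ENNReal.ofReal y)⁻¹) := by
        rw [div_eq_mul_inv]
        gcongr
        rw [← ENNReal.ofReal_mul hA.le]
        exact ENNReal.ofReal_le_ofReal h1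
    _ = _ := by
      rw [ENNReal.ofReal_mul hA.le, div_eq_mul_inv]
      ring

/-- The absolute rational power with numerator and denominator `1`. -/
def ARP.one (A σ : Type*) [CommRing A] [Nontrivial A] : ARP A σ where
  numCard := 1
  denCard := 1
  num := fun _ => 1
  den := fun _ => 1
  numExp := 1
  denExp := 1
  numExp_nonneg := zero_le_one
  denExp_nonneg := zero_le_one
  exists_num_ne_zero := ⟨0, one_ne_zero⟩

lemma ARP.one_K {A σ : Type*} [CommRing A] [Nontrivial A] [Algebra A ℂ] (b : σ → ℂ) :
    (ARP.one A σ).K b = 1 := by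
  change absPower (fun _ : Fin 1 => MvPolynomial.aeval b (1 : MvPolynomial σ A)) 1 = 1
  simp [absPower]

lemma ARP.value_ne_zero {A σ : Type*} [CommRing A] [Algebra A ℂ] {T : ARP A σ} {b : σ → ℂ}
    (h : T.K b ≠ 0) : T.value b ≠ 0 := by
  have h1 : 0 < T.K b := lt_of_le_of_ne (absPower_nonneg _ _) h.symm
  rw [ARP.value]
  exact ENNReal.div_ne_zero.2 ⟨by simpa using h1, ENNReal.ofReal_ne_top⟩

variable {I J : ℕ} {M : Fin I → ℕ} {N : Fin J → ℕ}

/-- Some P_i is a nonzero polynomial, and its leading coefficient is a Taylor coefficient at every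
center. -/
lemma exists_rootNum_ne_zero {ε : ℚ} {m : ℕ} {b : CoeffIndex M N → ℂ} (hb : b ∈ coeffSpace M N)
    {D : ℕ} (d : Fin D) (α : Fin D → ℂ)
    (hfam : ∀ k : Fin D × (Σ i : Fin I, Fin (M i + 1)),
      (rootNum (numFamily M N ε m) (1 / m) (evalAt b) α k : ℝ) =
        localNum ε (polyP b) (α k.1) k.2) :
    ∃ k, rootNum (numFamily M N ε m) (1 / m) (evalAt b) α k ≠ 0 := by
  obtain ⟨⟨i, μ⟩, hx⟩ := hb
  have hP : polyP b i ≠ 0 := by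
    intro h
    have := coeff_polyP b i μ
    rw [h, Polynomial.coeff_zero] at this
    exact hx this.symm
  have ht : Polynomial.taylor (α d) (polyP b i) ≠ 0 := by
    rwa [Ne, Polynomial.taylor_eq_zero]
  have hdeg : (Polynomial.taylor (α d) (polyP b i)).natDegree < M i + 1 := by
    rw [Polynomial.natDegree_taylor]
    have := natDegree_polyP_le b i
    omega
  refine ⟨(d, ⟨i, ⟨_, hdeg⟩⟩), fun h => ?_⟩
  have h1 := hfam (d, ⟨i, ⟨_, hdeg⟩⟩)
  rw [h, NNReal.coe_zero, localNum] at h1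
  have h2 : 0 < ‖(Polynomial.taylor (α d) (polyP b i)).coeff
      (Polynomial.taylor (α d) (polyP b i)).natDegree‖ := by
    rw [norm_pos_iff]
    exact Polynomial.leadingCoeff_ne_zero.2 ht
  exact (Real.rpow_pos_of_pos h2 _).ne h1

variable [NeZero J]

/-- The relation between two consecutive sets of the chain and the absolute rational power on their
difference. -/
def IsStratum (M : Fin I → ℕ) (N : Fin J → ℕ) (ε δ : ℚ) (s : ℝ)
    (U U' : Set (CoeffIndex M N → ℂ)) (T : ARP ℤ (CoeffIndex M N)) : Prop :=
  (∀ b ∈ U \ U', T.K b ≠ 0) ∧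
  (∀ C : ℝ, 0 < C → ∃ A : ℝ≥0, ∀ b ∈ U \ U',
    polyNorm (polyQ b 0 - Polynomial.X ^ N 0) < s →
    (∀ j, j ≠ 0 → polyNorm (polyQ b j) < C) →
      ∫⁻ z in Metric.ball (0 : ℂ) 1, ratPower ε δ b z ≤ A * T.value b ∧
      T.value b ≤ A * ∫⁻ z in Metric.ball (0 : ℂ) 1, ratPower ε δ b z) ∧
  U' = {b ∈ U | T.K b = 0} ∧ ∀ b ∈ U, T.K b = 0 → T.L b = 0

/-- The leading coefficient of Q_0 is within 1/2 of 1, so its absolute value lies between 1/2 and 2;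
take J-th powers. -/
lemma norm_evalAt_genLead {b : CoeffIndex M N → ℂ}
    (h : polyNorm (polyQ b 0 - Polynomial.X ^ N 0) < (1 / 2) ^ (N 0 + 1)) :
    (1 / 2) ^ J ≤ ‖evalAt b (genLead M N)‖ ∧ ‖evalAt b (genLead M N)‖ ≤ ((1 / 2) ^ J)⁻¹ := by
  have hs : ((1 : ℝ) / 2) ^ (N 0 + 1) ≤ 1 / 2 := by
    rw [pow_succ]
    have : ((1 : ℝ) / 2) ^ N 0 ≤ 1 := pow_le_one₀ (by norm_num) (by norm_num)
    linarith
  have h1 := norm_coeff_le_polyNorm (polyQ b 0 - Polynomial.X ^ N 0) (N 0)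
  rw [Polynomial.coeff_sub, Polynomial.coeff_X_pow_self] at h1
  have h2 := norm_sub_norm_le ((polyQ b 0).coeff (N 0)) 1
  have h3 := norm_sub_norm_le 1 ((polyQ b 0).coeff (N 0))
  rw [norm_sub_rev] at h3
  rw [norm_one] at h2 h3
  rw [evalAt_genLead, norm_pow]
  constructor
  · gcongr
    linarith
  · rw [← inv_pow]
    gcongr
    norm_num
    linarith

/-- On the set where K_n = 0 for all n above l but K_l ≠ 0, and the leading coefficient is nonzero,
l is the largest level with nonvanishing numerator; there K_l/L_l measures the integral. Repeated
sets are pruned at the end. -/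
theorem exists_chain [Nonempty (Fin I)] (hN : Antitone N)
    (ε δ : ℚ) (hε : 0 ≤ ε) (hδ : 0 ≤ δ) (hnd : Nondegenerate M N ε δ) :
    ∃ (n : ℕ) (U : Fin (n + 1) → Set (CoeffIndex M N → ℂ)) (T : Fin n → ARP ℤ (CoeffIndex M N)),
      (∀ l, IsAlgebraicIn (coeffSpace M N) (U l)) ∧ StrictAnti U ∧ U 0 = coeffSpace M N ∧
      U (Fin.last n) = ∅ ∧ ∀ l : Fin n,
        IsStratum M N ε δ ((1 / 2) ^ (N 0 + 1)) (U l.castSucc) (U l.succ) (T l) := by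
  classical
  obtain ⟨m, hm, hfam⟩ := exists_family_eq M N ε δ hε hδ
  have he : (0 : ℚ) < 1 / m := by positivity
  let D := J * (N 0 + 1)
  have hD : 0 < D := Nat.mul_pos (Nat.pos_of_ne_zero (NeZero.ne J)) (Nat.succ_pos _)
  let κ := Fin D × (Σ i : Fin I, Fin (M i + 1))
  let Xf := fun (ψ : MvPolynomial (CoeffIndex M N) ℤ →+* ℂ) (α : Fin D → ℂ) =>
    rootNum (numFamily M N ε m) (1 / m) ψ α
  let Yf := fun (ψ : MvPolynomial (CoeffIndex M N) ℤ →+* ℂ) (α : Fin D → ℂ) =>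
    rootDen (denFamily M N ε δ m) (1 / m) ψ α
  choose p g eg hg using fun n => exists_stratNum_descent (D := D) (genCenters M N)
    (genLead M N) (numFamily M N ε m) (denFamily M N ε δ m) (1 / m) he n
  choose p' g' eg' hg' using fun n => exists_stratDen_descent (D := D) (genCenters M N)
    (genLead M N) (denFamily M N ε δ m) (1 / m) he n
  let Kn := fun n (b : CoeffIndex M N → ℂ) => absPower (fun i => evalAt b (g n i)) (eg n)
  let Ln := fun n (b : CoeffIndex M N → ℂ) => absPower (fun i => evalAt b (g' n i)) (eg' n)
  let c := Fintype.card κ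
  -- The t-th set imposes the t equations of highest level. Levels from c on need no equation, as
  -- there are no n + 1 distinct indices for n ≥ c. The final value, at c + 1, is empty.
  let W : ℕ → Set (CoeffIndex M N → ℂ) := fun t =>
    if t ≤ c then {b ∈ coeffSpace M N | ∀ n, c - t ≤ n → n < c → Kn n b = 0} else ∅
  have hWle : ∀ t, t ≤ c →
      W t = {b ∈ coeffSpace M N | ∀ n, c - t ≤ n → n < c → Kn n b = 0} :=
    fun t ht => if_pos ht
  have hWend : W (c + 1) = ∅ := if_neg (by omega)
  have hWsucc : ∀ t < c, W (t + 1) = {b ∈ W t | Kn (c - (t + 1)) b = 0} := by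
    intro t ht
    rw [hWle _ ht, hWle _ ht.le]
    ext b
    constructor
    · rintro ⟨h1, h2⟩
      exact ⟨⟨h1, fun n hn => h2 n (by omega)⟩, h2 _ le_rfl (by omega)⟩
    · rintro ⟨⟨h1, h2⟩, h3⟩
      refine ⟨h1, fun n hn hn' => ?_⟩
      rcases hn.eq_or_lt with h | h
      · rw [← h]; exact h3
      · exact h2 n (by omega) hn'
  have hX : ∀ b ∈ coeffSpace M N, ∀ α : Fin D → ℂ, ∃ k, Xf (evalAt b) α k ≠ 0 := fun b hb α =>
    exists_rootNum_ne_zero hb ⟨0, hD⟩ α fun k => (hfam D b α k).1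
  -- With all equations imposed, the numerator of level 0, which is ∑ X_k, would vanish at any
  -- family of centers. But some X_k is nonzero.
  have hlead : ∀ b ∈ W c, evalAt b (genLead M N) = 0 := by
    intro b hb
    by_contra hne
    rw [hWle c le_rfl] at hb
    obtain ⟨α, hα⟩ := exists_isRootFamily hN hne
    obtain ⟨k, hk⟩ := hX b hb.1 α
    have hc : 0 < c := Fintype.card_pos_iff.2 ⟨k⟩
    have h1 := ((hg 0).eq_zero_iff hα hne).1 (hb.2 0 (by omega) hc)
    obtain ⟨e, he0, -⟩ := exists_embedding_cons (n := 0) k ∅ (by simp) (by simp)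
    exact stratNum_ne_zero_iff.2 ⟨e, by rw [he0]; exact hk, fun i => i.elim0⟩ h1
  have hnum : ∀ t, t ≤ c → ∀ b ∈ W t, ∀ α, IsRootFamily (genCenters M N) (genLead M N) (evalAt b) α →
      evalAt b (genLead M N) ≠ 0 → ∀ n, c - t ≤ n → n < c →
      stratNum (Xf (evalAt b) α) (Yf (evalAt b) α) n = 0 := by
    intro t ht b hb α hα hne n hn hn'
    rw [hWle t ht] at hb
    exact ((hg n).eq_zero_iff hα hne).1 (hb.2 n hn hn')
  obtain ⟨n, U, T, h1, h2, h3, h4, h5⟩ := exists_strictAnti_chain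
    (IsStratum M N ε δ ((1 / 2) ^ (N 0 + 1))) (c + 1) W
    (fun t ht => by
      rcases Nat.lt_succ_iff_lt_or_eq.1 ht with h | rfl
      · rw [hWsucc t h]; exact fun b hb => hb.1
      · rw [hWend]; exact Set.empty_subset _) hWend
    (fun t ht hne => by
      rcases Nat.lt_succ_iff_lt_or_eq.1 ht with ht | rfl
      · set l := c - (t + 1) with hl
        -- Were all these polynomials zero, the equation would be void and the set would not shrink.
        have hgne : ∃ i, g l i ≠ 0 := by
          by_contra! hcon
          apply hne
          rw [hWsucc t ht]
          refine Set.Subset.antisymm (fun b hb => hb.1) fun b hb => ⟨hb, ?_⟩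
          exact (absPower_eq_zero_iff _ (hg l).1).2 fun i =>
            (congrArg (evalAt b) (hcon i)).trans (map_zero _)
        let τ : ARP ℤ (CoeffIndex M N) := ⟨p l, p' l, g l, g' l, eg l, eg' l, (hg l).1.le,
          (hg' l).1.le, hgne⟩
        have hK : ∀ b, τ.K b = Kn l b := fun b => rfl
        have hL : ∀ b, τ.L b = Ln l b := fun b => rfl
        refine ⟨τ, ?_, fun C hC => ?_, ?_, ?_⟩
        · rintro b ⟨hb, hb'⟩ h
          rw [hWsucc t ht] at hb'
          exact hb' ⟨hb, h⟩
        · obtain ⟨A₁, hA₁, hint⟩ := exists_integral_equiv M N hN ε δ hε hδ hnd D C hC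
          obtain ⟨A₂, hsum⟩ := exists_sum_div_equiv κ l
          obtain ⟨A₃, hA₃, hnumA⟩ := (hg l).2.2 ((1 / 2) ^ J) (by positivity)
          obtain ⟨A₄, hA₄, hdenA⟩ := (hg' l).2.2 ((1 / 2) ^ J) (by positivity)
          -- The factors compare the integral with the sum over the centers, that sum with the
          -- stratum quotient, and the numerator and denominator of the latter with polynomials in
          -- b.
          refine ⟨A₁.toNNReal * A₂ * (A₃ * A₄).toNNReal, ?_⟩
          rintro b ⟨hb, hb'⟩ hnear hbd
          obtain ⟨hl1, hl2⟩ := norm_evalAt_genLead hnear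
          have hne0 : evalAt b (genLead M N) ≠ 0 := by
            rw [← norm_pos_iff]
            exact lt_of_lt_of_le (by positivity) hl1
          obtain ⟨α, hα⟩ := exists_isRootFamily hN hne0
          obtain ⟨i1, i2⟩ := hint b α hα hne0 hnear hbd
          obtain ⟨n1, n2⟩ := hnumA (evalAt b) α hα hl1 hl2
          obtain ⟨d1, d2⟩ := hdenA (evalAt b) α hα hl1 hl2
          have hKne : stratNum (Xf (evalAt b) α) (Yf (evalAt b) α) l ≠ 0 := by
            intro h
            rw [hWsucc t ht] at hb'
            exact hb' ⟨hb, ((hg l).eq_zero_iff hα hne0).2 h⟩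
          obtain ⟨s1, s2⟩ := hsum (Xf (evalAt b) α) (Yf (evalAt b) α)
            (fun n hn hn' => hnum t ht.le b hb α hα hne0 n (by omega) hn') hKne
          have hE : ∑ k : κ, ENNReal.ofReal (localNum ε (polyP b) (α k.1) k.2) /
              ENNReal.ofReal (localDen (N 0) ε δ (polyQ b) (α k.1) k.2) =
              ∑ k, (Xf (evalAt b) α k : ℝ≥0∞) / Yf (evalAt b) α k := by
            refine Finset.sum_congr rfl fun k _ => ?_
            rw [← (hfam D b α k).1, ← (hfam D b α k).2, ENNReal.ofReal_coe_nnreal,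
              ENNReal.ofReal_coe_nnreal]
          rw [hE] at i1 i2
          have v1 := div_le_of_equiv hA₃ hA₄ n1 d2
          have v2 := div_le_of_equiv hA₃ hA₄ n2 d1
          rw [ENNReal.ofReal_coe_nnreal, ENNReal.ofReal_coe_nnreal] at v1 v2
          have hv : τ.value b = ENNReal.ofReal (absPower (fun i => evalAt b (g l i)) (eg l)) /
            ENNReal.ofReal (absPower (fun i => evalAt b (g' l i)) (eg' l)) := rfl
          rw [← hv] at v1 v2
          push_cast
          change _ ≤ ENNReal.ofReal A₁ * A₂ * ENNReal.ofReal (A₃ * A₄) * _ ∧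
            _ ≤ ENNReal.ofReal A₁ * A₂ * ENNReal.ofReal (A₃ * A₄) * _
          constructor
          · calc _ ≤ _ := i1
              _ ≤ ENNReal.ofReal A₁ * (A₂ * (ENNReal.ofReal (A₃ * A₄) * τ.value b)) := by
                gcongr
                refine s1.trans ?_
                gcongr
              _ = _ := by ring
          · calc _ ≤ _ := v1
              _ ≤ ENNReal.ofReal (A₃ * A₄) * (A₂ * (ENNReal.ofReal A₁ *
                  ∫⁻ z in Metric.ball (0 : ℂ) 1, ratPower ε δ b z)) := by
                gcongr
                refine s2.trans ?_
                gcongr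
              _ = _ := by ring
        · exact hWsucc t ht
        · intro b hb hb0
          rw [hK] at hb0
          rw [hL]
          -- Without leading coefficient there is no family of centers; here the factor `lc` built
          -- into the denominator makes it vanish.
          by_cases hne0 : evalAt b (genLead M N) = 0
          · exact (hg' l).eq_zero hne0
          obtain ⟨α, hα⟩ := exists_isRootFamily hN hne0
          refine ((hg' l).eq_zero_iff hα hne0).2 ?_
          have hb1 : b ∈ W (t + 1) := by rw [hWsucc t ht]; exact ⟨hb, hb0⟩
          have hbc : b ∈ coeffSpace M N := by rw [hWle t ht.le] at hb; exact hb.1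
          exact stratDen_eq_zero (hX b hbc α) fun n hn hn' =>
            hnum (t + 1) ht b hb1 α hα hne0 n hn hn'
      -- The last step, down to the empty set. The constant 1 has no zeros, and the estimate is
      -- vacuous: the leading coefficient vanishes, so Q_0 is not near z^{N_0}.
      · refine ⟨ARP.one ℤ _, fun b _ => by rw [ARP.one_K]; exact one_ne_zero, fun C hC => ⟨0, ?_⟩,
          ?_, fun b _ h => ?_⟩
        · rintro b ⟨hb, -⟩ hnear
          have h := (norm_evalAt_genLead hnear).1
          rw [hlead b hb, norm_zero] at h
          exact absurd h (not_le.2 (by positivity))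
        · rw [hWend]
          ext b
          simp [ARP.one_K]
        · rw [ARP.one_K] at h
          exact absurd h one_ne_zero)
  refine ⟨n, U, T, fun l => ?_, h2, ?_, h4, h5⟩
  · obtain ⟨t, -, ht⟩ := h1 l
    rw [ht]
    by_cases htc : t ≤ c
    · refine ⟨(Finset.Ico (c - t) c).biUnion fun n => Finset.univ.image fun i =>
        MvPolynomial.map (Int.castRingHom ℂ) (g n i), ?_⟩
      rw [hWle t htc]
      ext b
      have hev : ∀ f : MvPolynomial (CoeffIndex M N) ℤ,
          MvPolynomial.eval b (MvPolynomial.map (Int.castRingHom ℂ) f) = evalAt b f := by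
        intro f
        rw [MvPolynomial.eval_map, evalAt_apply, MvPolynomial.aeval_def, algebraMap_int_eq]
      simp only [Set.mem_ofPred_eq, Finset.mem_biUnion, Finset.mem_Ico, Finset.mem_image,
        Finset.mem_univ, true_and]
      refine and_congr_right fun _ => ⟨?_, fun h n hn hn' => ?_⟩
      · rintro h f ⟨n, ⟨hn, hn'⟩, i, rfl⟩
        rw [hev]
        exact (absPower_eq_zero_iff _ (hg n).1).1 (h n hn hn') i
      · exact (absPower_eq_zero_iff _ (hg n).1).2 fun i => by
          rw [← hev]
          exact h _ ⟨n, ⟨hn, hn'⟩, i, rfl⟩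
    -- The empty set is cut out by the constant polynomial 1.
    · refine ⟨{1}, ?_⟩
      have : W t = ∅ := if_neg htc
      rw [this]
      ext b
      simp
  · rw [h3, hWle 0 (Nat.zero_le _)]
    ext b
    simp only [Set.mem_ofPred_eq, and_iff_left_iff_imp]
    intro _ n hn hn'
    omega

end Assembly

end

theorem theorem4 {I J : ℕ} [NeZero J] (M : Fin I → ℕ) (N : Fin J → ℕ) (hN : Antitone N)
    (ε δ : ℚ) (hε : 0 ≤ ε) (hδ : 0 ≤ δ) (hnd : Nondegenerate M N ε δ) :
    ∃ s : ℝ, 0 < s ∧ s < 1 ∧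
    ∃ (n : ℕ) (U : Fin (n + 1) → Set (CoeffIndex M N → ℂ)) (T : Fin n → ARP ℤ (CoeffIndex M N)),
      -- the chain
      ((∀ l, IsAlgebraicIn (coeffSpace M N) (U l)) ∧ StrictAnti U ∧
        U 0 = coeffSpace M N ∧ U (Fin.last n) = ∅) ∧
      -- the numerator does not vanish on the strata
      (∀ l : Fin n, ∀ b ∈ U l.castSucc \ U l.succ, (T l).K b ≠ 0 ∧ (T l).value b ≠ 0) ∧
      -- the size of the integral on the strata
      (∀ C : ℝ, 0 < C → ∃ A : ℝ≥0, ∀ l : Fin n, ∀ b ∈ U l.castSucc \ U l.succ,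
        polyNorm (polyQ b 0 - Polynomial.X ^ N 0) < s →
        (∀ j, j ≠ 0 → polyNorm (polyQ b j) < C) →
          b ∈ (T l).domain ∧
          ∫⁻ z in Metric.ball (0 : ℂ) 1, ratPower ε δ b z ≤ A * (T l).value b ∧
          (T l).value b ≤ A * ∫⁻ z in Metric.ball (0 : ℂ) 1, ratPower ε δ b z) ∧
      -- the next variety is the zero set of the numerator
      (∀ l : Fin n, U l.succ = {b ∈ U l.castSucc | (T l).K b = 0} ∧
        {b ∈ U l.castSucc | (T l).K b = 0} =
          {b ∈ U l.castSucc | (T l).K b = 0 ∧ (T l).L b = 0}) := by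
  refine ⟨(1 / 2) ^ (N 0 + 1), by positivity,
    pow_lt_one₀ (by norm_num) (by norm_num) (Nat.succ_ne_zero _), ?_⟩
  by_cases hI : Nonempty (Fin I)
  · obtain ⟨n, U, T, h1, h2, h3, h4, h5⟩ := exists_chain hN ε δ hε hδ hnd
    refine ⟨n, U, T, ⟨h1, h2, h3, h4⟩, fun l b hb => ?_, fun C hC => ?_, fun l => ?_⟩
    · have := (h5 l).1 b hb
      exact ⟨this, ARP.value_ne_zero this⟩
    · choose A hA using fun l => (h5 l).2.1 C hC
      -- The sum over the finitely many strata gives one constant for all of them.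
      refine ⟨∑ l, A l, fun l b hb hnear hbd => ⟨(h5 l).1 b hb, ?_⟩⟩
      obtain ⟨i1, i2⟩ := hA l b hb hnear hbd
      have hle : (A l : ℝ≥0∞) ≤ (∑ l, A l : ℝ≥0) := by
        exact_mod_cast Finset.single_le_sum (fun _ _ => zero_le) (Finset.mem_univ l)
      exact ⟨i1.trans (by gcongr), i2.trans (by gcongr)⟩
    · refine ⟨(h5 l).2.2.1, ?_⟩
      ext b
      exact ⟨fun hb => ⟨hb.1, hb.2, (h5 l).2.2.2 b hb.1 hb.2⟩, fun hb => ⟨hb.1, hb.2.1⟩⟩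
  -- Without any P_i the coefficient space is empty, and the chain of length 0 serves.
  · have hempty : coeffSpace M N = ∅ := by
      ext b
      simp only [Set.mem_empty_iff_false, iff_false]
      rintro ⟨x, -⟩
      exact hI ⟨x.1⟩
    refine ⟨0, fun _ => coeffSpace M N, fun l => l.elim0, ⟨fun _ => ⟨∅, by simp⟩, ?_, rfl, hempty⟩,
      fun l => l.elim0, fun _ _ => ⟨0, fun l => l.elim0⟩, fun l => l.elim0⟩
    intro a b hab
    omega
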